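/- **Setting.** Let $(\Omega,\mathcal F,\mathbb P)$ be a probability space, $d,m\ge 1$, $X$ an $\mathbb R^d$-valued random variable, and $f:\mathbb R^d\times\mathbb R^m\to\mathbb R$ with $f(X,\theta)\in L^1(\mathbb P)$ for all $\theta$; put $F(\theta)=\mathbb E[f(X,\theta)]$. Let $g:\mathbb R^d\times\mathbb R^m\to\mathbb R^m$ be measurable, $b(\theta)=\mathbb E[g(X,\theta)]$, let $(X_n)_{n\ge1}$ be i.i.d. copies of $X$, let $\theta_0\in L^2(\mathbb P)$ be independent of $(X_n)_{n\ge1}$, and let $$\theta_n=\theta_{n-1}-\gamma_n\,g(X_n,\theta_{n-1}),\qquad n\ge1 .$$ Norms are Euclidean. Assume the following. * (H1) $\inf F>-\infty$, $F$ is differentiable and $\|\nabla F(\theta')-\nabla F(\theta)\|\le L\|\theta'-\theta\|^\alpha$ for all $\theta,\theta'$, where $L>0$ and $\alpha\in(0,1]$. * (H2) There are $C_0>0$ and $0<\kappa\le c$ such that, for all $\theta$, $\mathbb E\|g(X,\theta)\|^2\le C_0(F(\theta)-\inf F+1)$, $b(\theta)^\top\nabla F(\theta)\ge\kappa\|\nabla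 F(\theta)\|^2$ and $\|b(\theta)\|\le c\|\nabla F(\theta)\|$. * (H3) $\gamma_n>0$ for $n\ge1$, $\sum_n\gamma_n=\infty$ and $\sum_n\gamma_n^{1+\alpha}<\infty$. * (H4) $F(\theta)\to\infty$ as $\|\theta\|\to\infty$. * (H5) $F$ is Łojasiewicz: it is $C^1$, and for every $\theta_\star$ with $\nabla F(\theta_\star)=0$ there are an open neighbourhood $\mathcal V$ of $\theta_\star$, $\beta\in(0,1)$ and $\zeta>0$ with $|F(\theta)-F(\theta_\star)|^\beta\le\zeta\|\nabla F(\theta)\|$ for $\theta\in\mathcal V$. ($F$ is *globally Łojasiewicz* if it is $C^1$ and one can always take $\mathcal V=\mathbb R^m$.) * (H6) (i) Either (a) $\ln(\gamma_{n-1}/\gamma_n)=o(\gamma_n)$, or (b) $\ln(\gamma_{n-1}/\gamma_n)\sim\gamma_n/\gamma_\star$ for some $\gamma_\star>0$; (ii) $\sum_n\gamma_n/S_n=\infty$, where $S_n=\sum_{k=1}^n\gamma_k$; (iii) $\gamma_n=O(S_n^{-\rho})$ for some $\rho>\frac1\alpha$. For $K\subset\mathbb R^m$, $\beta>0$, $\zeta>0$,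 let $\mathrm L(K,\beta,\zeta)$ be the property: every $\theta_\star\in K$ with $\nabla F(\theta_\star)=0$ has an open neighbourhood on which $|F(\theta)-F(\theta_\star)|^\beta\le\zeta\|\nabla F(\theta)\|$. Let $\mathcal A$ be the random set of accumulation points of $(\theta_n)_{n\ge0}$ and $\mathcal L_\ell=\{F\le\ell\}$. For $\beta>\frac12$ put $r(\beta)=\frac1{2\beta-1}\wedge(\alpha\rho-1)\wedge\frac{\rho-1}2$. For $\delta\in(0,1)$, $\beta\in(0,1]$ and $z>0$, say that *the local rates $\mathrm R(\delta,\beta,z)$ hold* if * in case $\beta\le\frac12$ and, under (H6)(i)(b), $\kappa\gamma_\star>z\,(\alpha\vee\frac12)$: there is $C_\delta>0$ such that for every $n\ge1$, $F(\theta_n)-F_\star\le C_\delta\,\gamma_n^{\alpha\wedge\frac12}$ with probability at least $1-\delta$; * in case $\beta>\frac12$: $r(\beta)>0$ and there is $C_\delta>0$ such that for every $n\ge1$, $F(\theta_n)-F_\star\le C_\delta\,S_n^{-r(\beta)}$ with probability at least $1-\delta$. **Theorem.** Under (H1)–(H6), $F(\theta_n)$ converges almost surely to a real limit, denoted $F_\star$,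 and the following hold. 1. For every $\delta\in(0,1)$ there is $\ell_\delta>\inf F$ such that $\mathbb P(\mathcal A\subset\mathcal L_{\ell_\delta})\ge1-\delta$ and: * (a) there are $\beta_\delta\in(0,1)$ and $\zeta_\delta>0$ with $\mathrm L(\mathcal L_{\ell_\delta},\beta_\delta,\zeta_\delta)$; and for all such $(\beta_\delta,\zeta_\delta)$ the local rates $\mathrm R(\delta,\beta_\delta,\zeta_\delta^{1/\beta_\delta})$ hold; * (b) there is $\beta_\delta\in(0,1)$ with $\mathrm L(\mathcal L_{\ell_\delta},\beta_\delta,1)$; and for every such $\beta_\delta$ the local rates $\mathrm R(\delta,\beta_\delta,1)$ hold. 2. There is $\beta\in(0,1]$ with $\mathrm L(\mathbb R^m,\beta,1)$; and for every such $\beta$ and every $\delta\in(0,1)$ the local rates $\mathrm R(\delta,\beta,1)$ hold. 3. If $F$ is globally Łojasiewicz, there are $\beta\in[\frac\alpha{1+\alpha},1)$ and $\zeta>0$ such that $$(F(\theta)-\inf F)^\beta\le\zeta\|\nabla F(\theta)\|,\qquad\theta\in\mathbb R^m. \tag{G}$$ For all $\beta\in(\frac\alpha{1+\alpha},1)\cup\{\frac12\}$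 and $\zeta>0$ satisfying (G): * if $\beta\le\frac12$ and if, under (H6)(i)(b), $$\kappa\gamma_\star>\zeta^{2+\lambda\frac{1+\alpha}\alpha}\Big(\frac{(1+\alpha)L^{1/\alpha}}\alpha\Big)^{\lambda}\alpha,\qquad \lambda=\frac{1-2\beta}{\frac{1+\alpha}\alpha\beta-1}\ \text{ if }\beta<\tfrac12,\quad \lambda=0\ \text{ if }\beta=\tfrac12,$$ then there is $C>0$ such that for all $\delta\in(0,1)$ and $n\ge1$, $F(\theta_n)-\inf F\le\frac C\delta\gamma_n^\alpha$ with probability at least $1-\delta$; * if $\beta>\frac12$, then $r=\frac1{2\beta-1}\wedge(\alpha\rho-1)>0$ and there is $C>0$ such that for all $\delta\in(0,1)$ and $n\ge1$, $F(\theta_n)-\inf F\le\frac C\delta S_n^{-r}$ with probability at least $1-\delta$. -/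

import Mathlib

open MeasureTheory ProbabilityTheory Filter Topology Asymptotics

/-- `ℝⁿ` with its Euclidean norm. -/
abbrev Vec (n : ℕ) : Type := EuclideanSpace ℝ (Fin n)

/-- `F` is bounded below and differentiable, and its gradient is `(L, α)`-Hölder continuous. -/
def HolderSmooth {m : ℕ} (F : Vec m → ℝ) (L α : ℝ) : Prop :=
  BddBelow (Set.range F) ∧ Differentiable ℝ F ∧
    ∀ θ θ' : Vec m, ‖gradient F θ' - gradient F θ‖ ≤ L * ‖θ' - θ‖ ^ α

/-- The mean direction `b(θ) = E[g(X, θ)]` of the stochastic gradient oracle `g`. -/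
noncomputable def meanOracle {Ω : Type*} [MeasurableSpace Ω] (P : Measure Ω) {d m : ℕ}
    (X : Ω → Vec d) (g : Vec d → Vec m → Vec m) (θ : Vec m) : Vec m :=
  ∫ ω, g (X ω) θ ∂P

/-- The growth and bias conditions on the oracle, with drift constant `κ`:
`E‖g(X, θ)‖² ≤ C (F(θ) - inf F + 1)`, `b(θ)ᵀ ∇F(θ) ≥ κ ‖∇F(θ)‖²` and `‖b(θ)‖ ≤ c ‖∇F(θ)‖`
for some `C > 0` and some `c ≥ κ > 0`. -/
def OracleCondition {Ω : Type*} [MeasurableSpace Ω] (P : Measure Ω) {d m : ℕ}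
    (X : Ω → Vec d) (g : Vec d → Vec m → Vec m) (F : Vec m → ℝ) (κ : ℝ) : Prop :=
  0 < κ ∧
  (∃ C : ℝ, 0 < C ∧ ∀ θ : Vec m, MemLp (fun ω => g (X ω) θ) 2 P ∧
    ∫ ω, ‖g (X ω) θ‖ ^ 2 ∂P ≤ C * ((F θ - ⨅ θ' : Vec m, F θ') + 1)) ∧
  (∀ θ : Vec m, κ * ‖gradient F θ‖ ^ 2 ≤ inner ℝ (meanOracle P X g θ) (gradient F θ)) ∧
  (∃ c : ℝ, κ ≤ c ∧ ∀ θ : Vec m, ‖meanOracle P X g θ‖ ≤ c * ‖gradient F θ‖)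

/-- The iterates `θ_n = θ_{n-1} - γ_n g(X_n, θ_{n-1})`, `n ≥ 1`, started at `θ_0`
(`γ 0` and `Xs 0` are not used). -/
def sgd {Ω : Type*} {d m : ℕ} (g : Vec d → Vec m → Vec m) (γ : ℕ → ℝ)
    (Xs : ℕ → Ω → Vec d) (θ₀ : Ω → Vec m) : ℕ → Ω → Vec m
  | 0 => θ₀
  | n + 1 => fun ω =>
      sgd g γ Xs θ₀ n ω - γ (n + 1) • g (Xs (n + 1) ω) (sgd g γ Xs θ₀ n ω)

/-- The limit `F_⋆` of the function values along a random trajectory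
(meaningful at the `ω` for which the limit exists). -/
noncomputable def limitValue {Ω : Type*} {m : ℕ} (F : Vec m → ℝ) (θ : ℕ → Ω → Vec m) (ω : Ω) : ℝ :=
  limUnder atTop (fun n => F (θ n ω))

/-- The set `𝒜(ω)` of accumulation points of a random trajectory. -/
def accPoints {Ω : Type*} {m : ℕ} (θ : ℕ → Ω → Vec m) (ω : Ω) : Set (Vec m) :=
  {x | MapClusterPt x atTop (fun n => θ n ω)}

/-- The level set `{θ | F(θ) ≤ ℓ}`. -/
def levelSet {m : ℕ} (F : Vec m → ℝ) (l : ℝ) : Set (Vec m) := {θ | F θ ≤ l}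

/-- The partial sums `∑_{k=1}^n γ_k`. -/
def stepSum (γ : ℕ → ℝ) (n : ℕ) : ℝ := ∑ k ∈ Finset.Icc 1 n, γ k

/-- Basic step sizes: `γ_n > 0`, `∑ γ_n = ∞` and `∑ γ_n^{1+α} < ∞` (over `n ≥ 1`). -/
def StepSizes (γ : ℕ → ℝ) (α : ℝ) : Prop :=
  (∀ n : ℕ, 1 ≤ n → 0 < γ n) ∧ Tendsto (stepSum γ) atTop atTop ∧
    Summable (fun n : ℕ => γ (n + 1) ^ (1 + α))

/-- `ln(γ_{n-1}/γ_n) = o(γ_n)`. -/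
def SlowSteps (γ : ℕ → ℝ) : Prop :=
  (fun n : ℕ => Real.log (γ n / γ (n + 1))) =o[atTop] fun n : ℕ => γ (n + 1)

/-- `ln(γ_{n-1}/γ_n) ∼ γ_n/γ_⋆`. -/
def CriticalSteps (γ : ℕ → ℝ) (γs : ℝ) : Prop :=
  (fun n : ℕ => Real.log (γ n / γ (n + 1))) ~[atTop] fun n : ℕ => γ (n + 1) / γs

/-- The finer step-size conditions with exponent `ρ > 1/α`. -/
def FineStepSizes (γ : ℕ → ℝ) (α ρ : ℝ) : Prop :=
  (SlowSteps γ ∨ ∃ γs : ℝ, 0 < γs ∧ CriticalSteps γ γs) ∧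
  Tendsto (fun n : ℕ => ∑ k ∈ Finset.Icc 1 n, γ k / stepSum γ k) atTop atTop ∧
  1 / α < ρ ∧ γ =O[atTop] fun n : ℕ => stepSum γ n ^ (-ρ)

/-- `F` satisfies a local Łojasiewicz inequality with the same exponent `β` and the same constant
`ζ` around every stationary point in `K`. -/
def UniformLojasiewicz {m : ℕ} (F : Vec m → ℝ) (K : Set (Vec m)) (β ζ : ℝ) : Prop :=
  ∀ θs ∈ K, gradient F θs = 0 → ∃ V : Set (Vec m), IsOpen V ∧ θs ∈ V ∧
    ∀ θ ∈ V, |F θ - F θs| ^ β ≤ ζ * ‖gradient F θ‖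

/-- `F` is Łojasiewicz: it is `C¹` and satisfies a local Łojasiewicz inequality around every
stationary point, with parameters that may depend on the point. -/
def Lojasiewicz {m : ℕ} (F : Vec m → ℝ) : Prop :=
  ContDiff ℝ 1 F ∧ ∀ θs : Vec m, gradient F θs = 0 →
    ∃ V : Set (Vec m), IsOpen V ∧ θs ∈ V ∧ ∃ β ζ : ℝ, 0 < β ∧ β < 1 ∧ 0 < ζ ∧
      ∀ θ ∈ V, |F θ - F θs| ^ β ≤ ζ * ‖gradient F θ‖

/-- `F` is globally Łojasiewicz: the neighbourhoods can be taken to be the whole space. -/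
def GloballyLojasiewicz {m : ℕ} (F : Vec m → ℝ) : Prop :=
  ContDiff ℝ 1 F ∧ ∀ θs : Vec m, gradient F θs = 0 →
    ∃ β ζ : ℝ, 0 < β ∧ β < 1 ∧ 0 < ζ ∧
      ∀ θ : Vec m, |F θ - F θs| ^ β ≤ ζ * ‖gradient F θ‖

/-- The global inequality `(F(θ) - inf F)^β ≤ ζ ‖∇F(θ)‖` on the whole space. -/
def GlobalInequality {m : ℕ} (F : Vec m → ℝ) (β ζ : ℝ) : Prop :=
  ∀ θ : Vec m, (F θ - ⨅ θ' : Vec m, F θ') ^ β ≤ ζ * ‖gradient F θ‖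

/-- The exponent `1/(2β-1) ∧ (αρ-1) ∧ (ρ-1)/2`. -/
noncomputable def localExponent (α ρ β : ℝ) : ℝ :=
  min (1 / (2 * β - 1)) (min (α * ρ - 1) ((ρ - 1) / 2))

/-- The exponent `1/(2β-1) ∧ (αρ-1)`. -/
noncomputable def globalExponent (α ρ β : ℝ) : ℝ :=
  min (1 / (2 * β - 1)) (α * ρ - 1)

/-- `λ = (1-2β) / ((1+α)β/α - 1)` if `β < 1/2`, and `λ = 0` otherwise. -/
noncomputable def globalLambda (α β : ℝ) : ℝ :=
  if β < 1 / 2 then (1 - 2 * β) / ((1 + α) / α * β - 1) else 0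

/-- The last-iterate rates at confidence level `1 - δ` in the local settings. If `β ≤ 1/2`, and if
`κ γ_⋆ > z (α ∨ 1/2)` in the case of critical steps, the rate is `γ_n^{α ∧ 1/2}`; if `β > 1/2`, it
is `(∑_{k ≤ n} γ_k)^{-r}` with `r = 1/(2β-1) ∧ (αρ-1) ∧ (ρ-1)/2 > 0`. -/
def LocalRates {Ω : Type*} [MeasurableSpace Ω] (P : Measure Ω) {m : ℕ} (F : Vec m → ℝ)
    (θ : ℕ → Ω → Vec m) (γ : ℕ → ℝ) (α κ ρ δ β z : ℝ) : Prop :=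
  (β ≤ 1 / 2 →
    (∀ γs : ℝ, 0 < γs → CriticalSteps γ γs → z * max α (1 / 2) < κ * γs) →
    ∃ C : ℝ, 0 < C ∧ ∀ n : ℕ, 1 ≤ n →
      1 - δ ≤ P.real {ω | F (θ n ω) - limitValue F θ ω ≤ C * γ n ^ min α (1 / 2)}) ∧
  (1 / 2 < β →
    0 < localExponent α ρ β ∧
    ∃ C : ℝ, 0 < C ∧ ∀ n : ℕ, 1 ≤ n →
      1 - δ ≤ P.real {ω | F (θ n ω) - limitValue F θ ω
        ≤ C * stepSum γ n ^ (-localExponent α ρ β)})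

/-! Everything rests on one pathwise descent inequality (`gap_succ_le`): in one step the gap `F -
inf F` loses `κ γ ‖∇F‖²`, up to `γ` times a centred noise and a term of order `γ^(1+α) (1 + ‖g‖²)`.
Conditionally on the past, `‖g‖²` is at most a multiple of `gap + 1`, and `∑ γ^(1+α)` converges, so
the Robbins–Siegmund argument applies: the expected gap stays bounded, `∑ γ E‖∇F‖²` is finite, and
the gap converges almost surely. The accumulated noise converges as well, each coordinate being a
martingale bounded in `L²`, which prevents the gradient from oscillating: it tends to zero
(`tendsto_norm_zero_of_recursion`). By coercivity almost every trajectory is bounded, so its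
accumulation points are stationary with value `F_⋆`, and a Łojasiewicz inequality near them holds
along the tail of the trajectory (`UniformLojasiewicz.eventually`).

Such an inequality is a drift bound `φ(F - l) ≤ κ ‖∇F‖²`, with `φ` linear if `β ≤ 1/2` and `φ(x) = μ
|x|^(2β)` if `β > 1/2`. `RateWeights` isolates the deterministic part of the rate proof: weights `w`
whose growth is compensated by the drift, and for which the weighted errors sum to `O(w_n R_n)`.
With `S_n` the sum of the steps, the choices are `w = exp(μ S_n)` for the linear drift and `w =
S_n^K` for the superlinear one.

If the drift is global, expectations remove the noise and Markov's inequality concludes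
(`exists_global_rate`). In the local setting the drift holds only from a random time on and `F_⋆`
depends on the whole future, so the recursion is unrolled pathwise (`weighted_gap_le`) on an event
where a fixed time `J` suffices. As the weights are deterministic, `F_⋆` is a mere shift and the
weighted noise is still a martingale. Its variance is compared with the finite sum `∑ γ E‖∇F‖²`,
which requires `w_{k+1}² γ_{k+1} ≤ C (w_n R_n)²` (`NoiseWeights`); this extra requirement is what
limits the local exponents. -/

/-! ### Hölder smooth functions: descent and gradient bounds. -/

namespace HolderSmooth

variable {m : ℕ} {F : Vec m → ℝ} {L α : ℝ}

theorem iInf_le (h : HolderSmooth F L α) (θ : Vec m) : (⨅ θ' : Vec m, F θ') ≤ F θ :=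
  ciInf_le h.1 θ

theorem gap_nonneg (h : HolderSmooth F L α) (θ : Vec m) : 0 ≤ F θ - ⨅ θ' : Vec m, F θ' :=
  sub_nonneg.2 (h.iInf_le θ)

theorem continuous (h : HolderSmooth F L α) : Continuous F := h.2.1.continuous

theorem continuous_gradient (h : HolderSmooth F L α) (hα : 0 < α) : Continuous (gradient F) := by
  refine continuous_iff_continuousAt.2 fun θ => ?_
  rw [ContinuousAt, tendsto_iff_norm_sub_tendsto_zero]
  refine squeeze_zero (fun _ => norm_nonneg _) (fun θ' => h.2.2 θ θ') ?_
  have h1 : Continuous fun θ' : Vec m => L * ‖θ' - θ‖ ^ α :=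
    continuous_const.mul ((continuous_id.sub continuous_const).norm.rpow_const
      fun _ => Or.inr hα.le)
  have h2 := h1.tendsto θ
  simpa [Real.zero_rpow hα.ne'] using h2

/-- The descent inequality for a function with Hölder continuous gradient. -/
theorem descent (h : HolderSmooth F L α) (hα : 0 < α) (θ v : Vec m) :
    F (θ + v) ≤ F θ + inner ℝ (gradient F θ) v + L / (1 + α) * ‖v‖ ^ (1 + α) := by
  have hα1 : 0 < 1 + α := by linarith
  -- `φ` is the defect of the inequality along the segment. The Hölder bound makes its derivative
  -- nonpositive on `(0, 1)`, and `φ 1 ≤ φ 0` is the claim.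
  let φ : ℝ → ℝ := fun t =>
    F (θ + t • v) - t * inner ℝ (gradient F θ) v - L / (1 + α) * t ^ (1 + α) * ‖v‖ ^ (1 + α)
  have hd : ∀ t : ℝ, HasDerivAt φ
      (inner ℝ (gradient F (θ + t • v)) v - inner ℝ (gradient F θ) v
        - L * t ^ α * ‖v‖ ^ (1 + α)) t := by
    intro t
    have h1 : HasDerivAt (fun t : ℝ => F (θ + t • v)) (inner ℝ (gradient F (θ + t • v)) v) t := by
      have hF := (h.2.1 (θ + t • v)).hasGradientAt.hasFDerivAt
      have hl : HasDerivAt (fun t : ℝ => θ + t • v) v t := by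
        simpa using ((hasDerivAt_id t).smul_const v).const_add θ
      exact (hF.comp_hasDerivAt t hl).congr_deriv (by simp)
    have h2 : HasDerivAt (fun t : ℝ => t * inner ℝ (gradient F θ) v)
        (inner ℝ (gradient F θ) v) t := by
      simpa using (hasDerivAt_id t).mul_const (inner ℝ (gradient F θ) v)
    have h3 : HasDerivAt (fun t : ℝ => L / (1 + α) * t ^ (1 + α) * ‖v‖ ^ (1 + α))
        (L * t ^ α * ‖v‖ ^ (1 + α)) t := by
      have := ((Real.hasDerivAt_rpow_const (x := t) (p := 1 + α)
        (Or.inr (by linarith))).const_mul (L / (1 + α))).mul_const (‖v‖ ^ (1 + α))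
      refine this.congr_deriv ?_
      rw [show 1 + α - 1 = α by ring]
      field_simp
    exact (h1.sub h2).sub h3
  have hanti : AntitoneOn φ (Set.Icc 0 1) := by
    refine antitoneOn_of_deriv_nonpos (convex_Icc 0 1)
      (fun t _ => (hd t).continuousAt.continuousWithinAt)
      (fun t _ => (hd t).differentiableAt.differentiableWithinAt) fun t ht => ?_
    rw [interior_Icc] at ht
    rw [(hd t).deriv, ← inner_sub_left]
    have h4 : inner ℝ (gradient F (θ + t • v) - gradient F θ) v
        ≤ ‖gradient F (θ + t • v) - gradient F θ‖ * ‖v‖ := real_inner_le_norm _ _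
    have h5 := h.2.2 θ (θ + t • v)
    rw [add_sub_cancel_left, norm_smul, Real.norm_of_nonneg ht.1.le,
      Real.mul_rpow ht.1.le (norm_nonneg _)] at h5
    have h6 : ‖v‖ ^ (1 + α) = ‖v‖ ^ α * ‖v‖ := by
      rw [add_comm, Real.rpow_add' (norm_nonneg _) (by linarith), Real.rpow_one]
    rw [h6]
    nlinarith [mul_le_mul_of_nonneg_right h5 (norm_nonneg v)]
  have := hanti (Set.left_mem_Icc.2 zero_le_one) (Set.right_mem_Icc.2 zero_le_one) zero_le_one
  simp only [φ, one_smul, zero_smul, add_zero, Real.one_rpow, Real.zero_rpow hα1.ne'] at this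
  linarith

/-- The gradient is controlled by the optimality gap. -/
theorem gradient_rpow_le (h : HolderSmooth F L α) (hL : 0 < L) (hα : 0 < α) (θ : Vec m) :
    ‖gradient F θ‖ ^ ((1 + α) / α)
      ≤ (1 + α) * L ^ (1 / α) / α * (F θ - ⨅ θ' : Vec m, F θ') := by
  have hα1 : 0 < 1 + α := by linarith
  set G := ‖gradient F θ‖ with hG
  rcases (norm_nonneg (gradient F θ)).eq_or_lt with h0 | h0
  · rw [hG, ← h0, Real.zero_rpow (by positivity)]
    exact mul_nonneg (by positivity) (h.gap_nonneg θ)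
  -- A step of length `t` along the normalized negative gradient, with `t` minimizing `-t G + L
  -- t^(1+α) / (1+α)`; the value reached is still at least `inf F`.
  · rw [← hG] at h0
    set t : ℝ := (G / L) ^ (1 / α) with ht
    have htpos : 0 < t := Real.rpow_pos_of_pos (div_pos h0 hL) _
    have h1 := h.descent hα θ (-(t / G) • gradient F θ)
    have h2 : ‖-(t / G) • gradient F θ‖ = t := by
      rw [norm_smul, ← hG, norm_neg, Real.norm_of_nonneg (by positivity)]
      field_simp
    rw [h2, inner_smul_right, real_inner_self_eq_norm_sq, ← hG] at h1
    have h3 := h.iInf_le (θ + -(t / G) • gradient F θ)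
    have h4 : t ^ α = G / L := by
      rw [ht, ← Real.rpow_mul (by positivity), one_div_mul_cancel hα.ne', Real.rpow_one]
    have h5 : t ^ (1 + α) = t * (G / L) := by
      rw [Real.rpow_add htpos, Real.rpow_one, h4]
    have h6 : G ^ ((1 + α) / α) = G * t * L ^ (1 / α) := by
      rw [ht, Real.div_rpow h0.le hL.le, show (1 + α) / α = 1 + 1 / α by field_simp; ring,
        Real.rpow_add h0, Real.rpow_one]
      field_simp
    have h7 : -(t / G) * G ^ 2 = -(t * G) := by field_simp
    rw [h5, h7] at h1
    have h8 : L / (1 + α) * (t * (G / L)) = t * G / (1 + α) := by field_simp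
    rw [h8] at h1
    have h9 : t * G * α / (1 + α) ≤ F θ - ⨅ θ' : Vec m, F θ' := by
      have : t * G * α / (1 + α) = t * G - t * G / (1 + α) := by field_simp; ring
      linarith
    have hLα : 0 < L ^ (1 / α) := Real.rpow_pos_of_pos hL _
    calc G ^ ((1 + α) / α) = (1 + α) * L ^ (1 / α) / α * (t * G * α / (1 + α)) := by
          rw [h6]; field_simp
      _ ≤ _ := by gcongr

theorem exists_gradient_sq_le (h : HolderSmooth F L α) (hL : 0 < L) (hα : 0 < α) (hα' : α ≤ 1) :
    ∃ C : ℝ, 0 < C ∧ ∀ θ : Vec m,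
      ‖gradient F θ‖ ^ 2 ≤ C * ((F θ - ⨅ θ' : Vec m, F θ') + 1) := by
  refine ⟨(1 + α) * L ^ (1 / α) / α + 1, by positivity, fun θ => ?_⟩
  have h1 := h.gradient_rpow_le hL hα θ
  have h2 := h.gap_nonneg θ
  have hc : 0 < (1 + α) * L ^ (1 / α) / α := by positivity
  -- Small gradients are absorbed by the `+ 1`; for large ones `(1 + α) / α ≥ 2`, since `α ≤ 1`.
  rcases le_total ‖gradient F θ‖ 1 with h3 | h3
  · nlinarith [norm_nonneg (gradient F θ)]
  · have h4 : ‖gradient F θ‖ ^ (2 : ℝ) ≤ ‖gradient F θ‖ ^ ((1 + α) / α) :=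
      Real.rpow_le_rpow_of_exponent_le h3 (by rw [le_div_iff₀ hα]; linarith)
    rw [Real.rpow_two] at h4
    nlinarith

end HolderSmooth

/-! ### Integrating out an independent variable. -/

/-- Independence makes the joint law a product. An event of the conditioning σ-algebra becomes a
rectangle `t ×ˢ univ`, and Fubini identifies the two set integrals. -/
theorem ProbabilityTheory.IndepFun.condExp_comap {Ω Ω' E : Type*} {mΩ : MeasurableSpace Ω}
    [mΩ' : MeasurableSpace Ω'] [MeasurableSpace E] {P : Measure Ω} [IsProbabilityMeasure P]
    {W : Ω → Ω'} {Y : Ω → E} (hW : Measurable W) (hY : Measurable Y) (hWY : IndepFun W Y P)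
    {h : Ω' → E → ℝ} (hh : Measurable (Function.uncurry h))
    (hint : Integrable (fun ω => h (W ω) (Y ω)) P) :
    P[fun ω => h (W ω) (Y ω) | mΩ'.comap W] =ᵐ[P] fun ω => ∫ y, h (W ω) y ∂(P.map Y) := by
  have hlaw := (indepFun_iff_map_prod_eq_prod_map_map hW.aemeasurable hY.aemeasurable).1 hWY
  have : IsProbabilityMeasure (P.map Y) := Measure.isProbabilityMeasure_map hY.aemeasurable
  have : IsProbabilityMeasure (P.map W) := Measure.isProbabilityMeasure_map hW.aemeasurable
  have hint' : Integrable (Function.uncurry h) ((P.map W).prod (P.map Y)) := by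
    rw [← hlaw, integrable_map_measure hh.aestronglyMeasurable (hW.prodMk hY).aemeasurable]
    exact hint
  have hsm : StronglyMeasurable fun w => ∫ y, h w y ∂(P.map Y) :=
    StronglyMeasurable.integral_prod_right (f := h) hh.stronglyMeasurable
  have hint2 : Integrable (fun ω => ∫ y, h (W ω) y ∂(P.map Y)) P := by
    have h1 : Integrable (fun w => ∫ y, h w y ∂(P.map Y)) (P.map W) := hint'.integral_prod_left
    exact (integrable_map_measure hsm.aestronglyMeasurable hW.aemeasurable).1 h1
  refine (ae_eq_condExp_of_forall_setIntegral_eq hW.comap_le hint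
    (fun s _ _ => hint2.integrableOn) (fun s hs _ => ?_) ?_).symm
  · obtain ⟨t, ht, rfl⟩ := hs
    have h1 : ∫ ω in W ⁻¹' t, h (W ω) (Y ω) ∂P
        = ∫ z in t ×ˢ Set.univ, Function.uncurry h z ∂((P.map W).prod (P.map Y)) := by
      rw [← hlaw, setIntegral_map (ht.prod .univ) hh.aestronglyMeasurable
        (hW.prodMk hY).aemeasurable]
      congr 2
      ext; simp
    have h2 := setIntegral_map (μ := P) ht hsm.aestronglyMeasurable hW.aemeasurable
    rw [h1, setIntegral_prod _ hint'.integrableOn]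
    simp only [Measure.restrict_univ, Function.uncurry_apply_pair]
    exact h2.symm
  · exact (hsm.comp_measurable (comap_measurable W)).aestronglyMeasurable

/-- A sub-σ-algebra `𝒢` is generated by the identity map into `(Ω, 𝒢)`, which reduces this to
`IndepFun.condExp_comap`. Two σ-algebras then live on `Ω`, hence the explicit instances. -/
theorem ProbabilityTheory.Indep.condExp_comp {Ω E E' : Type*} {𝒢 mΩ : MeasurableSpace Ω}
    [mE : MeasurableSpace E] [MeasurableSpace E'] {P : Measure Ω} [IsProbabilityMeasure P]
    (h𝒢 : 𝒢 ≤ mΩ) {Z : Ω → E'} {Y : Ω → E} (hZ : Measurable[𝒢] Z) (hY : Measurable Y)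
    (hind : Indep 𝒢 (mE.comap Y) P) {h : E → E' → ℝ} (hh : Measurable (Function.uncurry h))
    (hint : Integrable (fun ω => h (Y ω) (Z ω)) P) :
    P[fun ω => h (Y ω) (Z ω) | 𝒢] =ᵐ[P] fun ω => ∫ y, h y (Z ω) ∂(P.map Y) := by
  have hid : @Measurable Ω Ω mΩ 𝒢 id := measurable_id'' h𝒢
  have hind' : @IndepFun Ω Ω E mΩ 𝒢 mE id Y P := by
    refine (@IndepFun_iff_Indep Ω Ω E mΩ 𝒢 mE id Y P).2 ?_
    rwa [MeasurableSpace.comap_id]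
  have h1 : @Measurable (Ω × E) ℝ (@Prod.instMeasurableSpace Ω E 𝒢 mE) _
      (Function.uncurry fun ω y => h y (Z ω)) := by
    have h2 : @Measurable (Ω × E) (E × E') (@Prod.instMeasurableSpace Ω E 𝒢 mE) _
        fun p => (p.2, Z p.1) :=
      Measurable.prodMk (@measurable_snd Ω E 𝒢 mE) (hZ.comp (@measurable_fst Ω E 𝒢 mE))
    exact hh.comp h2
  have := @IndepFun.condExp_comap Ω Ω E mΩ 𝒢 mE P _ id Y hid hY hind' (fun ω y => h y (Z ω)) h1 hint
  rwa [MeasurableSpace.comap_id] at this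

/-- If `A` is independent of `(B, C)` and `B` is independent of `C` then `(A, B)` is independent
of `C`. -/
theorem ProbabilityTheory.IndepFun.prodMk_left_of_indepFun {Ω α β γ : Type*}
    {mΩ : MeasurableSpace Ω} [MeasurableSpace α] [MeasurableSpace β] [MeasurableSpace γ]
    {P : Measure Ω} [IsProbabilityMeasure P] {A : Ω → α} {B : Ω → β} {C : Ω → γ}
    (hA : Measurable A) (hB : Measurable B) (hC : Measurable C)
    (h₁ : IndepFun A (fun ω => (B ω, C ω)) P) (h₂ : IndepFun B C P) :
    IndepFun (fun ω => (A ω, B ω)) C P := by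
  have : IsProbabilityMeasure (P.map A) := Measure.isProbabilityMeasure_map hA.aemeasurable
  have : IsProbabilityMeasure (P.map B) := Measure.isProbabilityMeasure_map hB.aemeasurable
  have : IsProbabilityMeasure (P.map C) := Measure.isProbabilityMeasure_map hC.aemeasurable
  have hAB : IndepFun A B P := h₁.comp measurable_id measurable_fst
  have e₁ := h₁.map_prod_eq_prod_map_map hA.aemeasurable (hB.prodMk hC).aemeasurable
  have e₂ := h₂.map_prod_eq_prod_map_map hB.aemeasurable hC.aemeasurable
  have e₃ := hAB.map_prod_eq_prod_map_map hA.aemeasurable hB.aemeasurable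
  rw [indepFun_iff_map_prod_eq_prod_map_map (hA.prodMk hB).aemeasurable hC.aemeasurable, e₃]
  rw [e₂] at e₁
  have hmp := measurePreserving_prodAssoc (P.map A) (P.map B) (P.map C)
  have h3 := hmp.symm.map_eq
  rw [← h3, ← e₁, Measure.map_map (MeasurableEquiv.measurable _) (hA.prodMk (hB.prodMk hC))]
  rfl

/-! ### The filtration of the algorithm. -/

section History

variable {Ω : Type*} [mΩ : MeasurableSpace Ω] {d m : ℕ}

/-- The information available after `n` steps: the initialization and the first `n` innovations. -/
noncomputable def history (Xs : ℕ → Ω → Vec d) (θ₀ : Ω → Vec m) (n : ℕ) (ω : Ω) :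
    Vec m × (ℕ → Vec d) :=
  (θ₀ ω, fun i => if i < n then Xs (i + 1) ω else 0)

theorem measurable_history {Xs : ℕ → Ω → Vec d} {θ₀ : Ω → Vec m}
    (hXs : ∀ n : ℕ, 1 ≤ n → Measurable (Xs n)) (hθ₀ : Measurable θ₀) (n : ℕ) :
    Measurable (history Xs θ₀ n) := by
  refine hθ₀.prodMk (measurable_pi_lambda _ fun i => ?_)
  by_cases h : i < n
  · simpa [h] using hXs (i + 1) (by omega)
  · simp [h]

/-- The filtration generated by the initialization and the innovations. -/
noncomputable def historyFiltration {Xs : ℕ → Ω → Vec d} {θ₀ : Ω → Vec m}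
    (hXs : ∀ n : ℕ, 1 ≤ n → Measurable (Xs n)) (hθ₀ : Measurable θ₀) : Filtration ℕ mΩ where
  seq n := MeasurableSpace.comap (history Xs θ₀ n) inferInstance
  mono' := by
    intro i j hij
    -- Padding by zeros keeps all histories in one space, so an earlier history is the image of a
    -- later one under the truncation `T`.
    let T : Vec m × (ℕ → Vec d) → Vec m × (ℕ → Vec d) :=
      fun p => (p.1, fun k => if k < i then p.2 k else 0)
    have hT : Measurable T := by
      refine measurable_fst.prodMk (measurable_pi_lambda _ fun k => ?_)
      by_cases h : k < i
      · simpa [h, Function.comp_def] using (measurable_pi_apply k).comp measurable_snd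
      · simp [h]
    have hc : history Xs θ₀ i = T ∘ history Xs θ₀ j := by
      funext ω
      refine Prod.ext rfl (funext fun k => ?_)
      by_cases h : k < i
      · simp [history, T, h, h.trans_le hij]
      · simp [history, T, h]
    change MeasurableSpace.comap (history Xs θ₀ i) _ ≤ MeasurableSpace.comap (history Xs θ₀ j) _
    rw [hc, ← MeasurableSpace.comap_comp]
    exact MeasurableSpace.comap_mono hT.comap_le
  le' n := (measurable_history hXs hθ₀ n).comap_le

variable {Xs : ℕ → Ω → Vec d} {θ₀ : Ω → Vec m}
  (hXs : ∀ n : ℕ, 1 ≤ n → Measurable (Xs n)) (hθ₀ : Measurable θ₀)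

theorem measurable_innovation_historyFiltration (n : ℕ) :
    Measurable[historyFiltration hXs hθ₀ (n + 1)] (Xs (n + 1)) := by
  have h1 : Xs (n + 1) = (fun p : Vec m × (ℕ → Vec d) => p.2 n) ∘ history Xs θ₀ (n + 1) := by
    funext ω; simp [history]
  rw [h1]
  exact ((measurable_pi_apply n).comp measurable_snd).comp (comap_measurable _)

theorem measurable_sgd_historyFiltration {g : Vec d → Vec m → Vec m}
    (hg : Measurable (Function.uncurry g)) (γ : ℕ → ℝ) (n : ℕ) :
    Measurable[historyFiltration hXs hθ₀ n] (sgd g γ Xs θ₀ n) := by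
  induction n with
  | zero =>
    have h1 : sgd g γ Xs θ₀ 0 = Prod.fst ∘ history Xs θ₀ 0 := rfl
    rw [h1]
    exact measurable_fst.comp (comap_measurable _)
  | succ n ih =>
    have h1 := ih.mono ((historyFiltration hXs hθ₀).mono n.le_succ) le_rfl
    have h2 := measurable_innovation_historyFiltration hXs hθ₀ n
    exact h1.sub ((hg.comp (h2.prodMk h1)).const_smul (γ (n + 1)))

theorem indep_historyFiltration {P : Measure Ω} [IsProbabilityMeasure P]
    (hindep : iIndepFun (fun n : ℕ => Xs (n + 1)) P)
    (hθ₀_indep : IndepFun θ₀ (fun ω (n : ℕ) => Xs (n + 1) ω) P) (n : ℕ) :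
    Indep (historyFiltration hXs hθ₀ n) (MeasurableSpace.comap (Xs (n + 1)) inferInstance) P := by
  let B : Ω → ℕ → Vec d := fun ω i => if i < n then Xs (i + 1) ω else 0
  have hT : Measurable fun (s : ℕ → Vec d) (i : ℕ) => if i < n then s i else 0 := by
    refine measurable_pi_lambda _ fun k => ?_
    by_cases h : k < n
    · simpa [h] using measurable_pi_apply k
    · simp [h]
  have hmeas : ∀ i : ℕ, Measurable (Xs (i + 1)) := fun i => hXs _ (by omega)
  have hB : Measurable B := hT.comp (measurable_pi_lambda _ hmeas)
  have h₂ : IndepFun B (Xs (n + 1)) P := by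
    -- In the shifted indexing, `range n` stands for the innovations `1, …, n` and `{n}` for
    -- innovation `n + 1`; `φ` restores the padding by zeros.
    have h3 := hindep.indepFun_finset (Finset.range n) {n} (by simp) hmeas
    let φ : (Finset.range n → Vec d) → ℕ → Vec d :=
      fun s i => if h : i < n then s ⟨i, Finset.mem_range.2 h⟩ else 0
    have hφ : Measurable φ := by
      refine measurable_pi_lambda _ fun k => ?_
      by_cases h : k < n
      · simpa [φ, h] using measurable_pi_apply _
      · simp [φ, h]
    have h4 := h3.comp hφ (measurable_pi_apply (⟨n, Finset.mem_singleton_self n⟩ :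
      ({n} : Finset ℕ)))
    have h5 : (φ ∘ fun a (i : Finset.range n) => Xs (i + 1) a) = B := by
      funext ω i; simp [φ, B]
    rw [h5] at h4
    exact h4
  have h₁ : IndepFun θ₀ (fun ω => (B ω, Xs (n + 1) ω)) P :=
    hθ₀_indep.comp measurable_id (hT.prodMk (measurable_pi_apply n))
  have := IndepFun.prodMk_left_of_indepFun hθ₀ hB (hmeas n) h₁ h₂
  exact (IndepFun_iff_Indep _ _ _).1 this

end History

/-! ### The model, one-step descent and integrability. -/

/-- The optimality gap `F(θ) - inf F`. -/
noncomputable def gap {m : ℕ} (F : Vec m → ℝ) (θ : Vec m) : ℝ := F θ - ⨅ θ' : Vec m, F θ'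

/-- The standing assumptions on stochastic gradient descent, apart from those on the landscape and
the finer ones on the step sizes. -/
structure SGDModel {Ω : Type*} [MeasurableSpace Ω] (P : Measure Ω) {d m : ℕ} (X : Ω → Vec d)
    (F : Vec m → ℝ) (g : Vec d → Vec m → Vec m) (Xs : ℕ → Ω → Vec d) (θ₀ : Ω → Vec m)
    (L α κ : ℝ) (γ : ℕ → ℝ) : Prop where
  measurable_X : Measurable X
  measurable_oracle : Measurable (Function.uncurry g)
  measurable_Xs : ∀ n : ℕ, 1 ≤ n → Measurable (Xs n)
  law : ∀ n : ℕ, 1 ≤ n → IdentDistrib (Xs n) X P P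
  indep : iIndepFun (fun n : ℕ => Xs (n + 1)) P
  measurable_init : Measurable θ₀
  memLp_init : MemLp θ₀ 2 P
  indep_init : IndepFun θ₀ (fun ω (n : ℕ) => Xs (n + 1) ω) P
  L_pos : 0 < L
  α_pos : 0 < α
  α_le : α ≤ 1
  smooth : HolderSmooth F L α
  oracle : OracleCondition P X g F κ
  steps : StepSizes γ α

/-- The direction taken at step `n + 1`. -/
noncomputable def direction {Ω : Type*} {d m : ℕ} (g : Vec d → Vec m → Vec m) (γ : ℕ → ℝ)
    (Xs : ℕ → Ω → Vec d) (θ₀ : Ω → Vec m) (n : ℕ) (ω : Ω) : Vec m :=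
  g (Xs (n + 1) ω) (sgd g γ Xs θ₀ n ω)

/-- The component of the noise at step `n + 1` along the field `u`. -/
noncomputable def noise {Ω : Type*} [MeasurableSpace Ω] (P : Measure Ω) {d m : ℕ} (X : Ω → Vec d)
    (g : Vec d → Vec m → Vec m) (γ : ℕ → ℝ)
    (Xs : ℕ → Ω → Vec d) (θ₀ : Ω → Vec m) (u : Vec m → Vec m) (n : ℕ) (ω : Ω) : ℝ :=
  inner ℝ (u (sgd g γ Xs θ₀ n ω))
    (direction g γ Xs θ₀ n ω - meanOracle P X g (sgd g γ Xs θ₀ n ω))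

namespace SGDModel

variable {Ω : Type*} [mΩ : MeasurableSpace Ω] {P : Measure Ω} [IsProbabilityMeasure P] {d m : ℕ}
  {X : Ω → Vec d} {F : Vec m → ℝ} {g : Vec d → Vec m → Vec m} {Xs : ℕ → Ω → Vec d}
  {θ₀ : Ω → Vec m} {L α κ : ℝ} {γ : ℕ → ℝ}

local notation "θ" => sgd g γ Xs θ₀
local notation "𝐠" => direction g γ Xs θ₀
local notation "𝐛" => meanOracle P X g
local notation "∇F" => gradient F

section

variable (M : SGDModel P X F g Xs θ₀ L α κ γ)

/-- The filtration of the model. -/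
noncomputable def filtration (M : SGDModel P X F g Xs θ₀ L α κ γ) : Filtration ℕ mΩ :=
  historyFiltration M.measurable_Xs M.measurable_init

include M

omit [IsProbabilityMeasure P] in
theorem gap_nonneg (x : Vec m) : 0 ≤ gap F x := M.smooth.gap_nonneg x

omit [IsProbabilityMeasure P] in
theorem step_pos (n : ℕ) : 0 < γ (n + 1) := M.steps.1 _ (by omega)

omit [IsProbabilityMeasure P] in
theorem measurable_gap : Measurable (gap F) :=
  M.smooth.continuous.measurable.sub_const _

omit [IsProbabilityMeasure P] in
theorem measurable_gradient : Measurable (gradient F) :=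
  (M.smooth.continuous_gradient M.α_pos).measurable

omit [IsProbabilityMeasure P] in
theorem measurable_sgd_filtration (n : ℕ) : Measurable[M.filtration n] (θ n) :=
  measurable_sgd_historyFiltration _ _ M.measurable_oracle γ n

omit [IsProbabilityMeasure P] in
theorem measurable_sgd (n : ℕ) : Measurable (θ n) :=
  (M.measurable_sgd_filtration n).mono (M.filtration.le n) le_rfl

omit [IsProbabilityMeasure P] in
theorem measurable_direction (n : ℕ) : Measurable (𝐠 n) :=
  M.measurable_oracle.comp ((M.measurable_Xs _ (by omega)).prodMk (M.measurable_sgd n))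

omit [IsProbabilityMeasure P] in
theorem measurable_direction_filtration (n : ℕ) : Measurable[M.filtration (n + 1)] (𝐠 n) :=
  M.measurable_oracle.comp
    ((measurable_innovation_historyFiltration M.measurable_Xs M.measurable_init n).prodMk
      ((M.measurable_sgd_filtration n).mono (M.filtration.mono n.le_succ) le_rfl))

theorem measurable_meanOracle : Measurable 𝐛 := by
  have h : StronglyMeasurable (Function.uncurry fun (x : Vec m) (ω : Ω) => g (X ω) x) :=
    (M.measurable_oracle.comp
      ((M.measurable_X.comp measurable_snd).prodMk measurable_fst)).stronglyMeasurable
  exact (StronglyMeasurable.integral_prod_right (f := fun x ω => g (X ω) x) h).measurable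

omit [IsProbabilityMeasure P] in
theorem map_innovation (n : ℕ) : P.map (Xs (n + 1)) = P.map X := (M.law _ (by omega)).map_eq

omit [IsProbabilityMeasure P] in
theorem integral_oracle (x : Vec m) : ∫ y, g y x ∂(P.map X) = 𝐛 x :=
  integral_map M.measurable_X.aemeasurable
    (M.measurable_oracle.comp (measurable_id.prodMk measurable_const)).aestronglyMeasurable

omit [IsProbabilityMeasure P] in
theorem measurable_oracle_left (x : Vec m) : Measurable fun y => g y x :=
  M.measurable_oracle.comp (measurable_id.prodMk measurable_const)

omit [IsProbabilityMeasure P] in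
theorem memLp_oracle (x : Vec m) : MemLp (fun y => g y x) 2 (P.map X) := by
  obtain ⟨-, ⟨C, -, hC⟩, -⟩ := M.oracle
  exact (memLp_map_measure_iff (M.measurable_oracle_left x).aestronglyMeasurable
    M.measurable_X.aemeasurable).2 (hC x).1

omit [IsProbabilityMeasure P] in
theorem exists_integral_oracle_sq_le : ∃ C : ℝ, 0 < C ∧ ∀ x : Vec m,
    ∫ y, ‖g y x‖ ^ 2 ∂(P.map X) ≤ C * (gap F x + 1) := by
  obtain ⟨-, ⟨C, hC0, hC⟩, -⟩ := M.oracle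
  refine ⟨C, hC0, fun x => ?_⟩
  rw [integral_map M.measurable_X.aemeasurable
    ((M.measurable_oracle_left x).norm.pow_const 2).aestronglyMeasurable]
  exact (hC x).2

omit [IsProbabilityMeasure P] in
theorem exists_meanOracle_sq_le : ∃ C : ℝ, 0 < C ∧ ∀ x : Vec m,
    ‖𝐛 x‖ ^ 2 ≤ C * (gap F x + 1) := by
  obtain ⟨hκ, -, -, c, hc, hb⟩ := M.oracle
  obtain ⟨C, hC, hG⟩ := M.smooth.exists_gradient_sq_le M.L_pos M.α_pos M.α_le
  have hc0 : 0 < c := hκ.trans_le hc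
  refine ⟨c ^ 2 * C, by positivity, fun x => ?_⟩
  calc ‖𝐛 x‖ ^ 2 ≤ (c * ‖∇F x‖) ^ 2 := by gcongr; exact hb x
    _ = c ^ 2 * ‖∇F x‖ ^ 2 := by ring
    _ ≤ c ^ 2 * (C * (gap F x + 1)) := by gcongr; exact hG x
    _ = _ := by ring

theorem indep_filtration (n : ℕ) :
    Indep (M.filtration n) (MeasurableSpace.comap (Xs (n + 1)) inferInstance) P :=
  indep_historyFiltration _ _ M.indep M.indep_init n

/-- Conditionally on the past, the next innovation may be integrated out. -/
theorem condExp_innovation (n : ℕ) {h : Vec d → Vec m → ℝ} (hh : Measurable (Function.uncurry h))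
    (hint : Integrable (fun ω => h (Xs (n + 1) ω) (θ n ω)) P) :
    P[fun ω => h (Xs (n + 1) ω) (θ n ω) | M.filtration n]
      =ᵐ[P] fun ω => ∫ y, h y (θ n ω) ∂(P.map X) := by
  have := (M.indep_filtration n).condExp_comp (M.filtration.le n) (M.measurable_sgd_filtration n)
    (M.measurable_Xs (n + 1) (by omega)) hh hint
  rwa [M.map_innovation] at this

/-- The iterate is independent of the next innovation, so integrability may be checked under the
product law, where the inner integral is at most `C (gap + 1)`. -/
theorem integrable_direction_sq (n : ℕ) (hV : Integrable (fun ω => gap F (θ n ω)) P) :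
    Integrable (fun ω => ‖𝐠 n ω‖ ^ 2) P := by
  obtain ⟨C, hC0, hC⟩ := M.exists_integral_oracle_sq_le
  have hXn := M.measurable_Xs (n + 1) (by omega)
  have hind : IndepFun (θ n) (Xs (n + 1)) P := by
    refine (IndepFun_iff_Indep _ _ _).2 ?_
    exact indep_of_indep_of_le_left (M.indep_filtration n) (M.measurable_sgd_filtration n).comap_le
  have hlaw := hind.map_prod_eq_prod_map_map (M.measurable_sgd n).aemeasurable hXn.aemeasurable
  rw [M.map_innovation] at hlaw
  have := Measure.isProbabilityMeasure_map (μ := P) M.measurable_X.aemeasurable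
  have := Measure.isProbabilityMeasure_map (μ := P) (M.measurable_sgd n).aemeasurable
  have hm : Measurable fun p : Vec m × Vec d => ‖g p.2 p.1‖ ^ 2 :=
    (M.measurable_oracle.comp measurable_swap).norm.pow_const 2
  have h1 : Integrable (fun p : Vec m × Vec d => ‖g p.2 p.1‖ ^ 2)
      ((P.map (θ n)).prod (P.map X)) := by
    rw [integrable_prod_iff hm.aestronglyMeasurable]
    refine ⟨Eventually.of_forall fun x => (M.memLp_oracle x).integrable_norm_pow two_ne_zero, ?_⟩
    have h2 : Integrable (fun x => C * (gap F x + 1)) (P.map (θ n)) := by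
      refine (Integrable.add ?_ (integrable_const _)).const_mul C
      exact (integrable_map_measure M.measurable_gap.aestronglyMeasurable
        (M.measurable_sgd n).aemeasurable).2 hV
    refine h2.mono' (hm.norm.stronglyMeasurable.integral_prod_right').aestronglyMeasurable
      (Eventually.of_forall fun x => ?_)
    simp only [norm_pow, norm_norm]
    rw [Real.norm_of_nonneg (integral_nonneg fun _ => by positivity)]
    exact hC x
  rw [← hlaw, integrable_map_measure hm.aestronglyMeasurable
    ((M.measurable_sgd n).prodMk hXn).aemeasurable] at h1
  exact h1

omit [IsProbabilityMeasure P] in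
/-- One step of the algorithm decreases the function up to noise. -/
theorem gap_succ_le (n : ℕ) (ω : Ω) :
    gap F (θ (n + 1) ω) ≤ gap F (θ n ω) - κ * γ (n + 1) * ‖∇F (θ n ω)‖ ^ 2
      - γ (n + 1) * noise P X g γ Xs θ₀ ∇F n ω
      + L * γ (n + 1) ^ (1 + α) * (1 + ‖𝐠 n ω‖ ^ 2) := by
  have hα := M.α_pos
  have hγ := M.step_pos n
  have hL := M.L_pos
  have h1 := M.smooth.descent hα (θ n ω) (-(γ (n + 1) • 𝐠 n ω))
  rw [← sub_eq_add_neg] at h1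
  have h2 : θ (n + 1) ω = θ n ω - γ (n + 1) • 𝐠 n ω := rfl
  rw [← h2, norm_neg, norm_smul, Real.norm_of_nonneg hγ.le, inner_neg_right, inner_smul_right,
    Real.mul_rpow hγ.le (norm_nonneg _)] at h1
  -- Only second moments of the oracle are available; `α ≤ 1` makes them enough.
  have h3 : ‖𝐠 n ω‖ ^ (1 + α) ≤ 1 + ‖𝐠 n ω‖ ^ 2 := by
    rcases le_total ‖𝐠 n ω‖ 1 with h | h
    · have := Real.rpow_le_one (norm_nonneg _) h (by linarith : 0 ≤ 1 + α)
      nlinarith [sq_nonneg ‖𝐠 n ω‖]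
    · have := Real.rpow_le_rpow_of_exponent_le h (by linarith [M.α_le] : 1 + α ≤ 2)
      rw [Real.rpow_two] at this
      linarith
  have h4 : κ * ‖∇F (θ n ω)‖ ^ 2 ≤ inner ℝ (∇F (θ n ω)) (𝐛 (θ n ω)) := by
    rw [real_inner_comm]
    exact M.oracle.2.2.1 _
  have h5 : L / (1 + α) * (γ (n + 1) ^ (1 + α) * ‖𝐠 n ω‖ ^ (1 + α))
      ≤ L * γ (n + 1) ^ (1 + α) * (1 + ‖𝐠 n ω‖ ^ 2) := by
    have : L / (1 + α) ≤ L := div_le_self hL.le (by linarith)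
    calc _ ≤ L * (γ (n + 1) ^ (1 + α) * (1 + ‖𝐠 n ω‖ ^ 2)) := by gcongr
      _ = _ := by ring
  have h6 := mul_le_mul_of_nonneg_left h4 hγ.le
  simp only [gap, noise, inner_sub_right]
  linarith

omit [IsProbabilityMeasure P] in
theorem measurable_gap_sgd (n : ℕ) : Measurable fun ω => gap F (θ n ω) :=
  M.measurable_gap.comp (M.measurable_sgd n)

omit [IsProbabilityMeasure P] in
theorem measurable_gradient_sgd (n : ℕ) : Measurable fun ω => ∇F (θ n ω) :=
  M.measurable_gradient.comp (M.measurable_sgd n)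

theorem integrable_gradient_sq_of_gap (n : ℕ) (hV : Integrable (fun ω => gap F (θ n ω)) P) :
    Integrable (fun ω => ‖∇F (θ n ω)‖ ^ 2) P := by
  obtain ⟨C, hC, hG⟩ := M.smooth.exists_gradient_sq_le M.L_pos M.α_pos M.α_le
  refine Integrable.mono' ((hV.add (integrable_const 1)).const_mul C)
    ((M.measurable_gradient_sgd n).norm.pow_const 2).aestronglyMeasurable
    (Eventually.of_forall fun ω => ?_)
  rw [Real.norm_of_nonneg (by positivity)]
  exact hG _

theorem integrable_meanOracle_sq_of_gap (n : ℕ) (hV : Integrable (fun ω => gap F (θ n ω)) P) :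
    Integrable (fun ω => ‖𝐛 (θ n ω)‖ ^ 2) P := by
  obtain ⟨C, hC, hG⟩ := M.exists_meanOracle_sq_le
  refine Integrable.mono' ((hV.add (integrable_const 1)).const_mul C)
    ((M.measurable_meanOracle.comp (M.measurable_sgd n)).norm.pow_const 2).aestronglyMeasurable
    (Eventually.of_forall fun ω => ?_)
  rw [Real.norm_of_nonneg (by positivity)]
  exact hG _

theorem measurable_noise {u : Vec m → Vec m} (hu : Measurable u) (n : ℕ) :
    Measurable (noise P X g γ Xs θ₀ u n) :=
  (hu.comp (M.measurable_sgd n)).inner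
    ((M.measurable_direction n).sub (M.measurable_meanOracle.comp (M.measurable_sgd n)))

theorem measurable_noise_filtration {u : Vec m → Vec m} (hu : Measurable u) (n : ℕ) :
    Measurable[M.filtration (n + 1)] (noise P X g γ Xs θ₀ u n) := by
  have h := (M.measurable_sgd_filtration n).mono (M.filtration.mono n.le_succ) le_rfl
  exact (hu.comp h).inner ((M.measurable_direction_filtration n).sub
    (M.measurable_meanOracle.comp h))

omit [IsProbabilityMeasure P] M in
theorem noise_sq_le (u : Vec m → Vec m) (n : ℕ) (ω : Ω) :
    noise P X g γ Xs θ₀ u n ω ^ 2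
      ≤ ‖u (θ n ω)‖ ^ 2 * (2 * ‖𝐠 n ω‖ ^ 2 + 2 * ‖𝐛 (θ n ω)‖ ^ 2) := by
  have h1 := abs_real_inner_le_norm (u (θ n ω)) (𝐠 n ω - 𝐛 (θ n ω))
  have h2 := norm_sub_le (𝐠 n ω) (𝐛 (θ n ω))
  have h3 : ‖𝐠 n ω - 𝐛 (θ n ω)‖ ^ 2 ≤ 2 * ‖𝐠 n ω‖ ^ 2 + 2 * ‖𝐛 (θ n ω)‖ ^ 2 := by
    nlinarith [sq_nonneg (‖𝐠 n ω‖ - ‖𝐛 (θ n ω)‖), norm_nonneg (𝐠 n ω - 𝐛 (θ n ω))]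
  calc noise P X g γ Xs θ₀ u n ω ^ 2 = |noise P X g γ Xs θ₀ u n ω| ^ 2 := (sq_abs _).symm
    _ ≤ (‖u (θ n ω)‖ * ‖𝐠 n ω - 𝐛 (θ n ω)‖) ^ 2 := by gcongr; exact h1
    _ = ‖u (θ n ω)‖ ^ 2 * ‖𝐠 n ω - 𝐛 (θ n ω)‖ ^ 2 := by ring
    _ ≤ _ := by gcongr

/-- Square integrability of `u` along the iterates suffices, so this covers the unbounded field
`∇F`, as the induction for `integrable_gap` demands. -/
theorem integrable_noise_of_gap {u : Vec m → Vec m} (hu : Measurable u) (n : ℕ)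
    (hV : Integrable (fun ω => gap F (θ n ω)) P)
    (hu2 : Integrable (fun ω => ‖u (θ n ω)‖ ^ 2) P) :
    Integrable (noise P X g γ Xs θ₀ u n) P := by
  refine Integrable.mono' ((hu2.add ((M.integrable_direction_sq n hV).const_mul 2)).add
    ((M.integrable_meanOracle_sq_of_gap n hV).const_mul 2))
    (M.measurable_noise hu n).aestronglyMeasurable (Eventually.of_forall fun ω => ?_)
  have h1 := noise_sq_le (P := P) (X := X) (g := g) (γ := γ) (Xs := Xs) (θ₀ := θ₀) u n ω
  rw [Real.norm_eq_abs]
  set A := ‖u (θ n ω)‖ ^ 2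
  set B := 2 * ‖𝐠 n ω‖ ^ 2
  set D := 2 * ‖𝐛 (θ n ω)‖ ^ 2
  have hA : 0 ≤ A := by positivity
  have hB : 0 ≤ B := by positivity
  have hD : 0 ≤ D := by positivity
  change _ ≤ A + B + D
  refine abs_le_of_sq_le_sq ?_ (by positivity)
  nlinarith [mul_nonneg hA hB, mul_nonneg hA hD]

/-- The noise is centred conditionally on the past. -/
theorem condExp_noise_of_gap {u : Vec m → Vec m} (hu : Measurable u) (n : ℕ)
    (hV : Integrable (fun ω => gap F (θ n ω)) P)
    (hu2 : Integrable (fun ω => ‖u (θ n ω)‖ ^ 2) P) :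
    P[noise P X g γ Xs θ₀ u n | M.filtration n] =ᵐ[P] 0 := by
  have hm : Measurable (Function.uncurry fun (y : Vec d) (x : Vec m) =>
      inner ℝ (u x) (g y x - 𝐛 x)) :=
    (hu.comp measurable_snd).inner
      (M.measurable_oracle.sub (M.measurable_meanOracle.comp measurable_snd))
  have := Measure.isProbabilityMeasure_map (μ := P) M.measurable_X.aemeasurable
  refine (M.condExp_innovation n hm (M.integrable_noise_of_gap hu n hV hu2)).trans
    (Eventually.of_forall fun ω => ?_)
  have hi : Integrable (fun y => g y (θ n ω)) (P.map X) :=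
    (M.memLp_oracle _).integrable one_le_two
  have h1 := integral_inner (𝕜 := ℝ) (hi.sub (integrable_const (𝐛 (θ n ω)))) (u (θ n ω))
  simp only [Pi.sub_apply] at h1
  simp only [Pi.zero_apply]
  rw [h1, integral_sub hi (integrable_const _), M.integral_oracle]
  simp

theorem condExp_direction_sq_le : ∃ C : ℝ, 0 < C ∧ ∀ n : ℕ,
    Integrable (fun ω => gap F (θ n ω)) P →
      P[fun ω => ‖𝐠 n ω‖ ^ 2 | M.filtration n] ≤ᵐ[P] fun ω => C * (gap F (θ n ω) + 1) := by
  obtain ⟨C, hC0, hC⟩ := M.exists_integral_oracle_sq_le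
  refine ⟨C, hC0, fun n hV => ?_⟩
  have hm : Measurable (Function.uncurry fun (y : Vec d) (x : Vec m) => ‖g y x‖ ^ 2) :=
    M.measurable_oracle.norm.pow_const 2
  refine (M.condExp_innovation n hm (M.integrable_direction_sq n hV)).trans_le
    (Eventually.of_forall fun ω => hC _)

/-- By induction. The square integrability of the initialization enters through the quadratic growth
of `F` seen from the origin; the descent inequality dominates each new gap by integrable terms. -/
theorem integrable_gap (n : ℕ) : Integrable (fun ω => gap F (θ n ω)) P := by
  induction n with
  | zero =>
    have hα := M.α_pos
    have hL := M.L_pos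
    have h1 := M.memLp_init.integrable one_le_two
    have h2 := M.memLp_init.integrable_norm_pow two_ne_zero
    refine Integrable.mono' ((((integrable_const (gap F 0)).add
      (h1.norm.const_mul ‖∇F 0‖)).add (((integrable_const (1 : ℝ)).add h2).const_mul L)))
      (M.measurable_gap_sgd 0).aestronglyMeasurable (Eventually.of_forall fun ω => ?_)
    rw [Real.norm_of_nonneg (M.gap_nonneg _)]
    have h3 := M.smooth.descent hα 0 (θ₀ ω)
    rw [zero_add] at h3
    have h4 := real_inner_le_norm (∇F 0) (θ₀ ω)
    have h5 : ‖θ₀ ω‖ ^ (1 + α) ≤ 1 + ‖θ₀ ω‖ ^ 2 := by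
      rcases le_total ‖θ₀ ω‖ 1 with h | h
      · have := Real.rpow_le_one (norm_nonneg _) h (by linarith : 0 ≤ 1 + α)
        nlinarith [sq_nonneg ‖θ₀ ω‖]
      · have := Real.rpow_le_rpow_of_exponent_le h (by linarith [M.α_le] : 1 + α ≤ 2)
        rw [Real.rpow_two] at this
        linarith
    have h6 : L / (1 + α) * ‖θ₀ ω‖ ^ (1 + α) ≤ L * (1 + ‖θ₀ ω‖ ^ 2) := by
      have : L / (1 + α) ≤ L := div_le_self hL.le (by linarith)
      gcongr
    change F (θ₀ ω) - _ ≤ F 0 - _ + ‖∇F 0‖ * ‖θ₀ ω‖ + L * (1 + ‖θ₀ ω‖ ^ 2)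
    linarith
  | succ n ih =>
    have hG := M.integrable_gradient_sq_of_gap n ih
    have hN := M.integrable_noise_of_gap M.measurable_gradient n ih hG
    refine Integrable.mono' (((ih.sub (hG.const_mul (κ * γ (n + 1)))).sub
      (hN.const_mul (γ (n + 1)))).add (((integrable_const (1 : ℝ)).add
      (M.integrable_direction_sq n ih)).const_mul (L * γ (n + 1) ^ (1 + α))))
      (M.measurable_gap_sgd _).aestronglyMeasurable (Eventually.of_forall fun ω => ?_)
    rw [Real.norm_of_nonneg (M.gap_nonneg _)]
    exact M.gap_succ_le n ω

theorem integrable_gradient_sq (n : ℕ) : Integrable (fun ω => ‖∇F (θ n ω)‖ ^ 2) P :=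
  M.integrable_gradient_sq_of_gap n (M.integrable_gap n)

/-- The conditional expected decrease. -/
theorem exists_condExp_gap_succ_le : ∃ C : ℝ, 0 < C ∧ ∀ n : ℕ,
    P[fun ω => gap F (θ (n + 1) ω) | M.filtration n] ≤ᵐ[P]
      fun ω => gap F (θ n ω) - κ * γ (n + 1) * ‖∇F (θ n ω)‖ ^ 2
        + C * γ (n + 1) ^ (1 + α) * (gap F (θ n ω) + 1) := by
  obtain ⟨C, hC0, hC⟩ := M.condExp_direction_sq_le
  have hL := M.L_pos
  refine ⟨L * (1 + C), by positivity, fun n => ?_⟩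
  have hV := M.integrable_gap n
  have hG := M.integrable_gradient_sq n
  have hN := M.integrable_noise_of_gap M.measurable_gradient n hV hG
  have hD := M.integrable_direction_sq n hV
  -- `a` collects the terms known at time `n`, which conditioning leaves unchanged. What remains is
  -- the noise, centred, and `‖𝐠‖²`, conditionally of order `gap + 1`.
  set a : Ω → ℝ := fun ω => gap F (θ n ω) - κ * γ (n + 1) * ‖∇F (θ n ω)‖ ^ 2
    + L * γ (n + 1) ^ (1 + α) with ha
  have hai : Integrable a P := (hV.sub (hG.const_mul _)).add (integrable_const _)
  have ham : StronglyMeasurable[M.filtration n] a := by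
    have h := M.measurable_sgd_filtration n
    have h' : Measurable fun x => gap F x - κ * γ (n + 1) * ‖∇F x‖ ^ 2
        + L * γ (n + 1) ^ (1 + α) :=
      (M.measurable_gap.sub ((M.measurable_gradient.norm.pow_const 2).const_mul _)).add_const _
    exact h'.stronglyMeasurable.comp_measurable h
  have h1 : (fun ω => gap F (θ (n + 1) ω)) ≤ᵐ[P]
      (a - γ (n + 1) • noise P X g γ Xs θ₀ ∇F n)
        + (L * γ (n + 1) ^ (1 + α)) • fun ω => ‖𝐠 n ω‖ ^ 2 := by
    refine Eventually.of_forall fun ω => ?_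
    have := M.gap_succ_le n ω
    simp only [Pi.add_apply, Pi.sub_apply, Pi.smul_apply, smul_eq_mul, ha]
    linarith
  have h2 := condExp_mono (m := M.filtration n) (M.integrable_gap (n + 1))
    ((hai.sub (hN.smul (γ (n + 1)))).add (hD.smul (L * γ (n + 1) ^ (1 + α)))) h1
  have h3 := condExp_add (hai.sub (hN.smul (γ (n + 1)))) (hD.smul (L * γ (n + 1) ^ (1 + α)))
    (M.filtration n)
  have h4 := condExp_sub hai (hN.smul (γ (n + 1))) (M.filtration n)
  have h5 := condExp_smul (μ := P) (γ (n + 1)) (noise P X g γ Xs θ₀ ∇F n) (M.filtration n)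
  have h6 := condExp_smul (μ := P) (L * γ (n + 1) ^ (1 + α)) (fun ω => ‖𝐠 n ω‖ ^ 2)
    (M.filtration n)
  have h7 := condExp_of_stronglyMeasurable (M.filtration.le n) ham hai
  filter_upwards [h2, h3, h4, h5, h6, hC n hV,
    M.condExp_noise_of_gap M.measurable_gradient n hV hG] with ω e2 e3 e4 e5 e6 e8 e9
  refine e2.trans ?_
  rw [e3, Pi.add_apply, e4, Pi.sub_apply, e5, e6, h7, Pi.smul_apply, Pi.smul_apply, e9]
  have hp : 0 ≤ L * γ (n + 1) ^ (1 + α) :=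
    mul_nonneg hL.le (Real.rpow_nonneg (M.step_pos n).le _)
  have h10 := mul_le_mul_of_nonneg_left e8 hp
  have h11 : 0 ≤ L * γ (n + 1) ^ (1 + α) * gap F (θ n ω) := mul_nonneg hp (M.gap_nonneg _)
  simp only [smul_eq_mul, Pi.zero_apply, mul_zero, ha]
  nlinarith

end

end SGDModel

/-! ### Summation lemmas. -/

/-- The products of `1 + a k` over a summable nonnegative sequence converge. -/
theorem exists_tendsto_prod_one_add {a : ℕ → ℝ} (ha : ∀ n, 0 ≤ a n) (hs : Summable a) :
    ∃ p : ℝ, 1 ≤ p ∧ Tendsto (fun n => ∏ k ∈ Finset.range n, (1 + a k)) atTop (𝓝 p) ∧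
      ∀ n, 1 ≤ ∏ k ∈ Finset.range n, (1 + a k) ∧ ∏ k ∈ Finset.range n, (1 + a k) ≤ p := by
  have h1 : ∀ n, 1 ≤ ∏ k ∈ Finset.range n, (1 + a k) := by
    intro n
    induction n with
    | zero => simp
    | succ n ih =>
      rw [Finset.prod_range_succ]
      nlinarith [ha n]
  have hmono : Monotone fun n => ∏ k ∈ Finset.range n, (1 + a k) := by
    refine monotone_nat_of_le_succ fun n => ?_
    rw [Finset.prod_range_succ]
    nlinarith [h1 n, ha n]
  have hbdd : BddAbove (Set.range fun n => ∏ k ∈ Finset.range n, (1 + a k)) := by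
    refine ⟨Real.exp (∑' k, a k), ?_⟩
    rintro _ ⟨n, rfl⟩
    exact (Real.prod_one_add_le_exp_sum _ fun k => ha k).trans
      (Real.exp_le_exp.2 (hs.sum_le_tsum _ fun k _ => ha k))
  refine ⟨_, ?_, tendsto_atTop_ciSup hmono hbdd, fun n => ⟨h1 n, le_ciSup hbdd n⟩⟩
  exact (h1 0).trans (le_ciSup hbdd 0)

/-- A discrete Gronwall bound along a summable perturbation. -/
theorem exists_bound_of_le_one_add_mul {v a : ℕ → ℝ} (hv : ∀ n, 0 ≤ v n) (ha : ∀ n, 0 ≤ a n)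
    (hs : Summable a) (h : ∀ n, v (n + 1) ≤ (1 + a n) * v n) : ∃ B : ℝ, ∀ n, v n ≤ B := by
  obtain ⟨p, hp1, -, hp⟩ := exists_tendsto_prod_one_add ha hs
  have h1 : ∀ n, v n ≤ (∏ k ∈ Finset.range n, (1 + a k)) * v 0 := by
    intro n
    induction n with
    | zero => simp
    | succ n ih =>
      rw [Finset.prod_range_succ]
      calc v (n + 1) ≤ (1 + a n) * v n := h n
        _ ≤ (1 + a n) * ((∏ k ∈ Finset.range n, (1 + a k)) * v 0) := by
          have := ha n
          gcongr
        _ = _ := by ring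
  exact ⟨p * v 0, fun n => (h1 n).trans (mul_le_mul_of_nonneg_right (hp n).2 (hv 0))⟩

/-- Nonnegative random variables with summable expectations are almost surely summable. -/
theorem ae_summable_of_summable_integral {Ω : Type*} [MeasurableSpace Ω] {P : Measure Ω}
    {f : ℕ → Ω → ℝ} (hf : ∀ n ω, 0 ≤ f n ω) (hm : ∀ n, Measurable (f n))
    (hi : ∀ n, Integrable (f n) P) (hs : Summable fun n => ∫ ω, f n ω ∂P) :
    ∀ᵐ ω ∂P, Summable fun n => f n ω := by
  have h1 : ∫⁻ ω, ∑' n, ENNReal.ofReal (f n ω) ∂P ≠ ⊤ := by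
    rw [lintegral_tsum fun n => (hm n).ennreal_ofReal.aemeasurable]
    have h2 : ∀ n, ∫⁻ ω, ENNReal.ofReal (f n ω) ∂P = ENNReal.ofReal (∫ ω, f n ω ∂P) := fun n =>
      (ofReal_integral_eq_lintegral_ofReal (hi n) (Eventually.of_forall (hf n))).symm
    simp_rw [h2]
    exact hs.tsum_ofReal_ne_top
  filter_upwards [ae_lt_top (Measurable.tsum fun n => (hm n).ennreal_ofReal) h1] with ω hω
  have h3 := ENNReal.summable_toReal hω.ne
  simpa [ENNReal.toReal_ofReal (hf _ ω)] using h3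

/-! ### Moment bounds and almost sure convergence of the gap. -/

namespace SGDModel

variable {Ω : Type*} [mΩ : MeasurableSpace Ω] {P : Measure Ω} [IsProbabilityMeasure P] {d m : ℕ}
  {X : Ω → Vec d} {F : Vec m → ℝ} {g : Vec d → Vec m → Vec m} {Xs : ℕ → Ω → Vec d}
  {θ₀ : Ω → Vec m} {L α κ : ℝ} {γ : ℕ → ℝ}

local notation "θ" => sgd g γ Xs θ₀
local notation "𝐠" => direction g γ Xs θ₀
local notation "𝐛" => meanOracle P X g
local notation "∇F" => gradient F

section

variable (M : SGDModel P X F g Xs θ₀ L α κ γ)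
include M

theorem exists_integral_gap_succ_le : ∃ C : ℝ, 0 < C ∧ ∀ n : ℕ,
    ∫ ω, gap F (θ (n + 1) ω) ∂P ≤ ∫ ω, gap F (θ n ω) ∂P
      - κ * γ (n + 1) * ∫ ω, ‖∇F (θ n ω)‖ ^ 2 ∂P
      + C * γ (n + 1) ^ (1 + α) * (∫ ω, gap F (θ n ω) ∂P + 1) := by
  obtain ⟨C, hC, h⟩ := M.exists_condExp_gap_succ_le
  refine ⟨C, hC, fun n => ?_⟩
  have hV := M.integrable_gap n
  have hG := M.integrable_gradient_sq n
  have h1 : Integrable (fun ω => gap F (θ n ω) - κ * γ (n + 1) * ‖∇F (θ n ω)‖ ^ 2) P :=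
    hV.sub (hG.const_mul _)
  have h2 : Integrable (fun ω => C * γ (n + 1) ^ (1 + α) * (gap F (θ n ω) + 1)) P :=
    (hV.add (integrable_const 1)).const_mul _
  have h3 := integral_mono_ae integrable_condExp (h1.add h2) (h n)
  rw [integral_condExp (M.filtration.le n)] at h3
  refine h3.trans (le_of_eq ?_)
  change ∫ ω, (gap F (θ n ω) - κ * γ (n + 1) * ‖∇F (θ n ω)‖ ^ 2)
    + C * γ (n + 1) ^ (1 + α) * (gap F (θ n ω) + 1) ∂P = _
  rw [integral_add h1 h2, integral_sub hV (hG.const_mul _), integral_const_mul, integral_const_mul,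
    integral_add hV (integrable_const 1)]
  simp

omit [IsProbabilityMeasure P] in
theorem integral_gap_nonneg (n : ℕ) : 0 ≤ ∫ ω, gap F (θ n ω) ∂P :=
  integral_nonneg fun _ => M.gap_nonneg _

/-- Discarding the drift leaves a recursion with error proportional to `E gap + 1`. It is
homogeneous in `E gap + 1`, so the discrete Gronwall bound applies. -/
theorem exists_integral_gap_le : ∃ B : ℝ, 0 < B ∧ ∀ n : ℕ, ∫ ω, gap F (θ n ω) ∂P ≤ B := by
  obtain ⟨C, hC, h⟩ := M.exists_integral_gap_succ_le
  obtain ⟨B, hB⟩ := exists_bound_of_le_one_add_mul (v := fun n => ∫ ω, gap F (θ n ω) ∂P + 1)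
    (a := fun n => C * γ (n + 1) ^ (1 + α))
    (fun n => by linarith [M.integral_gap_nonneg n])
    (fun n => mul_nonneg hC.le (Real.rpow_nonneg (M.step_pos n).le _))
    (M.steps.2.2.mul_left C) fun n => by
      have h1 : 0 ≤ κ * γ (n + 1) * ∫ ω, ‖∇F (θ n ω)‖ ^ 2 ∂P :=
        mul_nonneg (mul_nonneg M.oracle.1.le (M.step_pos n).le)
          (integral_nonneg fun _ => by positivity)
      linarith [h n]
  refine ⟨max B 1, by positivity, fun n => ?_⟩
  have h1 := hB n
  exact le_max_of_le_left (by linarith)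

/-- Telescoping the expected descent: the drift spent in total is at most the initial gap plus a
summable error. This finite budget is used both to make the gradient vanish and to bound the noise
variance in the local rates. -/
theorem summable_integral_gradient_sq :
    Summable fun n : ℕ => γ (n + 1) * ∫ ω, ‖∇F (θ n ω)‖ ^ 2 ∂P := by
  obtain ⟨C, hC, h⟩ := M.exists_integral_gap_succ_le
  obtain ⟨B, hB0, hB⟩ := M.exists_integral_gap_le
  have hκ := M.oracle.1
  have hnn : ∀ n : ℕ, 0 ≤ ∫ ω, ‖∇F (θ n ω)‖ ^ 2 ∂P := fun n =>
    integral_nonneg fun _ => by positivity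
  have hp : ∀ n : ℕ, 0 ≤ γ (n + 1) ^ (1 + α) := fun n => Real.rpow_nonneg (M.step_pos n).le _
  have h1 : ∀ n : ℕ, ∑ k ∈ Finset.range n, κ * (γ (k + 1) * ∫ ω, ‖∇F (θ k ω)‖ ^ 2 ∂P)
      ≤ ∫ ω, gap F (θ 0 ω) ∂P - ∫ ω, gap F (θ n ω) ∂P
        + ∑ k ∈ Finset.range n, C * (B + 1) * γ (k + 1) ^ (1 + α) := by
    intro n
    induction n with
    | zero => simp
    | succ n ih =>
      rw [Finset.sum_range_succ, Finset.sum_range_succ]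
      have h2 : C * γ (n + 1) ^ (1 + α) * (∫ ω, gap F (θ n ω) ∂P + 1)
          ≤ C * (B + 1) * γ (n + 1) ^ (1 + α) := by
        calc _ ≤ C * γ (n + 1) ^ (1 + α) * (B + 1) := by
              have := hp n
              have := hB n
              gcongr
          _ = _ := by ring
      linarith [h n]
  have h2 : Summable fun n : ℕ => κ * (γ (n + 1) * ∫ ω, ‖∇F (θ n ω)‖ ^ 2 ∂P) := by
    refine summable_of_sum_range_le
      (c := ∫ ω, gap F (θ 0 ω) ∂P + ∑' k : ℕ, C * (B + 1) * γ (k + 1) ^ (1 + α))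
      (fun n => mul_nonneg hκ.le (mul_nonneg (M.step_pos n).le (hnn n))) fun n => ?_
    have h3 := (M.steps.2.2.mul_left (C * (B + 1))).sum_le_tsum (Finset.range n)
      fun k _ => mul_nonneg (by positivity) (hp k)
    linarith [h1 n, M.integral_gap_nonneg n]
  exact (summable_mul_left_iff hκ.ne').1 h2

theorem ae_summable_gradient_sq :
    ∀ᵐ ω ∂P, Summable fun n : ℕ => γ (n + 1) * ‖∇F (θ n ω)‖ ^ 2 := by
  refine ae_summable_of_summable_integral
    (fun n ω => mul_nonneg (M.step_pos n).le (by positivity))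
    (fun n => ((M.measurable_gradient_sgd n).norm.pow_const 2).const_mul _)
    (fun n => (M.integrable_gradient_sq n).const_mul _) ?_
  simp_rw [integral_const_mul]
  exact M.summable_integral_gradient_sq

/-- The optimality gap converges almost surely. -/
theorem ae_exists_tendsto_gap :
    ∀ᵐ ω ∂P, ∃ c, Tendsto (fun n => gap F (θ n ω)) atTop (𝓝 c) := by
  obtain ⟨C, hC, h⟩ := M.exists_condExp_gap_succ_le
  obtain ⟨B, hB0, hB⟩ := M.exists_integral_gap_le
  have ha : ∀ n, 0 ≤ C * γ (n + 1) ^ (1 + α) := fun n =>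
    mul_nonneg hC.le (Real.rpow_nonneg (M.step_pos n).le _)
  obtain ⟨p, hp1, hpt, hp⟩ := exists_tendsto_prod_one_add ha (M.steps.2.2.mul_left C)
  set q : ℕ → ℝ := fun n => ∏ k ∈ Finset.range n, (1 + C * γ (k + 1) ^ (1 + α)) with hq
  -- Adding `1` makes the recursion homogeneous, and dividing by `q n` cancels its factor `1 + C
  -- γ^(1+α)`: `U` is a true supermartingale.
  let U : ℕ → Ω → ℝ := fun n ω => (q n)⁻¹ * (gap F (θ n ω) + 1)
  have hUi : ∀ n, Integrable (U n) P := fun n =>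
    ((M.integrable_gap n).add (integrable_const 1)).const_mul _
  have hU : Supermartingale U M.filtration P := by
    refine supermartingale_nat (fun n => ?_) hUi fun n => ?_
    · exact (((M.measurable_gap.comp (M.measurable_sgd_filtration n)).add_const 1).const_mul
        _).stronglyMeasurable
    · have h1 := condExp_smul (μ := P) (q (n + 1))⁻¹ (fun ω => gap F (θ (n + 1) ω) + 1)
        (M.filtration n)
      have h2 := condExp_add (M.integrable_gap (n + 1)) (integrable_const (1 : ℝ)) (M.filtration n)
      have h3 := condExp_const (μ := P) (M.filtration.le n) (1 : ℝ)
      filter_upwards [h1, h2, h n] with ω e1 e2 e3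
      rw [h3] at e2
      have h4 : q (n + 1) = q n * (1 + C * γ (n + 1) ^ (1 + α)) := Finset.prod_range_succ _ _
      have h5 : 0 < q n := zero_lt_one.trans_le (hp n).1
      have h6 : 0 < 1 + C * γ (n + 1) ^ (1 + α) := by linarith [ha n]
      have h7 : 0 ≤ κ * γ (n + 1) * ‖∇F (θ n ω)‖ ^ 2 :=
        mul_nonneg (mul_nonneg M.oracle.1.le (M.step_pos n).le) (by positivity)
      refine e1.le.trans ?_
      change (q (n + 1))⁻¹ * (P[(fun ω => gap F (θ (n + 1) ω)) + fun _ => (1 : ℝ) |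
        M.filtration n]) ω ≤ _
      rw [e2, Pi.add_apply, h4]
      calc _ ≤ (q n * (1 + C * γ (n + 1) ^ (1 + α)))⁻¹
            * ((1 + C * γ (n + 1) ^ (1 + α)) * (gap F (θ n ω) + 1)) := by
            gcongr
            linarith
        _ = U n ω := by
            simp only [U]
            field_simp
  have hbdd : ∀ n, eLpNorm (fun ω => -U n ω) 1 P ≤ ((B + 1).toNNReal : ENNReal) := by
    intro n
    have h0 : Integrable (fun ω => -U n ω) P := (hUi n).neg
    rw [eLpNorm_one_eq_lintegral_enorm, ← ofReal_integral_norm_eq_lintegral_enorm h0]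
    refine ENNReal.ofReal_le_ofReal ?_
    have h1 : ∀ ω, ‖-U n ω‖ ≤ gap F (θ n ω) + 1 := by
      intro ω
      have h5 : (q n)⁻¹ ≤ 1 := inv_le_one_of_one_le₀ (hp n).1
      have h6 : 0 < q n := zero_lt_one.trans_le (hp n).1
      have h7 := M.gap_nonneg (θ n ω)
      simp only [norm_neg, U]
      rw [Real.norm_of_nonneg (by positivity)]
      exact mul_le_of_le_one_left (by positivity) h5
    calc _ ≤ ∫ ω, (gap F (θ n ω) + 1) ∂P :=
          integral_mono h0.norm ((M.integrable_gap n).add (integrable_const 1)) h1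
      _ = ∫ ω, gap F (θ n ω) ∂P + 1 := by
          rw [integral_add (M.integrable_gap n) (integrable_const 1)]; simp
      _ ≤ B + 1 := by linarith [hB n]
  filter_upwards [hU.neg.exists_ae_tendsto_of_bdd hbdd] with ω ⟨c, hc⟩
  -- Here `c` is the limit of the submartingale `-U`, and the gap is `q n * U n - 1` with `q n`
  -- tending to `p`.
  refine ⟨p * -c - 1, ?_⟩
  refine ((hpt.mul hc.neg).sub_const 1).congr fun n => ?_
  have h6 : q n ≠ 0 := (zero_lt_one.trans_le (hp n).1).ne'
  simp only [Pi.neg_apply, neg_neg, U]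
  change q n * _ - 1 = _
  field_simp
  ring

end

/-! ### Martingale sums of the noise along bounded fields. -/

/-- Weighted sums of the noise along a field. -/
noncomputable def noiseSum (P : Measure Ω) (X : Ω → Vec d) (g : Vec d → Vec m → Vec m) (γ : ℕ → ℝ)
    (Xs : ℕ → Ω → Vec d) (θ₀ : Ω → Vec m) (u : Vec m → Vec m) (a : ℕ → ℝ) (n : ℕ) (ω : Ω) : ℝ :=
  ∑ k ∈ Finset.range n, a k * noise P X g γ Xs θ₀ u k ω

section

variable (M : SGDModel P X F g Xs θ₀ L α κ γ) {u : Vec m → Vec m}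
  (hu : Measurable u) {K : ℝ} (hK : ∀ x, ‖u x‖ ≤ K)
include M hu hK

theorem integrable_norm_sq (n : ℕ) : Integrable (fun ω => ‖u (θ n ω)‖ ^ 2) P := by
  refine Integrable.mono' (integrable_const (K ^ 2))
    ((hu.comp (M.measurable_sgd n)).norm.pow_const 2).aestronglyMeasurable
    (Eventually.of_forall fun ω => ?_)
  rw [Real.norm_of_nonneg (by positivity)]
  gcongr
  exact hK _

omit [IsProbabilityMeasure P] in
theorem integrable_norm_sq_mul {f : Ω → ℝ} (hf : Integrable f P) (n : ℕ) :
    Integrable (fun ω => ‖u (θ n ω)‖ ^ 2 * f ω) P := by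
  refine hf.bdd_mul (c := K ^ 2)
    ((hu.comp (M.measurable_sgd n)).norm.pow_const 2).aestronglyMeasurable
    (Eventually.of_forall fun ω => ?_)
  rw [Real.norm_of_nonneg (by positivity)]
  gcongr
  exact hK _

theorem memLp_noise (n : ℕ) : MemLp (noise P X g γ Xs θ₀ u n) 2 P := by
  have hV := M.integrable_gap n
  rw [memLp_two_iff_integrable_sq (M.measurable_noise hu n).aestronglyMeasurable]
  refine Integrable.mono' (M.integrable_norm_sq_mul hu hK
    (((M.integrable_direction_sq n hV).const_mul 2).add
      ((M.integrable_meanOracle_sq_of_gap n hV).const_mul 2)) n)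
    ((M.measurable_noise hu n).pow_const 2).aestronglyMeasurable (Eventually.of_forall fun ω => ?_)
  rw [Real.norm_of_nonneg (by positivity)]
  exact noise_sq_le u n ω

theorem condExp_noise (n : ℕ) : P[noise P X g γ Xs θ₀ u n | M.filtration n] =ᵐ[P] 0 :=
  M.condExp_noise_of_gap hu n (M.integrable_gap n) (M.integrable_norm_sq hu hK n)

/-- The weight `‖u‖²` is a function of the current iterate, so it passes through the conditional
expectation. Keeping it is essential: it later supplies the factor `‖∇F‖²` in the variance. -/
theorem integral_norm_sq_mul_direction_sq_le {C : ℝ}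
    (hC : ∀ x : Vec m, ∫ y, ‖g y x‖ ^ 2 ∂(P.map X) ≤ C * (gap F x + 1)) (n : ℕ) :
    ∫ ω, ‖u (θ n ω)‖ ^ 2 * ‖𝐠 n ω‖ ^ 2 ∂P
      ≤ C * ∫ ω, ‖u (θ n ω)‖ ^ 2 * (gap F (θ n ω) + 1) ∂P := by
  have hV := M.integrable_gap n
  have hm : Measurable (Function.uncurry fun (y : Vec d) (x : Vec m) =>
      ‖u x‖ ^ 2 * ‖g y x‖ ^ 2) :=
    ((hu.comp measurable_snd).norm.pow_const 2).mul (M.measurable_oracle.norm.pow_const 2)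
  have h1 := M.condExp_innovation n hm
    (M.integrable_norm_sq_mul hu hK (M.integrable_direction_sq n hV) n)
  have h2 : Integrable (fun ω => C * (‖u (θ n ω)‖ ^ 2 * (gap F (θ n ω) + 1))) P :=
    (M.integrable_norm_sq_mul hu hK (hV.add (integrable_const 1)) n).const_mul C
  have h3 : P[fun ω => ‖u (θ n ω)‖ ^ 2 * ‖𝐠 n ω‖ ^ 2 | M.filtration n] ≤ᵐ[P]
      fun ω => C * (‖u (θ n ω)‖ ^ 2 * (gap F (θ n ω) + 1)) := by
    refine h1.trans_le (Eventually.of_forall fun ω => ?_)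
    simp only
    rw [integral_const_mul]
    calc _ ≤ ‖u (θ n ω)‖ ^ 2 * (C * (gap F (θ n ω) + 1)) := by
          gcongr
          exact hC _
      _ = _ := by ring
  have h4 := integral_mono_ae integrable_condExp h2 h3
  rwa [integral_condExp (M.filtration.le n), integral_const_mul] at h4

omit hK in
theorem measurable_noiseSum_filtration (a : ℕ → ℝ) (n : ℕ) :
    Measurable[M.filtration n] (noiseSum P X g γ Xs θ₀ u a n) := by
  refine Finset.measurable_fun_sum _ fun k hk => ?_
  exact ((M.measurable_noise_filtration hu k).mono
    (M.filtration.mono (Finset.mem_range.1 hk)) le_rfl).const_mul _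

theorem memLp_noiseSum (a : ℕ → ℝ) (n : ℕ) : MemLp (noiseSum P X g γ Xs θ₀ u a n) 2 P :=
  memLp_finsetSum _ fun k _ => (M.memLp_noise hu hK k).const_mul (a k)

/-- Sums of the noise are martingales. -/
theorem martingale_noiseSum (a : ℕ → ℝ) :
    Martingale (noiseSum P X g γ Xs θ₀ u a) M.filtration P := by
  refine martingale_nat
    (fun n => (M.measurable_noiseSum_filtration hu a n).stronglyMeasurable)
    (fun n => (M.memLp_noiseSum hu hK a n).integrable one_le_two) fun n => ?_
  have h0 : noiseSum P X g γ Xs θ₀ u a (n + 1)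
      = noiseSum P X g γ Xs θ₀ u a n + a n • noise P X g γ Xs θ₀ u n := by
    funext ω
    exact Finset.sum_range_succ _ _
  have hi := (M.memLp_noiseSum hu hK a n).integrable one_le_two
  have hn := (M.memLp_noise hu hK n).integrable one_le_two
  have h1 := condExp_add hi (hn.smul (a n)) (M.filtration n)
  have h2 := condExp_smul (μ := P) (a n) (noise P X g γ Xs θ₀ u n) (M.filtration n)
  have h3 := condExp_of_stronglyMeasurable (M.filtration.le n)
    (M.measurable_noiseSum_filtration hu a n).stronglyMeasurable hi
  rw [h0]
  filter_upwards [h1, h2, M.condExp_noise hu hK n] with ω e1 e2 e3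
  rw [e1, Pi.add_apply, e2, h3, Pi.smul_apply, e3]
  simp

end

section

variable (M : SGDModel P X F g Xs θ₀ L α κ γ)
include M

/-- The second moments of sums of the noise. -/
theorem exists_integral_noiseSum_sq_le : ∃ C : ℝ, 0 < C ∧ ∀ (u : Vec m → Vec m) (K : ℝ),
    Measurable u → (∀ x, ‖u x‖ ≤ K) → ∀ (a : ℕ → ℝ) (n : ℕ),
      ∫ ω, noiseSum P X g γ Xs θ₀ u a n ω ^ 2 ∂P
        ≤ C * ∑ k ∈ Finset.range n, a k ^ 2 * ∫ ω, ‖u (θ k ω)‖ ^ 2 * (gap F (θ k ω) + 1) ∂P := by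
  obtain ⟨C₁, hC₁, h₁⟩ := M.exists_integral_oracle_sq_le
  obtain ⟨C₂, hC₂, h₂⟩ := M.exists_meanOracle_sq_le
  refine ⟨2 * C₁ + 2 * C₂, by positivity, fun u K hu hK a n => ?_⟩
  induction n with
  | zero => simp [noiseSum]
  | succ n ih =>
    have hV := M.integrable_gap n
    set T := noiseSum P X g γ Xs θ₀ u a n with hT
    set Y := noise P X g γ Xs θ₀ u n with hY
    have hTL : MemLp T 2 P := M.memLp_noiseSum hu hK a n
    have hYL : MemLp Y 2 P := M.memLp_noise hu hK n
    have hTY : Integrable (T * Y) P := hTL.integrable_mul hYL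
    have h0 : ∀ ω, noiseSum P X g γ Xs θ₀ u a (n + 1) ω ^ 2
        = T ω ^ 2 + 2 * a n * (T * Y) ω + a n ^ 2 * Y ω ^ 2 := by
      intro ω
      have : noiseSum P X g γ Xs θ₀ u a (n + 1) ω = T ω + a n * Y ω := Finset.sum_range_succ _ _
      rw [this, Pi.mul_apply]
      ring
    -- Orthogonality of martingale increments: `T` is known at time `n` and `Y` is conditionally
    -- centred.
    have hz : ∫ ω, (T * Y) ω ∂P = 0 := by
      rw [← integral_condExp (M.filtration.le n)]
      have e1 := condExp_mul_of_stronglyMeasurable_left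
        (M.measurable_noiseSum_filtration hu a n).stronglyMeasurable hTY
        (hYL.integrable one_le_two)
      have e2 : P[T * Y | M.filtration n] =ᵐ[P] 0 := by
        filter_upwards [e1, M.condExp_noise hu hK n] with ω e3 e4
        rw [e3, Pi.mul_apply, e4]
        simp
      rw [integral_congr_ae e2]
      simp
    have hY2 : ∫ ω, Y ω ^ 2 ∂P
        ≤ (2 * C₁ + 2 * C₂) * ∫ ω, ‖u (θ n ω)‖ ^ 2 * (gap F (θ n ω) + 1) ∂P := by
      have i1 := M.integrable_norm_sq_mul hu hK (M.integrable_direction_sq n hV) n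
      have i2 : Integrable (fun ω => ‖u (θ n ω)‖ ^ 2 * (gap F (θ n ω) + 1)) P :=
        M.integrable_norm_sq_mul hu hK (hV.add (integrable_const 1)) n
      have i3 := M.integral_norm_sq_mul_direction_sq_le hu hK h₁ n
      calc ∫ ω, Y ω ^ 2 ∂P
          ≤ ∫ ω, (2 * (‖u (θ n ω)‖ ^ 2 * ‖𝐠 n ω‖ ^ 2)
            + 2 * C₂ * (‖u (θ n ω)‖ ^ 2 * (gap F (θ n ω) + 1))) ∂P := by
            refine integral_mono hYL.integrable_sq ((i1.const_mul 2).add (i2.const_mul (2 * C₂)))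
              fun ω => ?_
            refine (noise_sq_le u n ω).trans ?_
            have := mul_le_mul_of_nonneg_left (h₂ (θ n ω)) (sq_nonneg ‖u (θ n ω)‖)
            linarith
        _ = 2 * ∫ ω, ‖u (θ n ω)‖ ^ 2 * ‖𝐠 n ω‖ ^ 2 ∂P
            + 2 * C₂ * ∫ ω, ‖u (θ n ω)‖ ^ 2 * (gap F (θ n ω) + 1) ∂P := by
            rw [integral_add (i1.const_mul 2) (i2.const_mul (2 * C₂)), integral_const_mul,
              integral_const_mul]
        _ ≤ _ := by linarith
    simp_rw [h0]
    have i4 : Integrable (fun ω => T ω ^ 2 + 2 * a n * (T * Y) ω) P :=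
      hTL.integrable_sq.add (hTY.const_mul _)
    rw [integral_add i4 (hYL.integrable_sq.const_mul _), integral_add hTL.integrable_sq (hTY.const_mul _), integral_const_mul, integral_const_mul, hz,
      Finset.sum_range_succ]
    have := mul_le_mul_of_nonneg_left hY2 (sq_nonneg (a n))
    linarith

/-- The accumulated noise converges almost surely. -/
theorem ae_exists_tendsto_noise : ∀ᵐ ω ∂P, ∃ v : Vec m,
    Tendsto (fun n => ∑ k ∈ Finset.range n, γ (k + 1) • (𝐠 k ω - 𝐛 (θ k ω))) atTop (𝓝 v) := by
  obtain ⟨C, hC, hC'⟩ := M.exists_integral_noiseSum_sq_le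
  obtain ⟨B, hB0, hB⟩ := M.exists_integral_gap_le
  have hs : Summable fun n : ℕ => γ (n + 1) ^ 2 := by
    refine Summable.of_norm_bounded_eventually_nat M.steps.2.2 ?_
    have h1 := M.steps.2.2.tendsto_atTop_zero
    have hα : 0 < 1 + α := by linarith [M.α_pos]
    filter_upwards [h1.eventually (gt_mem_nhds zero_lt_one)] with n hn
    have h2 := M.step_pos n
    have h3 : γ (n + 1) ≤ 1 := by
      by_contra h
      exact absurd hn (not_lt.2 (Real.one_le_rpow (not_le.1 h).le hα.le))
    rw [Real.norm_of_nonneg (by positivity), ← Real.rpow_two]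
    exact Real.rpow_le_rpow_of_exponent_ge h2 h3 (by linarith [M.α_le])
  have hcoord : ∀ i : Fin m, ∀ᵐ ω ∂P, ∃ c : ℝ, Tendsto (fun n =>
      ∑ k ∈ Finset.range n, γ (k + 1) * (𝐠 k ω - 𝐛 (θ k ω)) i) atTop (𝓝 c) := by
    intro i
    -- A constant basis vector as field turns the scalar noise into the `i`-th coordinate of the
    -- vector noise.
    let u : Vec m → Vec m := fun _ => EuclideanSpace.single i 1
    have hu : Measurable u := measurable_const
    have hK : ∀ x, ‖u x‖ ≤ 1 := fun x => by simp [u]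
    set a : ℕ → ℝ := fun k => γ (k + 1)
    have hbdd : ∀ n, eLpNorm (noiseSum P X g γ Xs θ₀ u a n) 1 P
        ≤ ((1 + C * ∑' k, a k ^ 2 * (B + 1)).toNNReal : ENNReal) := by
      intro n
      have hTL := M.memLp_noiseSum hu hK a n
      have hTi := hTL.integrable one_le_two
      rw [eLpNorm_one_eq_lintegral_enorm, ← ofReal_integral_norm_eq_lintegral_enorm hTi]
      refine ENNReal.ofReal_le_ofReal ?_
      calc _ ≤ ∫ ω, (1 + noiseSum P X g γ Xs θ₀ u a n ω ^ 2) ∂P := by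
            refine integral_mono hTi.norm ((integrable_const 1).add hTL.integrable_sq) fun ω => ?_
            have h1 := sq_abs (noiseSum P X g γ Xs θ₀ u a n ω)
            simp only [Real.norm_eq_abs]
            nlinarith [sq_nonneg (|noiseSum P X g γ Xs θ₀ u a n ω| - 1)]
        _ = 1 + ∫ ω, noiseSum P X g γ Xs θ₀ u a n ω ^ 2 ∂P := by
            rw [integral_add (integrable_const 1) hTL.integrable_sq]; simp
        _ ≤ 1 + C * ∑ k ∈ Finset.range n, a k ^ 2
            * ∫ ω, ‖u (θ k ω)‖ ^ 2 * (gap F (θ k ω) + 1) ∂P := by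
            gcongr
            exact hC' u 1 hu hK a n
        _ ≤ 1 + C * ∑ k ∈ Finset.range n, a k ^ 2 * (B + 1) := by
            gcongr with k hk
            have : ∫ ω, (gap F (θ k ω) + 1) ∂P = ∫ ω, gap F (θ k ω) ∂P + 1 := by
              rw [integral_add (M.integrable_gap k) (integrable_const 1)]; simp
            simp only [u, PiLp.norm_single, norm_one, one_pow, one_mul]
            linarith [hB k]
        _ ≤ _ := by
            gcongr
            exact (hs.mul_right (B + 1)).sum_le_tsum _ fun k _ => by positivity
    filter_upwards [(M.martingale_noiseSum hu hK a).submartingale.exists_ae_tendsto_of_bdd hbdd]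
      with ω ⟨c, hc⟩
    refine ⟨c, hc.congr fun n => ?_⟩
    refine Finset.sum_congr rfl fun k _ => ?_
    simp [noise, u, a, EuclideanSpace.inner_single_left]
  filter_upwards [ae_all_iff.2 hcoord] with ω hω
  choose c hc using hω
  refine ⟨WithLp.toLp 2 c, ?_⟩
  have h1 : Tendsto (fun n => fun i : Fin m =>
      ∑ k ∈ Finset.range n, γ (k + 1) * (𝐠 k ω - 𝐛 (θ k ω)) i) atTop (𝓝 c) :=
    tendsto_pi_nhds.2 hc
  have h2 := ((PiLp.continuous_toLp 2 fun _ : Fin m => ℝ).tendsto c).comp h1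
  refine h2.congr fun n => ?_
  ext i
  simp

end

end SGDModel

/-! ### The gradient vanishes along the trajectory. -/

/-- Along a perturbed gradient-like recursion with small total noise, a Hölder continuous field with
summable weighted squares vanishes in the limit. -/
theorem tendsto_norm_zero_of_recursion {m : ℕ} {G : Vec m → Vec m} {L α c : ℝ} (hL : 0 < L)
    (hα : 0 < α) (hc : 0 < c) (hG : ∀ x y : Vec m, ‖G y - G x‖ ≤ L * ‖y - x‖ ^ α)
    {x b e : ℕ → Vec m} {a : ℕ → ℝ} (ha : ∀ n, 0 ≤ a n)
    (hx : ∀ n, x (n + 1) = x n - (a n • b n + a n • e n)) (hb : ∀ n, ‖b n‖ ≤ c * ‖G (x n)‖)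
    (hs : Summable fun n => a n * ‖G (x n)‖ ^ 2) (ha' : ¬Summable a) (ha0 : Tendsto a atTop (𝓝 0))
    {v : Vec m} (hv : Tendsto (fun n => ∑ k ∈ Finset.range n, a k • e k) atTop (𝓝 v)) :
    Tendsto (fun n => ‖G (x n)‖) atTop (𝓝 0) := by
  set y : ℕ → ℝ := fun n => ‖G (x n)‖ with hy
  have hy0 : ∀ n, 0 ≤ y n := fun n => norm_nonneg _
  -- If `y` stayed above `ε`, then `∑ a` would be dominated by `ε⁻² ∑ a y²` and converge.
  have hfreq : ∀ ε : ℝ, 0 < ε → ∃ᶠ n in atTop, y n < ε := by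
    intro ε hε hcon
    refine ha' (Summable.of_norm_bounded_eventually_nat (hs.mul_left (ε ^ 2)⁻¹) ?_)
    filter_upwards [hcon] with n hn
    have h1 : ε ^ 2 ≤ y n ^ 2 := by
      have := not_lt.1 hn
      gcongr
    rw [Real.norm_of_nonneg (ha n), ← div_eq_inv_mul, le_div_iff₀ (by positivity)]
    exact mul_le_mul_of_nonneg_left h1 (ha n)
  have hev : ∀ ε : ℝ, 0 < ε → ∀ᶠ n in atTop, y n < 2 * ε := by
    intro ε hε
    -- A displacement of at most `D` changes `G` by at most `ε / 2`. It is split into three parts of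
    -- size `D / 3`: noise, the first drift step, the other drift steps.
    set D : ℝ := (ε / (2 * L)) ^ (1 / α) with hD
    have hD0 : 0 < D := Real.rpow_pos_of_pos (by positivity) _
    have hLD : L * D ^ α = ε / 2 := by
      rw [hD, ← Real.rpow_mul (by positivity), one_div_mul_cancel hα.ne', Real.rpow_one]
      field_simp
    obtain ⟨N₁, hN₁⟩ := Metric.cauchySeq_iff.1 hs.hasSum.tendsto_sum_nat.cauchySeq
      (D * ε / (3 * c)) (by positivity)
    obtain ⟨N₂, hN₂⟩ := Metric.cauchySeq_iff.1 hv.cauchySeq (D / 3) (by positivity)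
    obtain ⟨N₃, hN₃⟩ := eventually_atTop.1
      (ha0.eventually (gt_mem_nhds (show (0 : ℝ) < D / (3 * (c * ε)) by positivity)))
    obtain ⟨p₀, hp₀, hyp₀⟩ := (frequently_atTop.1 (hfreq ε hε)) (max N₁ (max N₂ N₃))
    have hp1 : N₁ ≤ p₀ := (le_max_left _ _).trans hp₀
    have hp2 : N₂ ≤ p₀ := (le_max_left _ _).trans ((le_max_right _ _).trans hp₀)
    have hp3 : N₃ ≤ p₀ := (le_max_right _ _).trans ((le_max_right _ _).trans hp₀)
    refine eventually_atTop.2 ⟨p₀, fun q hq => ?_⟩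
    by_contra hcon
    have hcon := not_lt.1 hcon
    classical
    -- The last time up to `q` at which `y` is below `ε`: on the excursion that follows, `y ≥ ε`.
    set p := Nat.findGreatest (fun k => y k < ε) q with hp
    have hp0p : p₀ ≤ p := Nat.le_findGreatest hq hyp₀
    have hyp : y p < ε := Nat.findGreatest_spec (P := fun k => y k < ε) hq hyp₀
    have hpq : p < q := by
      refine lt_of_le_of_ne (Nat.findGreatest_le q) fun h => ?_
      rw [h] at hyp
      linarith
    have hbig : ∀ k, p < k → k ≤ q → ε ≤ y k := fun k h1 h2 =>
      not_lt.1 (Nat.findGreatest_is_greatest h1 h2)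
    have htel : ∀ n, x n = x 0 - (∑ k ∈ Finset.range n, a k • b k
        + ∑ k ∈ Finset.range n, a k • e k) := by
      intro n
      induction n with
      | zero => simp
      | succ n ih =>
        rw [hx, Finset.sum_range_succ, Finset.sum_range_succ]
        nth_rewrite 1 [ih]
        abel
    have hdiff : x q - x p = -(∑ k ∈ Finset.Ico p q, a k • b k
        + (∑ k ∈ Finset.range q, a k • e k - ∑ k ∈ Finset.range p, a k • e k)) := by
      rw [Finset.sum_Ico_eq_sub _ hpq.le, htel q, htel p]
      abel
    have h1 : ‖∑ k ∈ Finset.range q, a k • e k - ∑ k ∈ Finset.range p, a k • e k‖ ≤ D / 3 := by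
      rw [← dist_eq_norm]
      exact (hN₂ q (by omega) p (by omega)).le
    have h2 : ∑ k ∈ Finset.Ico (p + 1) q, a k * y k ^ 2 ≤ D * ε / (3 * c) := by
      have h3 := hN₁ q (by omega) (p + 1) (by omega)
      rw [Real.dist_eq, ← Finset.sum_Ico_eq_sub _ (by omega : p + 1 ≤ q)] at h3
      exact (le_abs_self _).trans h3.le
    have h3 : ‖∑ k ∈ Finset.Ico p q, a k • b k‖ ≤ D / 3 + D / 3 := by
      have h4 : ∀ k, ‖a k • b k‖ ≤ a k * (c * y k) := fun k => by
        rw [norm_smul, Real.norm_of_nonneg (ha k)]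
        exact mul_le_mul_of_nonneg_left (hb k) (ha k)
      refine (norm_sum_le_of_le _ fun k _ => h4 k).trans ?_
      -- At index `p` itself `y` is small, so that term is controlled by the smallness of `a p`;
      -- afterwards `y ≤ y² / ε`, and the tail of `∑ a y²` takes over.
      rw [Finset.sum_eq_sum_Ico_succ_bot hpq]
      refine add_le_add ?_ ?_
      · have h5 := (hN₃ p (by omega)).le
        calc a p * (c * y p) ≤ D / (3 * (c * ε)) * (c * ε) := by
              have := hy0 p
              gcongr
          _ = D / 3 := by field_simp
      · calc ∑ k ∈ Finset.Ico (p + 1) q, a k * (c * y k)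
            ≤ ∑ k ∈ Finset.Ico (p + 1) q, c / ε * (a k * y k ^ 2) := by
              refine Finset.sum_le_sum fun k hk => ?_
              rw [Finset.mem_Ico] at hk
              have h5 := hbig k (by omega) (by omega)
              have h6 : y k ≤ y k ^ 2 / ε := by
                rw [le_div_iff₀ hε]
                nlinarith [hy0 k]
              calc a k * (c * y k) ≤ a k * (c * (y k ^ 2 / ε)) := by
                    have := ha k
                    gcongr
                _ = _ := by ring
          _ = c / ε * ∑ k ∈ Finset.Ico (p + 1) q, a k * y k ^ 2 := by rw [Finset.mul_sum]
          _ ≤ c / ε * (D * ε / (3 * c)) := by gcongr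
          _ = D / 3 := by field_simp
    have h4 : ‖x q - x p‖ ≤ D := by
      rw [hdiff, norm_neg]
      exact (norm_add_le _ _).trans (by linarith)
    have h5 : y q ≤ y p + ε / 2 := by
      have h6 : y q ≤ y p + ‖G (x q) - G (x p)‖ := by
        simpa [hy] using norm_add_le (G (x p)) (G (x q) - G (x p))
      have h7 := hG (x p) (x q)
      have h8 : L * ‖x q - x p‖ ^ α ≤ L * D ^ α := by gcongr
      linarith
    linarith
  rw [Metric.tendsto_atTop]
  intro ε hε
  obtain ⟨N, hN⟩ := eventually_atTop.1 (hev (ε / 2) (by positivity))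
  refine ⟨N, fun n hn => ?_⟩
  rw [Real.dist_eq, sub_zero, abs_of_nonneg (hy0 n)]
  linarith [hN n hn]

/-! ### Weights and step sizes; exponential weights for a linear drift. -/

/-- Weights `w` that turn a drift of strength `φ`, up to errors `e`, into the rate `R`. -/
structure RateWeights (γ : ℕ → ℝ) (α : ℝ) (φ : ℝ → ℝ) (R w e : ℕ → ℝ) (N : ℕ) (C : ℝ) :
    Prop where
  one_le : 1 ≤ N
  C_pos : 0 < C
  R_pos : ∀ n, 1 ≤ n → 0 < R n
  w_pos : ∀ n, N ≤ n → 0 < w n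
  e_nonneg : ∀ n, N ≤ n → 0 ≤ e n
  one_le_mul : ∀ n, N ≤ n → 1 ≤ C * (w n * R n)
  sum_le : ∀ n, N ≤ n →
    ∑ k ∈ Finset.Ico N n, w (k + 1) * (e k + γ (k + 1) ^ (1 + α)) ≤ C * (w n * R n)
  drift : ∀ n, N ≤ n → ∀ x y : ℝ, φ x ≤ y →
    w (n + 1) * (x - γ (n + 1) * y) ≤ w n * x + w (n + 1) * e n

/-- The weights control the fluctuations of the noise. -/
def NoiseWeights (γ R w : ℕ → ℝ) (N : ℕ) (C : ℝ) : Prop :=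
  ∀ k n, N ≤ k → k < n → w (k + 1) ^ 2 * γ (k + 1) ≤ C * (w n * R n) ^ 2

theorem stepSum_succ (γ : ℕ → ℝ) (n : ℕ) : stepSum γ (n + 1) = stepSum γ n + γ (n + 1) :=
  Finset.sum_Icc_succ_top (by omega) _

theorem stepSum_eq_sum_range (γ : ℕ → ℝ) (n : ℕ) :
    stepSum γ n = ∑ k ∈ Finset.range n, γ (k + 1) := by
  induction n with
  | zero => simp [stepSum]
  | succ n ih => rw [stepSum_succ, ih, Finset.sum_range_succ]

section Steps

variable {γ : ℕ → ℝ} {α : ℝ}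

theorem StepSizes.monotone_stepSum (h : StepSizes γ α) : Monotone (stepSum γ) :=
  monotone_nat_of_le_succ fun n => by
    rw [stepSum_succ]
    linarith [h.1 (n + 1) (by omega)]

theorem StepSizes.stepSum_pos (h : StepSizes γ α) {n : ℕ} (hn : 1 ≤ n) : 0 < stepSum γ n := by
  have h1 := h.monotone_stepSum hn
  have h2 : stepSum γ 1 = γ 1 := by simp [stepSum]
  linarith [h.1 1 le_rfl]

theorem StepSizes.tendsto_zero (h : StepSizes γ α) (hα : 0 < α) :
    Tendsto (fun n => γ (n + 1)) atTop (𝓝 0) := by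
  have hα1 : 0 < 1 + α := by linarith
  have h1 := h.2.2.tendsto_atTop_zero.rpow_const (p := (1 + α)⁻¹) (Or.inr (by positivity))
  rw [Real.zero_rpow (by positivity)] at h1
  refine h1.congr fun n => ?_
  rw [← Real.rpow_mul (h.1 _ (by omega)).le, mul_inv_cancel₀ hα1.ne', Real.rpow_one]

theorem StepSizes.exists_le (h : StepSizes γ α) (hα : 0 < α) :
    ∃ B : ℝ, 1 ≤ B ∧ ∀ n, 1 ≤ n → γ n ≤ B := by
  obtain ⟨B, hB⟩ := (h.tendsto_zero hα).bddAbove_range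
  refine ⟨max B 1, le_max_right _ _, fun n hn => le_max_of_le_left (hB ⟨n - 1, ?_⟩)⟩
  simp only
  congr 1
  omega

theorem StepSizes.not_summable (h : StepSizes γ α) : ¬Summable fun n => γ (n + 1) := by
  intro hs
  have h1 := hs.hasSum.tendsto_sum_nat
  simp_rw [← stepSum_eq_sum_range] at h1
  exact not_tendsto_nhds_of_tendsto_atTop h.2.1 _ h1

/-- The steps decay slowly enough compared with `exp (-μ S_n)`. -/
theorem exists_eventually_log_le {q μ : ℝ} (hq : 0 < q) (hμ : 0 < μ)
    (hγ : ∀ n : ℕ, 1 ≤ n → 0 < γ n) (h : SlowSteps γ ∨ ∃ γs : ℝ, 0 < γs ∧ CriticalSteps γ γs)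
    (hcrit : ∀ γs : ℝ, 0 < γs → CriticalSteps γ γs → q < μ * γs) :
    ∃ μ' : ℝ, 0 < μ' ∧ μ' < μ ∧
      ∀ᶠ n in atTop, q * Real.log (γ n / γ (n + 1)) ≤ μ' * γ (n + 1) := by
  rcases h with h | ⟨γs, hγs, h⟩
  · refine ⟨μ / 2, by positivity, by linarith, ?_⟩
    filter_upwards [h.def (show 0 < μ / 2 / q by positivity)] with n hn
    rw [Real.norm_eq_abs, Real.norm_of_nonneg (hγ (n + 1) (by omega)).le] at hn
    calc q * Real.log (γ n / γ (n + 1)) ≤ q * (μ / 2 / q * γ (n + 1)) := by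
          gcongr
          exact (le_abs_self _).trans hn
      _ = _ := by field_simp
  · have h1 : q / γs < μ := (div_lt_iff₀ hγs).2 (hcrit γs hγs h)
    have h2 : 0 < q / γs := by positivity
    -- Asymptotically `q log(γ_n / γ_{n+1})` is `(q / γs) γ_{n+1}`, so any constant strictly above
    -- `q / γs` works eventually; the midpoint also stays below `μ`.
    refine ⟨(q / γs + μ) / 2, by positivity, by linarith, ?_⟩
    filter_upwards [IsLittleO.def h (show 0 < (μ - q / γs) / 2 / (q / γs) from
      div_pos (by linarith) h2)] with n hn
    have h3 := hγ (n + 1) (by omega)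
    simp only [Pi.sub_apply] at hn
    rw [Real.norm_eq_abs, Real.norm_of_nonneg (by positivity)] at hn
    have h4 := (le_abs_self _).trans hn
    have h5 : q * ((μ - q / γs) / 2 / (q / γs) * (γ (n + 1) / γs) + γ (n + 1) / γs)
        = (q / γs + μ) / 2 * γ (n + 1) := by
      field_simp
      ring
    rw [← h5]
    exact mul_le_mul_of_nonneg_left (by linarith) hq.le

/-- The hypothesis is the logarithm of the conclusion. It says that `exp(μ' S_n)` grows at least as
fast as `γ_n^q` decays. -/
theorem exp_mul_rpow_le_succ {q μ' : ℝ} {n : ℕ} (hn : 0 < γ n) (hn1 : 0 < γ (n + 1))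
    (h : q * Real.log (γ n / γ (n + 1)) ≤ μ' * γ (n + 1)) :
    Real.exp (μ' * stepSum γ n) * γ n ^ q
      ≤ Real.exp (μ' * stepSum γ (n + 1)) * γ (n + 1) ^ q := by
  rw [Real.rpow_def_of_pos hn, Real.rpow_def_of_pos hn1, ← Real.exp_add, ← Real.exp_add,
    Real.exp_le_exp, stepSum_succ]
  rw [Real.log_div hn.ne' hn1.ne'] at h
  linarith

/-- A Riemann sum for the integral of `exp(ν s)`, taken at right endpoints; the factor `exp(ν B)`
pays for moving to the left endpoint, where `1 + t ≤ exp t` lets the sum telescope. -/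
theorem sum_exp_mul_le {ν B : ℝ} (hν : 0 < ν) (hγ : ∀ n : ℕ, 1 ≤ n → 0 < γ n)
    (hB : ∀ n, 1 ≤ n → γ n ≤ B) (n : ℕ) :
    ∑ k ∈ Finset.range n, Real.exp (ν * stepSum γ (k + 1)) * γ (k + 1)
      ≤ Real.exp (ν * B) / ν * Real.exp (ν * stepSum γ n) := by
  induction n with
  | zero =>
    rw [Finset.sum_range_zero]
    positivity
  | succ n ih =>
    rw [Finset.sum_range_succ]
    have h1 := hγ (n + 1) (by omega)
    have h2 := hB (n + 1) (by omega)
    set s := Real.exp (ν * stepSum γ n) with hs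
    have hs0 : 0 < s := Real.exp_pos _
    have h3 : Real.exp (ν * stepSum γ (n + 1)) = s * Real.exp (ν * γ (n + 1)) := by
      rw [stepSum_succ, hs, ← Real.exp_add]
      ring_nf
    have h4 := Real.add_one_le_exp (ν * γ (n + 1))
    have h5 : Real.exp (ν * γ (n + 1)) ≤ Real.exp (ν * B) := by gcongr
    rw [h3]
    have h6 : s * Real.exp (ν * γ (n + 1)) * γ (n + 1)
        ≤ Real.exp (ν * B) / ν * (s * (Real.exp (ν * γ (n + 1)) - 1)) := by
      calc s * Real.exp (ν * γ (n + 1)) * γ (n + 1)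
          ≤ s * Real.exp (ν * B) * γ (n + 1) := by gcongr
        _ = Real.exp (ν * B) / ν * (s * (ν * γ (n + 1))) := by field_simp
        _ ≤ _ := by gcongr; linarith
    linarith

/-- Exponential weights, for a linear drift. -/
theorem StepSizes.exists_exp_rateWeights (h : StepSizes γ α) (hα : 0 < α) {p q μ μ' : ℝ}
    (hp : 0 < p) (hpα : p ≤ α) (hαq : α ≤ q) (hμ' : 0 < μ') (hμ : μ' < μ)
    (hlog : ∀ᶠ n in atTop, q * Real.log (γ n / γ (n + 1)) ≤ μ' * γ (n + 1)) :
    ∃ (w e : ℕ → ℝ) (N : ℕ) (C : ℝ),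
      RateWeights γ α (fun x => μ * |x|) (fun n => γ n ^ p) w e N C ∧
        (p ≤ 1 / 2 → 1 / 2 ≤ q → NoiseWeights γ (fun n => γ n ^ p) w N C) := by
  obtain ⟨B, hB1, hB⟩ := h.exists_le hα
  obtain ⟨N₀, hN₀⟩ := eventually_atTop.1 hlog
  set N := max N₀ 1 with hN
  have hN1 : 1 ≤ N := le_max_right _ _
  -- One logarithmic condition, at exponent `q`, serves all smaller exponents: those needed below
  -- are `p`, `α` and `1/2`.
  have hlog' : ∀ q', 0 < q' → q' ≤ q → ∀ k n, N ≤ k → k ≤ n →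
      Real.exp (μ' * stepSum γ k) * γ k ^ q' ≤ Real.exp (μ' * stepSum γ n) * γ n ^ q' := by
    intro q' hq' hqq k n hk hkn
    induction n, hkn using Nat.le_induction with
    | base => exact le_rfl
    | succ n hn ih =>
      have h1 := h.1 n (by omega)
      have h2 := h.1 (n + 1) (by omega)
      refine ih.trans (exp_mul_rpow_le_succ h1 h2 ?_)
      rcases le_total 0 (Real.log (γ n / γ (n + 1))) with h3 | h3
      · exact (mul_le_mul_of_nonneg_right hqq h3).trans
          (hN₀ n ((le_max_left _ _).trans (hk.trans hn)))
      · exact (mul_nonpos_of_nonneg_of_nonpos hq'.le h3).trans (by positivity)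
  set c₁ := Real.exp (μ' * stepSum γ N) * γ N ^ p with hc₁
  have hγN := h.1 N hN1
  have hc₁0 : 0 < c₁ := mul_pos (Real.exp_pos _) (Real.rpow_pos_of_pos hγN _)
  -- The rate `μ` is split: `μ'` compensates the decay of the steps, and the surplus `ν` makes the
  -- weighted error sum comparable to its last term.
  set ν := μ - μ' with hν
  have hν0 : 0 < ν := sub_pos.2 hμ
  set c₂ := Real.exp (ν * B) / ν with hc₂
  have hc₂0 : 0 < c₂ := by positivity
  have hμ0 : 0 < μ := hμ'.trans hμ
  have hS : ∀ n, 0 ≤ stepSum γ n := fun n =>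
    Finset.sum_nonneg fun k hk => (h.1 k (Finset.mem_Icc.1 hk).1).le
  have hsplit : ∀ n, Real.exp (μ * stepSum γ n)
      = Real.exp (ν * stepSum γ n) * Real.exp (μ' * stepSum γ n) := fun n => by
    rw [← Real.exp_add, hν]
    ring_nf
  have hpow : ∀ s t : ℝ, s ≤ t → ∀ n, 1 ≤ n → γ n ^ t ≤ B ^ (t - s) * γ n ^ s := by
    intro s t hst n hn
    have h1 := h.1 n hn
    calc γ n ^ t = γ n ^ (t - s) * γ n ^ s := by rw [← Real.rpow_add h1]; ring_nf
      _ ≤ _ := by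
        have := hB n hn
        have := sub_nonneg.2 hst
        gcongr
  refine ⟨fun n => Real.exp (μ * stepSum γ n), fun _ => 0, N,
    1 / c₁ + c₂ * B ^ (α - p) + B ^ (1 - 2 * p), ?_, ?_⟩
  · have hBp : 0 < B ^ (α - p) := Real.rpow_pos_of_pos (by linarith) _
    have hBp' : 0 < B ^ (1 - 2 * p) := Real.rpow_pos_of_pos (by linarith) _
    refine ⟨hN1, by positivity, fun n hn => Real.rpow_pos_of_pos (h.1 n hn) _,
      fun n _ => Real.exp_pos _, fun n _ => le_rfl, fun n hn => ?_, fun n hn => ?_,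
      fun n hn x y hxy => ?_⟩
    · have h1 := hlog' p hp (hpα.trans hαq) N n le_rfl hn
      have h2 : Real.exp (μ' * stepSum γ n) ≤ Real.exp (μ * stepSum γ n) := by
        have := hS n
        gcongr
      have h3 : 0 < γ n ^ p := Real.rpow_pos_of_pos (h.1 n (hN1.trans hn)) _
      calc (1 : ℝ) = 1 / c₁ * c₁ := by field_simp
        _ ≤ 1 / c₁ * (Real.exp (μ * stepSum γ n) * γ n ^ p) := by
          gcongr
          exact h1.trans (by gcongr)
        _ ≤ _ := by
          gcongr
          linarith [mul_pos hc₂0 hBp]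
    · have h1 : ∀ k ∈ Finset.Ico N n,
          Real.exp (μ * stepSum γ (k + 1)) * (0 + γ (k + 1) ^ (1 + α))
            ≤ Real.exp (ν * stepSum γ (k + 1)) * γ (k + 1)
              * (Real.exp (μ' * stepSum γ n) * γ n ^ α) := by
        intro k hk
        rw [Finset.mem_Ico] at hk
        have h2 := h.1 (k + 1) (by omega)
        rw [hsplit, zero_add, Real.rpow_add h2, Real.rpow_one]
        calc _ = Real.exp (ν * stepSum γ (k + 1)) * γ (k + 1)
              * (Real.exp (μ' * stepSum γ (k + 1)) * γ (k + 1) ^ α) := by ring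
          _ ≤ _ := by
            have := hlog' α hα hαq (k + 1) n (by omega) (by omega)
            gcongr
      have hγn := h.1 n (hN1.trans hn)
      have h3 : 0 < γ n ^ α := Real.rpow_pos_of_pos hγn _
      have h3' : 0 < γ n ^ p := Real.rpow_pos_of_pos hγn _
      calc _ ≤ ∑ k ∈ Finset.Ico N n, Real.exp (ν * stepSum γ (k + 1)) * γ (k + 1)
              * (Real.exp (μ' * stepSum γ n) * γ n ^ α) := Finset.sum_le_sum h1
        _ = (∑ k ∈ Finset.Ico N n, Real.exp (ν * stepSum γ (k + 1)) * γ (k + 1))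
              * (Real.exp (μ' * stepSum γ n) * γ n ^ α) := by rw [Finset.sum_mul]
        _ ≤ (c₂ * Real.exp (ν * stepSum γ n)) * (Real.exp (μ' * stepSum γ n) * γ n ^ α) := by
          refine mul_le_mul_of_nonneg_right ?_ (by positivity)
          refine le_trans ?_ (sum_exp_mul_le hν0 h.1 hB n)
          refine Finset.sum_le_sum_of_subset_of_nonneg (fun k hk => ?_) fun k _ _ => ?_
          · exact Finset.mem_range.2 (Finset.mem_Ico.1 hk).2
          · exact mul_nonneg (Real.exp_pos _).le (h.1 _ (by omega)).le
        _ = c₂ * (Real.exp (μ * stepSum γ n) * γ n ^ α) := by rw [hsplit]; ring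
        _ ≤ c₂ * (Real.exp (μ * stepSum γ n) * (B ^ (α - p) * γ n ^ p)) := by
          have := hpow p α hpα n (hN1.trans hn)
          gcongr
        _ = c₂ * B ^ (α - p) * (Real.exp (μ * stepSum γ n) * γ n ^ p) := by ring
        _ ≤ _ := by
          gcongr
          linarith [one_div_pos.2 hc₁0]
    · have h1 := h.1 (n + 1) (by omega)
      have h2 : Real.exp (μ * stepSum γ n)
          = Real.exp (μ * stepSum γ (n + 1)) * Real.exp (-(μ * γ (n + 1))) := by
        rw [← Real.exp_add, stepSum_succ]
        ring_nf
      -- In the local setting `x` may be negative, as the values can lie below their limit. Then the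
      -- drift only helps, and `x ≤ exp(-μ γ) x`.
      have h3 : x - γ (n + 1) * y ≤ Real.exp (-(μ * γ (n + 1))) * x := by
        have h4 : γ (n + 1) * (μ * |x|) ≤ γ (n + 1) * y := by gcongr
        have h5 := Real.add_one_le_exp (-(μ * γ (n + 1)))
        have h6 : Real.exp (-(μ * γ (n + 1))) ≤ 1 :=
          Real.exp_le_one_iff.2 (neg_nonpos.2 (by positivity))
        rcases le_total 0 x with hx | hx
        · rw [abs_of_nonneg hx] at h4
          nlinarith
        · rw [abs_of_nonpos hx] at h4
          have : 0 ≤ γ (n + 1) * (μ * -x) :=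
            mul_nonneg h1.le (mul_nonneg hμ0.le (neg_nonneg.2 hx))
          nlinarith
      simp only [mul_zero, add_zero]
      rw [h2, mul_assoc]
      exact mul_le_mul_of_nonneg_left h3 (Real.exp_pos _).le
  · intro hp2 hq2 k n hk hkn
    have h1 := hlog' (1 / 2) (by norm_num) hq2 (k + 1) n (by omega) (by omega)
    have hγk := h.1 (k + 1) (by omega)
    have hγn := h.1 n (by omega)
    have hsq : ∀ t : ℝ, 0 < t → (t ^ (1 / 2 : ℝ)) ^ 2 = t := fun t ht => by
      rw [← Real.rpow_natCast, ← Real.rpow_mul ht.le]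
      norm_num
    have h2 : Real.exp (ν * stepSum γ (k + 1)) ≤ Real.exp (ν * stepSum γ n) := by
      have := h.monotone_stepSum (show k + 1 ≤ n by omega)
      gcongr
    have h3 : Real.exp (μ * stepSum γ (k + 1)) ^ 2 * γ (k + 1)
        ≤ Real.exp (μ * stepSum γ n) ^ 2 * γ n := by
      rw [hsplit, hsplit]
      calc _ = (Real.exp (ν * stepSum γ (k + 1)) * (Real.exp (μ' * stepSum γ (k + 1))
              * γ (k + 1) ^ (1 / 2 : ℝ))) ^ 2 := by
            rw [mul_pow, mul_pow, mul_pow, hsq _ hγk]; ring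
        _ ≤ (Real.exp (ν * stepSum γ n) * (Real.exp (μ' * stepSum γ n)
              * γ n ^ (1 / 2 : ℝ))) ^ 2 := by
            have : 0 < γ (k + 1) ^ (1 / 2 : ℝ) := Real.rpow_pos_of_pos hγk _
            gcongr
        _ = _ := by
            rw [mul_pow, mul_pow, mul_pow, hsq _ hγn]; ring
    have h4 := hpow (2 * p) 1 (by linarith) n (by omega)
    rw [Real.rpow_one] at h4
    have h5 : γ n ^ (2 * p) = (γ n ^ p) ^ 2 := by
      rw [← Real.rpow_natCast, ← Real.rpow_mul hγn.le, mul_comm]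
      norm_num
    rw [h5] at h4
    have h6 : 0 ≤ 1 / c₁ + c₂ * B ^ (α - p) := by
      have : 0 < B ^ (α - p) := Real.rpow_pos_of_pos (by linarith) _
      positivity
    calc _ ≤ _ := h3
      _ ≤ Real.exp (μ * stepSum γ n) ^ 2 * (B ^ (1 - 2 * p) * (γ n ^ p) ^ 2) := by gcongr
      _ = B ^ (1 - 2 * p) * (Real.exp (μ * stepSum γ n) * γ n ^ p) ^ 2 := by ring
      _ ≤ _ := by
        gcongr
        linarith

end Steps

/-! ### Polynomial weights for a superlinear drift. -/

/-- A power lies above its tangents. -/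
theorem tangent_le_rpow {b s t : ℝ} (hb : 1 ≤ b) (hs : 0 < s) (ht : 0 ≤ t) :
    b * s ^ (b - 1) * t - (b - 1) * s ^ b ≤ t ^ b := by
  have h1 := one_add_mul_self_le_rpow_one_add (s := t / s - 1)
    (by have := div_nonneg ht hs.le; linarith) hb
  rw [add_sub_cancel, Real.div_rpow ht hs.le, le_div_iff₀ (Real.rpow_pos_of_pos hs b)] at h1
  refine le_trans (le_of_eq ?_) h1
  rw [Real.rpow_sub_one hs.ne']
  field_simp
  ring

/-- For `x ≥ 0`, multiply `(1 + u)^K ≤ exp(K u)` by `1 - K u ≤ exp(-K u)`; for `x ≤ 0` both effects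
have the right sign. With `u = γ_{n+1} / S_n`, the factor `(1 + u)^K` is the growth of the weight
`S_n^K`. -/
theorem one_add_rpow_mul_sub_le {u K x : ℝ} (hu : 0 ≤ u) (hK : 0 ≤ K) :
    (1 + u) ^ K * (x - K * u * |x|) ≤ x := by
  have h1 : 1 ≤ (1 + u) ^ K := Real.one_le_rpow (by linarith) hK
  have hKu : 0 ≤ K * u := mul_nonneg hK hu
  rcases le_total 0 x with hx | hx
  · rw [abs_of_nonneg hx]
    have h2 : (1 + u) ^ K ≤ Real.exp (K * u) := by
      rw [mul_comm, Real.exp_mul]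
      have := Real.add_one_le_exp u
      exact Real.rpow_le_rpow (by linarith) (by linarith) hK
    have h3 : (1 + u) ^ K * (1 - K * u) ≤ 1 := by
      rcases le_total (1 - K * u) 0 with h | h
      · nlinarith
      · have h4 : 1 - K * u ≤ Real.exp (-(K * u)) := by
          linarith [Real.add_one_le_exp (-(K * u))]
        calc (1 + u) ^ K * (1 - K * u) ≤ Real.exp (K * u) * Real.exp (-(K * u)) := by gcongr
          _ = 1 := by rw [← Real.exp_add]; simp
    nlinarith
  · rw [abs_of_nonpos hx]
    nlinarith [mul_nonneg hKu (neg_nonneg.2 hx), mul_nonneg (sub_nonneg.2 h1) (neg_nonneg.2 hx),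
      mul_nonneg (sub_nonneg.2 h1) (mul_nonneg hKu (neg_nonneg.2 hx))]

/-- Polynomial weights in the partial sums of the steps, for a superlinear drift. -/
theorem StepSizes.exists_rpow_rateWeights {γ : ℕ → ℝ} {α ρ r β μ : ℝ} (h : StepSizes γ α)
    (hα : 0 < α) (hγO : γ =O[atTop] fun n : ℕ => stepSum γ n ^ (-ρ)) (hρ : 0 < ρ)
    (hβ : 1 / 2 < β) (hμ : 0 < μ) (hr : 0 < r) (hr₁ : r ≤ 1 / (2 * β - 1)) (hr₂ : r ≤ α * ρ - 1) :
    ∃ (w e : ℕ → ℝ) (N : ℕ) (C : ℝ),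
      RateWeights γ α (fun x => μ * |x| ^ (2 * β)) (fun n => stepSum γ n ^ (-r)) w e N C ∧
        (2 * r ≤ ρ → NoiseWeights γ (fun n => stepSum γ n ^ (-r)) w N C) := by
  obtain ⟨B, hB1, hB⟩ := h.exists_le hα
  obtain ⟨D, hD0, hD⟩ := hγO.exists_pos
  obtain ⟨N₁, hN₁⟩ := eventually_atTop.1 hD.bound
  obtain ⟨N₂, hN₂⟩ := eventually_atTop.1 (h.2.1.eventually_ge_atTop B)
  set N := max (max N₁ N₂) 1 with hN
  have hN1 : 1 ≤ N := le_max_right _ _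
  have hSB : ∀ n, N ≤ n → B ≤ stepSum γ n := fun n hn => hN₂ n (by omega)
  have hS1 : ∀ n, N ≤ n → 1 ≤ stepSum γ n := fun n hn => hB1.trans (hSB n hn)
  have hS0 : ∀ n, N ≤ n → 0 < stepSum γ n := fun n hn => zero_lt_one.trans_le (hS1 n hn)
  have hγD : ∀ n, N ≤ n → γ n ≤ D * stepSum γ n ^ (-ρ) := by
    intro n hn
    have h1 := hN₁ n (by omega)
    rwa [Real.norm_of_nonneg (h.1 n (by omega)).le,
      Real.norm_of_nonneg (Real.rpow_nonneg (hS0 n hn).le _)] at h1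
  set a := 1 / (2 * β - 1) with ha
  have hb : 0 < 2 * β - 1 := by linarith
  have hab : a * (2 * β - 1) = 1 := by rw [ha]; field_simp
  have ha0 : 0 < a := by positivity
  -- The precise value of `K` is immaterial: it is large enough that every exponent of `S_n` to be
  -- compared by monotonicity is nonnegative.
  set K := a + 1 + α * ρ + ρ + r with hK
  have hαρ : 0 < α * ρ := mul_pos hα hρ
  have hK0 : 0 < K := by positivity
  set A := μ * (2 * β - 1) * (K / (μ * (2 * β))) ^ (1 + a) with hA
  have hq0 : 0 < K / (μ * (2 * β)) := by positivity
  have hA0 : 0 < A := by positivity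
  set c := A * 2 ^ (1 + a) + D ^ α with hc
  have hc0 : 0 < c := by positivity
  refine ⟨fun n => stepSum γ n ^ K, fun n => γ (n + 1) * (A * stepSum γ n ^ (-(1 + a))), N,
    1 + c + D, ?_, ?_⟩
  · refine ⟨hN1, by positivity, fun n hn => Real.rpow_pos_of_pos (h.stepSum_pos hn) _,
      fun n hn => Real.rpow_pos_of_pos (hS0 n hn) _, fun n hn => ?_, fun n hn => ?_, fun n hn => ?_,
      fun n hn x y hxy => ?_⟩
    · exact mul_nonneg (h.1 _ (by omega)).le
        (mul_nonneg hA0.le (Real.rpow_nonneg (hS0 n hn).le _))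
    · rw [← Real.rpow_add (hS0 n hn)]
      have h1 : 1 ≤ stepSum γ n ^ (K + -r) := Real.one_le_rpow (hS1 n hn) (by rw [hK]; linarith)
      nlinarith
    · have h1 : ∀ k ∈ Finset.Ico N n, stepSum γ (k + 1) ^ K
          * (γ (k + 1) * (A * stepSum γ k ^ (-(1 + a))) + γ (k + 1) ^ (1 + α))
            ≤ γ (k + 1) * (c * stepSum γ n ^ (K - 1 - r)) := by
        intro k hk
        rw [Finset.mem_Ico] at hk
        have hg := h.1 (k + 1) (by omega)
        have hs := hS0 (k + 1) (by omega)
        have hs1 := hS1 (k + 1) (by omega)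
        have hs' := hS0 k hk.1
        have h2 : stepSum γ k ^ (-(1 + a)) ≤ 2 ^ (1 + a) * stepSum γ (k + 1) ^ (-(1 + a)) := by
          -- Beyond `N` the sum exceeds the bound `B` on the steps, so one more step at most doubles
          -- it.
          have h3 : stepSum γ (k + 1) / 2 ≤ stepSum γ k := by
            rw [stepSum_succ]
            linarith [hSB k hk.1, hB (k + 1) (by omega)]
          calc stepSum γ k ^ (-(1 + a)) ≤ (stepSum γ (k + 1) / 2) ^ (-(1 + a)) :=
                Real.rpow_le_rpow_of_nonpos (by positivity) h3 (by linarith)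
            _ = _ := by
                rw [Real.div_rpow hs.le zero_le_two, Real.rpow_neg zero_le_two (1 + a)]
                field_simp
        have h4 : γ (k + 1) ^ (1 + α) ≤ γ (k + 1) * (D ^ α * stepSum γ (k + 1) ^ (-(α * ρ))) := by
          rw [Real.rpow_add hg, Real.rpow_one]
          gcongr
          calc γ (k + 1) ^ α ≤ (D * stepSum γ (k + 1) ^ (-ρ)) ^ α := by
                have := hγD (k + 1) (by omega)
                gcongr
            _ = _ := by
                rw [Real.mul_rpow hD0.le (Real.rpow_nonneg hs.le _), ← Real.rpow_mul hs.le]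
                ring_nf
        -- The two upper bounds on `r` enter here: `r ≤ a` for the error of linearizing the drift,
        -- `r ≤ α ρ - 1` for the second-order error.
        have h5 : stepSum γ (k + 1) ^ (-(1 + a)) ≤ stepSum γ (k + 1) ^ (-(1 + r)) :=
          Real.rpow_le_rpow_of_exponent_le hs1 (by linarith)
        have h6 : stepSum γ (k + 1) ^ (-(α * ρ)) ≤ stepSum γ (k + 1) ^ (-(1 + r)) :=
          Real.rpow_le_rpow_of_exponent_le hs1 (by linarith)
        calc _ ≤ stepSum γ (k + 1) ^ K
              * (γ (k + 1) * (A * (2 ^ (1 + a) * stepSum γ (k + 1) ^ (-(1 + r))))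
                + γ (k + 1) * (D ^ α * stepSum γ (k + 1) ^ (-(1 + r)))) := by
              gcongr
              · exact h2.trans (by gcongr)
              · exact h4.trans (by gcongr)
          _ = γ (k + 1) * (c * (stepSum γ (k + 1) ^ K * stepSum γ (k + 1) ^ (-(1 + r)))) := by
              rw [hc]; ring
          _ = γ (k + 1) * (c * stepSum γ (k + 1) ^ (K - 1 - r)) := by
              rw [← Real.rpow_add hs]; ring_nf
          _ ≤ _ := by
              have h7 := h.monotone_stepSum (show k + 1 ≤ n by omega)
              have h8 : 0 ≤ K - 1 - r := by rw [hK]; linarith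
              gcongr
      have hSn := hS0 n hn
      calc _ ≤ ∑ k ∈ Finset.Ico N n, γ (k + 1) * (c * stepSum γ n ^ (K - 1 - r)) :=
            Finset.sum_le_sum h1
        _ = (∑ k ∈ Finset.Ico N n, γ (k + 1)) * (c * stepSum γ n ^ (K - 1 - r)) := by
            rw [Finset.sum_mul]
        _ ≤ stepSum γ n * (c * stepSum γ n ^ (K - 1 - r)) := by
            gcongr
            rw [stepSum_eq_sum_range]
            exact Finset.sum_le_sum_of_subset_of_nonneg
              (fun k hk => Finset.mem_range.2 (Finset.mem_Ico.1 hk).2)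
              fun k _ _ => (h.1 _ (by omega)).le
        _ = c * (stepSum γ n ^ K * stepSum γ n ^ (-r)) := by
            rw [← Real.rpow_add hSn, show K + -r = 1 + (K - 1 - r) by ring, Real.rpow_add hSn 1,
              Real.rpow_one]
            ring
        _ ≤ _ := by
            gcongr
            linarith
    · have hs := hS0 n hn
      have hg := h.1 (n + 1) (by omega)
      -- The tangent point at which `μ t^(2β)` has slope `K / S_n`, exactly the linear drift that
      -- the growth of `S_n^K` consumes. The intercept of the tangent is the source of `e`.
      set t := (K / (μ * (2 * β)) / stepSum γ n) ^ a with ht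
      have ht0 : 0 < t := Real.rpow_pos_of_pos (by positivity) _
      have h1 := tangent_le_rpow (b := 2 * β) (by linarith) ht0 (abs_nonneg x)
      have h2 : t ^ (2 * β - 1) = K / (μ * (2 * β)) / stepSum γ n := by
        rw [ht, ← Real.rpow_mul (by positivity), hab, Real.rpow_one]
      have h3 : t ^ (2 * β) = (K / (μ * (2 * β))) ^ (1 + a) * stepSum γ n ^ (-(1 + a)) := by
        rw [ht, ← Real.rpow_mul (by positivity), show a * (2 * β) = 1 + a by linarith,
          Real.div_rpow (by positivity) hs.le, Real.rpow_neg hs.le]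
        field_simp
      have h4 : K / stepSum γ n * |x| - A * stepSum γ n ^ (-(1 + a)) ≤ y := by
        refine le_trans ?_ hxy
        refine le_trans (le_of_eq ?_) (mul_le_mul_of_nonneg_left h1 hμ.le)
        rw [h2, h3, hA]
        field_simp
      have h5 : stepSum γ (n + 1) = stepSum γ n * (1 + γ (n + 1) / stepSum γ n) := by
        rw [stepSum_succ]
        field_simp
      have h6 := one_add_rpow_mul_sub_le (u := γ (n + 1) / stepSum γ n) (x := x) (by positivity)
        hK0.le
      have h7 : stepSum γ (n + 1) ^ K * (x - K * (γ (n + 1) / stepSum γ n) * |x|)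
          ≤ stepSum γ n ^ K * x := by
        rw [h5, Real.mul_rpow hs.le (by positivity), mul_assoc]
        exact mul_le_mul_of_nonneg_left h6 (Real.rpow_nonneg hs.le _)
      have h8 : x - γ (n + 1) * y ≤ (x - K * (γ (n + 1) / stepSum γ n) * |x|)
          + γ (n + 1) * (A * stepSum γ n ^ (-(1 + a))) := by
        have h9 := mul_le_mul_of_nonneg_left h4 hg.le
        have h10 : γ (n + 1) * (K / stepSum γ n * |x| - A * stepSum γ n ^ (-(1 + a)))
            = K * (γ (n + 1) / stepSum γ n) * |x| - γ (n + 1) * (A * stepSum γ n ^ (-(1 + a))) := by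
          ring
        linarith
      have h11 : 0 ≤ stepSum γ (n + 1) ^ K :=
        Real.rpow_nonneg (hS0 (n + 1) (by omega)).le _
      calc _ ≤ stepSum γ (n + 1) ^ K * ((x - K * (γ (n + 1) / stepSum γ n) * |x|)
              + γ (n + 1) * (A * stepSum γ n ^ (-(1 + a)))) := by gcongr
        _ ≤ _ := by
            rw [mul_add]
            gcongr
  · intro hr3 k n hk hkn
    have hs := hS0 (k + 1) (by omega)
    have hSn := hS0 n (by omega)
    have hg := h.1 (k + 1) (by omega)
    have hsq : ∀ t : ℝ, 0 < t → ∀ q : ℝ, (t ^ q) ^ 2 = t ^ (2 * q) := fun t ht q => by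
      rw [← Real.rpow_natCast, ← Real.rpow_mul ht.le, mul_comm]
      norm_num
    rw [mul_pow, hsq _ hs, hsq _ hSn, hsq _ hSn, ← Real.rpow_add hSn]
    calc stepSum γ (k + 1) ^ (2 * K) * γ (k + 1)
        ≤ stepSum γ (k + 1) ^ (2 * K) * (D * stepSum γ (k + 1) ^ (-ρ)) := by
          have := hγD (k + 1) (by omega)
          gcongr
      _ = D * stepSum γ (k + 1) ^ (2 * K - ρ) := by
          rw [sub_eq_add_neg, Real.rpow_add hs]; ring
      _ ≤ D * stepSum γ n ^ (2 * K - ρ) := by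
          have h7 := h.monotone_stepSum (show k + 1 ≤ n by omega)
          have h8 : 0 ≤ 2 * K - ρ := by rw [hK]; linarith
          gcongr
      _ ≤ D * stepSum γ n ^ (2 * K + 2 * -r) := by
          have := hS1 n (by omega)
          gcongr
          · linarith
      _ ≤ _ := by
          have : 0 ≤ stepSum γ n ^ (2 * K + 2 * -r) := Real.rpow_nonneg hSn.le _
          gcongr
          linarith

/-! ### From weights to rates. -/

namespace SGDModel

variable {Ω : Type*} [mΩ : MeasurableSpace Ω] {P : Measure Ω} [IsProbabilityMeasure P] {d m : ℕ}
  {X : Ω → Vec d} {F : Vec m → ℝ} {g : Vec d → Vec m → Vec m} {Xs : ℕ → Ω → Vec d}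
  {θ₀ : Ω → Vec m} {L α κ : ℝ} {γ : ℕ → ℝ}

local notation "θ" => sgd g γ Xs θ₀
local notation "𝐠" => direction g γ Xs θ₀
local notation "𝐛" => meanOracle P X g
local notation "∇F" => gradient F

section

variable (M : SGDModel P X F g Xs θ₀ L α κ γ)
include M

theorem ae_tendsto_gradient_zero :
    ∀ᵐ ω ∂P, Tendsto (fun n => ‖∇F (θ n ω)‖) atTop (𝓝 0) := by
  obtain ⟨hκ, -, -, c, hκc, hc⟩ := M.oracle
  filter_upwards [M.ae_summable_gradient_sq, M.ae_exists_tendsto_noise] with ω h1 ⟨v, hv⟩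
  refine tendsto_norm_zero_of_recursion (x := fun n => θ n ω) (b := fun n => 𝐛 (θ n ω))
    (e := fun n => 𝐠 n ω - 𝐛 (θ n ω)) (a := fun n => γ (n + 1)) M.L_pos M.α_pos
    (hκ.trans_le hκc) M.smooth.2.2 (fun n => (M.step_pos n).le) (fun n => ?_) (fun n => hc _) h1
    M.steps.not_summable (M.steps.tendsto_zero M.α_pos) hv
  rw [← smul_add, add_sub_cancel]
  rfl

theorem exists_integral_direction_sq_le : ∃ C : ℝ, 0 < C ∧ ∀ n : ℕ,
    ∫ ω, ‖𝐠 n ω‖ ^ 2 ∂P ≤ C := by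
  obtain ⟨C, hC, h⟩ := M.condExp_direction_sq_le
  obtain ⟨B, hB0, hB⟩ := M.exists_integral_gap_le
  refine ⟨C * (B + 1), by positivity, fun n => ?_⟩
  have hV := M.integrable_gap n
  have h1 : Integrable (fun ω => gap F (θ n ω) + 1) P := hV.add (integrable_const 1)
  have h2 := integral_mono_ae integrable_condExp (h1.const_mul C) (h n hV)
  rw [integral_condExp (M.filtration.le n), integral_const_mul,
    integral_add hV (integrable_const 1)] at h2
  refine h2.trans (mul_le_mul_of_nonneg_left ?_ hC.le)
  simpa using hB n

/-- A global drift gives a rate in expectation, hence a rate at every confidence level. -/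
theorem exists_global_rate {φ : ℝ → ℝ} {R w e : ℕ → ℝ} {N : ℕ} {C : ℝ}
    (hW : RateWeights γ α φ R w e N C)
    (hφ : ∀ x : Vec m, φ (gap F x) ≤ κ * ‖∇F x‖ ^ 2) :
    ∃ C' : ℝ, 0 < C' ∧ ∀ δ : ℝ, 0 < δ → δ < 1 → ∀ n : ℕ, 1 ≤ n →
      1 - δ ≤ P.real {ω | gap F (θ n ω) ≤ C' / δ * R n} := by
  obtain ⟨C₁, hC₁, h₁⟩ := M.exists_integral_gap_succ_le
  obtain ⟨B, hB0, hB⟩ := M.exists_integral_gap_le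
  set v : ℕ → ℝ := fun n => ∫ ω, gap F (θ n ω) ∂P with hv
  have hv0 : ∀ n, 0 ≤ v n := M.integral_gap_nonneg
  set D := 1 + C₁ * (B + 1) with hD
  have hD1 : 1 ≤ D := by rw [hD]; nlinarith
  have hstep : ∀ n, N ≤ n →
      w (n + 1) * v (n + 1) ≤ w n * v n + D * (w (n + 1) * (e n + γ (n + 1) ^ (1 + α))) := by
    intro n hn
    have hV := M.integrable_gap n
    have hG := M.integrable_gradient_sq n
    have hw := hW.w_pos (n + 1) (by omega)
    have hp : 0 ≤ γ (n + 1) ^ (1 + α) := Real.rpow_nonneg (M.step_pos n).le _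
    -- The drift bound is applied pointwise and then integrated. Being affine in `(x, y)` for `x ≥
    -- 0`-valued gaps, it needs no convexity of `φ`.
    have h2 : w (n + 1) * (v n - γ (n + 1) * (κ * ∫ ω, ‖∇F (θ n ω)‖ ^ 2 ∂P))
        ≤ w n * v n + w (n + 1) * e n := by
      have i1 : Integrable (fun ω => γ (n + 1) * (κ * ‖∇F (θ n ω)‖ ^ 2)) P :=
        (hG.const_mul κ).const_mul _
      have h3 := integral_mono ((hV.sub i1).const_mul (w (n + 1)))
        ((hV.const_mul (w n)).add (integrable_const (w (n + 1) * e n)))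
        fun ω => hW.drift n hn _ _ (hφ (θ n ω))
      simp only [Pi.sub_apply, Pi.add_apply] at h3
      rw [integral_const_mul, integral_sub hV i1, integral_const_mul, integral_const_mul,
        integral_add (hV.const_mul _) (integrable_const _), integral_const_mul] at h3
      simpa using h3
    have h4 := h₁ n
    have h5 : C₁ * γ (n + 1) ^ (1 + α) * (v n + 1) ≤ C₁ * γ (n + 1) ^ (1 + α) * (B + 1) := by
      have := hB n
      gcongr
    have h6 : v (n + 1) ≤ v n - γ (n + 1) * (κ * ∫ ω, ‖∇F (θ n ω)‖ ^ 2 ∂P)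
        + C₁ * (B + 1) * γ (n + 1) ^ (1 + α) := by
      simp only [hv] at h5 ⊢
      linarith
    have he := hW.e_nonneg n hn
    have h7 : w (n + 1) * e n + w (n + 1) * (C₁ * (B + 1) * γ (n + 1) ^ (1 + α))
        ≤ D * (w (n + 1) * (e n + γ (n + 1) ^ (1 + α))) := by
      have h8 : e n + C₁ * (B + 1) * γ (n + 1) ^ (1 + α) ≤ D * (e n + γ (n + 1) ^ (1 + α)) := by
        rw [hD]
        have : 0 ≤ C₁ * (B + 1) := by positivity
        nlinarith [mul_nonneg this he]
      nlinarith [mul_le_mul_of_nonneg_left h8 hw.le]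
    have := mul_le_mul_of_nonneg_left h6 hw.le
    linarith
  have hsum : ∀ n, N ≤ n → w n * v n ≤ w N * v N
      + D * ∑ k ∈ Finset.Ico N n, w (k + 1) * (e k + γ (k + 1) ^ (1 + α)) := by
    intro n hn
    induction n, hn using Nat.le_induction with
    | base => simp
    | succ n hn ih =>
      rw [Finset.sum_Ico_succ_top hn, mul_add]
      linarith [hstep n hn]
  set C₂ := w N * v N * C + D * C with hC₂
  have hwN := hW.w_pos N le_rfl
  have hC := hW.C_pos
  have hC₂0 : 0 < C₂ := by
    have := hv0 N
    positivity
  have hR : ∀ n, N ≤ n → v n ≤ C₂ * R n := by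
    intro n hn
    have hw := hW.w_pos n hn
    have h1 := hsum n hn
    have h2 := hW.sum_le n hn
    have h3 := mul_le_mul_of_nonneg_left (hW.one_le_mul n hn) (mul_nonneg hwN.le (hv0 N))
    have h4 := mul_le_mul_of_nonneg_left h2 (zero_le_one.trans hD1)
    refine le_of_mul_le_mul_left (a := w n) ?_ hw
    calc w n * v n ≤ w N * v N * (C * (w n * R n)) + D * (C * (w n * R n)) := by linarith
      _ = _ := by rw [hC₂]; ring
  -- The extra sum covers the finitely many indices before the weights become effective.
  set C₃ := C₂ + ∑ k ∈ Finset.Icc 1 N, v k / R k with hC₃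
  have hterm : ∀ k ∈ Finset.Icc 1 N, 0 ≤ v k / R k := fun k hk =>
    div_nonneg (hv0 k) (hW.R_pos k (Finset.mem_Icc.1 hk).1).le
  have hC₃0 : 0 < C₃ := add_pos_of_pos_of_nonneg hC₂0 (Finset.sum_nonneg hterm)
  have hR' : ∀ n, 1 ≤ n → v n ≤ C₃ * R n := by
    intro n hn
    have hRn := hW.R_pos n hn
    rcases le_total N n with h | h
    · refine (hR n h).trans (mul_le_mul_of_nonneg_right ?_ hRn.le)
      exact le_add_of_nonneg_right (Finset.sum_nonneg hterm)
    · have h1 := Finset.single_le_sum hterm (Finset.mem_Icc.2 ⟨hn, h⟩)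
      calc v n = v n / R n * R n := by field_simp
        _ ≤ _ := by
          refine mul_le_mul_of_nonneg_right ?_ hRn.le
          linarith
  refine ⟨C₃, hC₃0, fun δ hδ _ n hn => ?_⟩
  have hRn := hW.R_pos n hn
  have hε : 0 < C₃ / δ * R n := by positivity
  have h1 := mul_meas_ge_le_integral_of_nonneg (μ := P)
    (Eventually.of_forall fun ω => M.gap_nonneg (θ n ω)) (M.integrable_gap n) (C₃ / δ * R n)
  have h2 : P.real {ω | C₃ / δ * R n ≤ gap F (θ n ω)} ≤ δ := by
    refine le_of_mul_le_mul_left (a := C₃ / δ * R n) ?_ hε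
    refine h1.trans ((hR' n hn).trans (le_of_eq ?_))
    field_simp
  have h3 : (1 : ℝ) ≤ P.real {ω | gap F (θ n ω) ≤ C₃ / δ * R n}
      + P.real {ω | C₃ / δ * R n ≤ gap F (θ n ω)} := by
    refine le_trans ?_ (measureReal_union_le _ _)
    rw [show {ω | gap F (θ n ω) ≤ C₃ / δ * R n} ∪ {ω | C₃ / δ * R n ≤ gap F (θ n ω)} = Set.univ
      from Set.eq_univ_of_forall fun ω => le_total (gap F (θ n ω)) (C₃ / δ * R n)]
    simp
  linarith

end

section

variable (M : SGDModel P X F g Xs θ₀ L α κ γ)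
include M

omit [IsProbabilityMeasure P] in
/-- The pathwise consequence of a drift along a trajectory. -/
theorem weighted_gap_le {φ : ℝ → ℝ} {R w e : ℕ → ℝ} {N : ℕ} {C : ℝ}
    (hW : RateWeights γ α φ R w e N C) {l : ℝ} {J : ℕ} (hJ : N ≤ J) {u : Vec m → Vec m} {ω : Ω}
    (hu : ∀ n, u (θ n ω) = ∇F (θ n ω))
    (hφ : ∀ n, J ≤ n → φ (F (θ n ω) - l) ≤ κ * ‖∇F (θ n ω)‖ ^ 2) {n : ℕ} (hn : J ≤ n) :
    w n * (F (θ n ω) - l) ≤ w J * (F (θ J ω) - l) + ∑ k ∈ Finset.Ico J n, w (k + 1) * e k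
      + ∑ k ∈ Finset.Ico J n, w (k + 1) * γ (k + 1) ^ (1 + α) * (L * (1 + ‖𝐠 k ω‖ ^ 2))
      - noiseSum P X g γ Xs θ₀ u (fun k => if J ≤ k then w (k + 1) * γ (k + 1) else 0) n ω := by
  induction n, hn using Nat.le_induction with
  | base =>
    -- The coefficients before `J` are zero, so the noise from time `J` on is an ordinary `noiseSum`
    -- started at time `0`.
    have : noiseSum P X g γ Xs θ₀ u
        (fun k => if J ≤ k then w (k + 1) * γ (k + 1) else 0) J ω = 0 := by
      refine Finset.sum_eq_zero fun k hk => ?_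
      have hkJ : ¬J ≤ k := not_le.2 (Finset.mem_range.1 hk)
      simp only [if_neg hkJ, zero_mul]
    simp [this]
  | succ n hn ih =>
    have h1 := M.gap_succ_le n ω
    have h2 := hW.drift n (hJ.trans hn) _ _ (hφ n hn)
    have hw := hW.w_pos (n + 1) (by omega)
    have h3 : noise P X g γ Xs θ₀ u n ω = noise P X g γ Xs θ₀ ∇F n ω := by
      simp only [noise, hu]
    have h4 : noiseSum P X g γ Xs θ₀ u
        (fun k => if J ≤ k then w (k + 1) * γ (k + 1) else 0) (n + 1) ω
        = noiseSum P X g γ Xs θ₀ u (fun k => if J ≤ k then w (k + 1) * γ (k + 1) else 0) n ω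
          + w (n + 1) * γ (n + 1) * noise P X g γ Xs θ₀ ∇F n ω := by
      unfold noiseSum
      rw [Finset.sum_range_succ, h3]
      simp only [if_pos hn]
    rw [h4, Finset.sum_Ico_succ_top hn, Finset.sum_Ico_succ_top hn]
    simp only [gap] at h1
    have h5 : F (θ (n + 1) ω) - l ≤ (F (θ n ω) - l - γ (n + 1) * (κ * ‖∇F (θ n ω)‖ ^ 2))
        - γ (n + 1) * noise P X g γ Xs θ₀ ∇F n ω
        + L * γ (n + 1) ^ (1 + α) * (1 + ‖𝐠 n ω‖ ^ 2) := by linarith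
    have h6 := mul_le_mul_of_nonneg_left h5 hw.le
    linarith

/-- A drift that eventually holds along the trajectory, with large probability, gives a rate. -/
theorem exists_local_rate {φ : ℝ → ℝ} {R w e : ℕ → ℝ} {N : ℕ} {C : ℝ}
    (hW : RateWeights γ α φ R w e N C) (hNW : NoiseWeights γ R w N C) {δ : ℝ} (hδ : 0 < δ)
    {E : Set Ω} (hE : 1 - δ / 2 ≤ P.real E) {Fs : Ω → ℝ}
    (hFs : ∀ᵐ ω ∂P, Tendsto (fun n => F (θ n ω)) atTop (𝓝 (Fs ω)))
    (hφ : ∀ᵐ ω ∂P, ω ∈ E → ∀ᶠ n in atTop, φ (F (θ n ω) - Fs ω) ≤ κ * ‖∇F (θ n ω)‖ ^ 2) :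
    ∃ C' : ℝ, 0 < C' ∧ ∀ n : ℕ, 1 ≤ n →
      1 - δ ≤ P.real {ω | F (θ n ω) - Fs ω ≤ C' * R n} := by
  -- On `A J` a deterministic `J` bounds the gaps and the time from which the drift holds. These
  -- events increase and cover `E` up to a null set.
  set A : ℕ → Set Ω := fun J => {ω | (∀ n, gap F (θ n ω) ≤ J) ∧ (⨅ x : Vec m, F x) ≤ Fs ω ∧
    ∀ n, J ≤ n → φ (F (θ n ω) - Fs ω) ≤ κ * ‖∇F (θ n ω)‖ ^ 2} with hA
  have hAmono : Monotone A := by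
    intro i j hij ω ⟨h1, h2, h3⟩
    exact ⟨fun n => (h1 n).trans (Nat.cast_le.2 hij), h2, fun n hn => h3 n (hij.trans hn)⟩
  have hEA : P.real E ≤ P.real (⋃ J, A J) := by
    refine ENNReal.toReal_mono (measure_ne_top _ _) (measure_mono_ae ?_)
    filter_upwards [hFs, hφ] with ω h1 h2 hω
    obtain ⟨J₁, hJ₁⟩ := eventually_atTop.1 (h2 hω)
    obtain ⟨B, hB⟩ := h1.bddAbove_range
    obtain ⟨J₂, hJ₂⟩ := exists_nat_ge (B - ⨅ x : Vec m, F x)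
    refine Set.mem_iUnion.2 ⟨max J₁ J₂, fun n => ?_, ?_, fun n hn => hJ₁ n (by omega)⟩
    · have h3 : F (θ n ω) ≤ B := hB ⟨n, rfl⟩
      have h4 : (J₂ : ℝ) ≤ (max J₁ J₂ : ℕ) := Nat.cast_le.2 (le_max_right _ _)
      simp only [gap]
      linarith
    · exact ge_of_tendsto' h1 fun n => M.smooth.iInf_le _
  have hlim : Tendsto (fun J => P.real (A J)) atTop (𝓝 (P.real (⋃ J, A J))) :=
    (ENNReal.tendsto_toReal (measure_ne_top _ _)).comp (tendsto_measure_iUnion_atTop hAmono)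
  obtain ⟨J, hJA, hJN⟩ := ((hlim.eventually (lt_mem_nhds
    (show 1 - 3 * δ / 4 < P.real (⋃ J, A J) by linarith))).and (eventually_ge_atTop N)).exists
  obtain ⟨CG, hCG, hG⟩ := M.smooth.exists_gradient_sq_le M.L_pos M.α_pos M.α_le
  have hJ0 : (0 : ℝ) ≤ J := Nat.cast_nonneg J
  have hL := M.L_pos
  have hC := hW.C_pos
  -- the truncated gradient field
  set u : Vec m → Vec m := fun x => if gap F x ≤ J then ∇F x else 0 with hu
  have hum : Measurable u := Measurable.ite (measurableSet_le M.measurable_gap measurable_const)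
    M.measurable_gradient measurable_const
  have huK : ∀ x, ‖u x‖ ≤ Real.sqrt (CG * (J + 1)) := by
    intro x
    by_cases h : gap F x ≤ J
    · simp only [hu, if_pos h]
      refine Real.le_sqrt_of_sq_le ((hG x).trans ?_)
      have : F x - ⨅ x' : Vec m, F x' ≤ J := h
      gcongr
    · simp only [hu, if_neg h, norm_zero]
      positivity
  -- Truncation trades the growth of the oracle variance for the factor `J + 1`, leaving `‖∇F‖²`,
  -- whose weighted expectations are summable. On `A J` the truncation is never active.
  have huG : ∀ x, ‖u x‖ ^ 2 * (gap F x + 1) ≤ (J + 1) * ‖∇F x‖ ^ 2 := by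
    intro x
    by_cases h : gap F x ≤ J
    · simp only [hu, if_pos h]
      rw [mul_comm]
      gcongr
    · simp only [hu, if_neg h, norm_zero]
      nlinarith [sq_nonneg ‖∇F x‖]
  set a : ℕ → ℝ := fun k => if J ≤ k then w (k + 1) * γ (k + 1) else 0 with ha
  set T : ℕ → Ω → ℝ := noiseSum P X g γ Xs θ₀ u a with hT
  set Z : ℕ → Ω → ℝ := fun n ω =>
    ∑ k ∈ Finset.Ico J n, w (k + 1) * γ (k + 1) ^ (1 + α) * (L * (1 + ‖𝐠 k ω‖ ^ 2)) with hZ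
  have hwγ : ∀ k, J ≤ k → 0 ≤ w (k + 1) * γ (k + 1) ^ (1 + α) := fun k hk =>
    mul_nonneg (hW.w_pos _ (by omega)).le (Real.rpow_nonneg (M.step_pos k).le _)
  -- second moments of the martingale part
  obtain ⟨C₁, hC₁, h₁⟩ := M.exists_integral_noiseSum_sq_le
  set Q := ∑' k : ℕ, γ (k + 1) * ∫ ω, ‖∇F (θ k ω)‖ ^ 2 ∂P with hQ
  have hint0 : ∀ k, 0 ≤ γ (k + 1) * ∫ ω, ‖∇F (θ k ω)‖ ^ 2 ∂P := fun k =>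
    mul_nonneg (M.step_pos k).le (integral_nonneg fun _ => by positivity)
  have hQ0 : 0 ≤ Q := tsum_nonneg hint0
  set C₂ := C₁ * ((J + 1) * C * Q) + 1 with hC₂
  have hC₂0 : 0 < C₂ := by positivity
  have hT2 : ∀ n, N ≤ n → ∫ ω, T n ω ^ 2 ∂P ≤ C₂ * (w n * R n) ^ 2 := by
    intro n hn
    have h2 : ∀ k ∈ Finset.range n,
        a k ^ 2 * ∫ ω, ‖u (θ k ω)‖ ^ 2 * (gap F (θ k ω) + 1) ∂P
          ≤ (J + 1) * C * (w n * R n) ^ 2 * (γ (k + 1) * ∫ ω, ‖∇F (θ k ω)‖ ^ 2 ∂P) := by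
      intro k hk
      have h3 : ∫ ω, ‖u (θ k ω)‖ ^ 2 * (gap F (θ k ω) + 1) ∂P
          ≤ (J + 1) * ∫ ω, ‖∇F (θ k ω)‖ ^ 2 ∂P := by
        rw [← integral_const_mul]
        exact integral_mono (M.integrable_norm_sq_mul hum huK
          ((M.integrable_gap k).add (integrable_const 1)) k)
          ((M.integrable_gradient_sq k).const_mul _) fun ω => huG _
      -- `NoiseWeights` bounds one factor `γ` of `a k ^ 2`; the other is kept for the sum `∑ γ
      -- E‖∇F‖²`.
      have h4 : a k ^ 2 ≤ C * (w n * R n) ^ 2 * γ (k + 1) := by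
        have hγk := M.step_pos k
        by_cases h : J ≤ k
        · simp only [ha, if_pos h]
          have h5 := hNW k n (hJN.trans h) (Finset.mem_range.1 hk)
          nlinarith
        · have : a k = 0 := if_neg h
          rw [this, zero_pow two_ne_zero]
          exact mul_nonneg (mul_nonneg hC.le (sq_nonneg _)) hγk.le
      have hg0 : 0 ≤ ∫ ω, ‖∇F (θ k ω)‖ ^ 2 ∂P := integral_nonneg fun _ => by positivity
      calc _ ≤ a k ^ 2 * ((J + 1) * ∫ ω, ‖∇F (θ k ω)‖ ^ 2 ∂P) := by gcongr
        _ ≤ (C * (w n * R n) ^ 2 * γ (k + 1)) * ((J + 1) * ∫ ω, ‖∇F (θ k ω)‖ ^ 2 ∂P) := by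
          gcongr
        _ = _ := by ring
    calc ∫ ω, T n ω ^ 2 ∂P ≤ _ := h₁ u _ hum huK a n
      _ ≤ C₁ * ∑ k ∈ Finset.range n, (J + 1) * C * (w n * R n) ^ 2
            * (γ (k + 1) * ∫ ω, ‖∇F (θ k ω)‖ ^ 2 ∂P) :=
          mul_le_mul_of_nonneg_left (Finset.sum_le_sum h2) hC₁.le
      _ = C₁ * ((J + 1) * C * (w n * R n) ^ 2
            * ∑ k ∈ Finset.range n, γ (k + 1) * ∫ ω, ‖∇F (θ k ω)‖ ^ 2 ∂P) := by
          rw [← Finset.mul_sum]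
      _ ≤ C₁ * ((J + 1) * C * (w n * R n) ^ 2 * Q) := by
          gcongr
          exact M.summable_integral_gradient_sq.sum_le_tsum _ fun k _ => hint0 k
      _ = C₁ * ((J + 1) * C * Q) * (w n * R n) ^ 2 := by ring
      _ ≤ _ := by
          gcongr
          linarith
  -- first moments of the second-order part
  obtain ⟨C₃, hC₃, h₃⟩ := M.exists_integral_direction_sq_le
  set C₄ := L * (1 + C₃) * C with hC₄
  have hC₄0 : 0 < C₄ := by positivity
  have hZi : ∀ n, Integrable (Z n) P := fun n => integrable_finsetSum _ fun k _ =>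
    (((integrable_const (1 : ℝ)).add (M.integrable_direction_sq k
      (M.integrable_gap k))).const_mul L).const_mul _
  have hZ0 : ∀ n ω, 0 ≤ Z n ω := fun n ω => Finset.sum_nonneg fun k hk =>
    mul_nonneg (hwγ k (Finset.mem_Ico.1 hk).1) (by positivity)
  have hsub : ∀ n, ∀ f : ℕ → ℝ, (∀ k, N ≤ k → 0 ≤ f k) →
      ∑ k ∈ Finset.Ico J n, f k ≤ ∑ k ∈ Finset.Ico N n, f k := fun n f hf =>
    Finset.sum_le_sum_of_subset_of_nonneg (Finset.Ico_subset_Ico_left hJN)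
      fun k hk _ => hf k (Finset.mem_Ico.1 hk).1
  have hsum : ∀ n, J ≤ n → ∑ k ∈ Finset.Ico J n, w (k + 1) * e k ≤ C * (w n * R n) ∧
      ∑ k ∈ Finset.Ico J n, w (k + 1) * γ (k + 1) ^ (1 + α) ≤ C * (w n * R n) := by
    intro n hn
    have h4 : ∀ k, N ≤ k → 0 ≤ w (k + 1) * e k ∧ 0 ≤ w (k + 1) * γ (k + 1) ^ (1 + α) := by
      intro k hk
      have := hW.w_pos (k + 1) (by omega)
      exact ⟨mul_nonneg this.le (hW.e_nonneg k hk),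
        mul_nonneg this.le (Real.rpow_nonneg (M.step_pos k).le _)⟩
    have h5 := hW.sum_le n (hJN.trans hn)
    constructor
    · refine ((hsub n _ fun k hk => (h4 k hk).1).trans (Finset.sum_le_sum fun k hk => ?_)).trans h5
      rw [mul_add]
      linarith [(h4 k (Finset.mem_Ico.1 hk).1).2]
    · refine ((hsub n _ fun k hk => (h4 k hk).2).trans (Finset.sum_le_sum fun k hk => ?_)).trans h5
      rw [mul_add]
      linarith [(h4 k (Finset.mem_Ico.1 hk).1).1]
  have hZ1 : ∀ n, J ≤ n → ∫ ω, Z n ω ∂P ≤ C₄ * (w n * R n) := by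
    intro n hn
    have h4 : ∫ ω, Z n ω ∂P = ∑ k ∈ Finset.Ico J n, w (k + 1) * γ (k + 1) ^ (1 + α)
        * (L * (1 + ∫ ω, ‖𝐠 k ω‖ ^ 2 ∂P)) := by
      have hi : ∀ k, Integrable (fun ω => L * (1 + ‖𝐠 k ω‖ ^ 2)) P := fun k =>
        ((integrable_const (1 : ℝ)).add (M.integrable_direction_sq k
          (M.integrable_gap k))).const_mul L
      rw [integral_finsetSum _ fun k _ => (hi k).const_mul _]
      refine Finset.sum_congr rfl fun k _ => ?_
      rw [integral_const_mul, integral_const_mul, integral_add (integrable_const _)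
        (M.integrable_direction_sq k (M.integrable_gap k))]
      simp
    rw [h4]
    calc _ ≤ ∑ k ∈ Finset.Ico J n, w (k + 1) * γ (k + 1) ^ (1 + α) * (L * (1 + C₃)) := by
          refine Finset.sum_le_sum fun k hk => ?_
          have := hwγ k (Finset.mem_Ico.1 hk).1
          have := h₃ k
          gcongr
      _ = (∑ k ∈ Finset.Ico J n, w (k + 1) * γ (k + 1) ^ (1 + α)) * (L * (1 + C₃)) := by
          rw [Finset.sum_mul]
      _ ≤ (C * (w n * R n)) * (L * (1 + C₃)) := by
          gcongr
          exact (hsum n hn).2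
      _ = _ := by rw [hC₄]; ring
  -- assembling
  set c₁ := 8 * C₄ / δ with hc₁
  set c₂ := Real.sqrt (8 * C₂ / δ) with hc₂
  have hc₁0 : 0 < c₁ := by positivity
  have hc₂0 : 0 < c₂ := Real.sqrt_pos.2 (by positivity)
  have hc₂2 : c₂ ^ 2 = 8 * C₂ / δ := Real.sq_sqrt (by positivity)
  have hterm : ∀ k ∈ Finset.Icc 1 J, 0 ≤ J / R k := fun k hk =>
    div_nonneg hJ0 (hW.R_pos k (Finset.mem_Icc.1 hk).1).le
  have hwJ := hW.w_pos J hJN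
  set C₅ := C * (w J * J + 1) + c₁ + c₂ with hC₅
  have hC₅0 : 0 < C₅ := by positivity
  refine ⟨C₅ + ∑ k ∈ Finset.Icc 1 J, J / R k,
    add_pos_of_pos_of_nonneg hC₅0 (Finset.sum_nonneg hterm), fun n hn => ?_⟩
  have hRn := hW.R_pos n hn
  have hDle : ∀ ω ∈ A J, ∀ n, F (θ n ω) - Fs ω ≤ J := by
    intro ω hω n
    have h4 := hω.1 n
    simp only [gap] at h4
    linarith [hω.2.1]
  rcases lt_or_ge n J with hnJ | hnJ
  · have h4 : A J ⊆ {ω | F (θ n ω) - Fs ω ≤ (C₅ + ∑ k ∈ Finset.Icc 1 J, J / R k) * R n} := by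
      intro ω hω
      refine (hDle ω hω n).trans ?_
      have h5 := Finset.single_le_sum hterm (Finset.mem_Icc.2 ⟨hn, hnJ.le⟩)
      calc (J : ℝ) = J / R n * R n := by field_simp
        _ ≤ _ := by
          refine mul_le_mul_of_nonneg_right ?_ hRn.le
          linarith
    have h5 := measureReal_mono (μ := P) h4
    linarith
  · have hw := hW.w_pos n (hJN.trans hnJ)
    have hwR : 0 < w n * R n := mul_pos hw hRn
    have h4 : A J ⊆ {ω | F (θ n ω) - Fs ω ≤ (C₅ + ∑ k ∈ Finset.Icc 1 J, J / R k) * R n}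
        ∪ ({ω | c₁ * (w n * R n) ≤ Z n ω} ∪ {ω | c₂ ^ 2 * (w n * R n) ^ 2 ≤ T n ω ^ 2}) := by
      intro ω hω
      by_contra hcon
      simp only [Set.mem_union, Set.mem_ofPred_eq, not_or, not_le] at hcon
      obtain ⟨hcon1, hcon2, hcon3⟩ := hcon
      have huω : ∀ k, u (θ k ω) = ∇F (θ k ω) := fun k => if_pos (hω.1 k)
      have h5 := M.weighted_gap_le hW hJN huω hω.2.2 hnJ
      have h6 : |T n ω| < c₂ * (w n * R n) := by
        refine abs_lt_of_sq_lt_sq ?_ (by positivity)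
        rw [mul_pow]
        exact hcon3
      have h7 := (abs_lt.1 h6).1
      have h8 := (hsum n hnJ).1
      have h9 : w J * (F (θ J ω) - Fs ω) ≤ w J * J * (C * (w n * R n)) := by
        calc _ ≤ w J * J := by
              have := hDle ω hω J
              gcongr
          _ ≤ _ := le_mul_of_one_le_right (by positivity) (hW.one_le_mul n (hJN.trans hnJ))
      have h10 : w n * (F (θ n ω) - Fs ω) ≤ w n * (C₅ * R n) := by
        calc w n * (F (θ n ω) - Fs ω) ≤ w J * J * (C * (w n * R n)) + C * (w n * R n)
              + c₁ * (w n * R n) + c₂ * (w n * R n) := by linarith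
          _ = _ := by rw [hC₅]; ring
      have h11 := le_of_mul_le_mul_left h10 hw
      have h12 : C₅ * R n ≤ (C₅ + ∑ k ∈ Finset.Icc 1 J, J / R k) * R n :=
        mul_le_mul_of_nonneg_right (le_add_of_nonneg_right (Finset.sum_nonneg hterm)) hRn.le
      linarith
    have h5 : P.real {ω | c₁ * (w n * R n) ≤ Z n ω} ≤ δ / 8 := by
      have h6 := mul_meas_ge_le_integral_of_nonneg (μ := P)
        (Eventually.of_forall (hZ0 n)) (hZi n) (c₁ * (w n * R n))
      refine le_of_mul_le_mul_left (a := c₁ * (w n * R n)) ?_ (by positivity)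
      refine h6.trans ((hZ1 n hnJ).trans (le_of_eq ?_))
      rw [hc₁]
      field_simp
    have h6 : P.real {ω | c₂ ^ 2 * (w n * R n) ^ 2 ≤ T n ω ^ 2} ≤ δ / 8 := by
      have h7 := mul_meas_ge_le_integral_of_nonneg (μ := P)
        (Eventually.of_forall fun ω => sq_nonneg (T n ω))
        (M.memLp_noiseSum hum huK a n).integrable_sq (c₂ ^ 2 * (w n * R n) ^ 2)
      refine le_of_mul_le_mul_left (a := c₂ ^ 2 * (w n * R n) ^ 2) ?_ (by positivity)
      refine h7.trans ((hT2 n (hJN.trans hnJ)).trans (le_of_eq ?_))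
      rw [hc₂2]
      field_simp
    have h7 := measureReal_mono (μ := P) h4
    have h8 := h7.trans (measureReal_union_le _ _)
    have h9 := measureReal_union_le (μ := P) {ω | c₁ * (w n * R n) ≤ Z n ω}
      {ω | c₂ ^ 2 * (w n * R n) ^ 2 ≤ T n ω ^ 2}
    linarith

end

end SGDModel

/-! ### Łojasiewicz inequalities: compactness and use along sequences. -/

/-- A cluster point of a convergent function is its limit. -/
theorem MapClusterPt.eq_of_tendsto {ι X : Type*} [TopologicalSpace X] [T2Space X] {f : Filter ι}
    {u : ι → X} {x y : X} (h : MapClusterPt x f u) (hu : Tendsto u f (𝓝 y)) : x = y := by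
  have : NeBot (𝓝 x ⊓ 𝓝 y) := NeBot.mono h (inf_le_inf_left _ hu)
  exact eq_of_nhds_neBot this

section Lojasiewicz

variable {m : ℕ} {F : Vec m → ℝ}

theorem isCompact_levelSet (hF : Continuous F) (h : Tendsto F (cocompact (Vec m)) atTop) (l : ℝ) :
    IsCompact (levelSet F l) := by
  obtain ⟨t, ht, hts⟩ := mem_cocompact.1 (h.eventually_gt_atTop l)
  refine ht.of_isClosed_subset (isClosed_le hF continuous_const) fun x hx => ?_
  by_contra hxt
  have h1 : l < F x := hts hxt
  have h2 : F x ≤ l := hx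
  linarith

/-- A larger exponent absorbs the constant in a Łojasiewicz inequality. -/
theorem UniformLojasiewicz.of_lt (hF : Continuous F) {K : Set (Vec m)} {β β' ζ : ℝ} (hβ : β < β')
    (hβ0 : 0 < β) (h : UniformLojasiewicz F K β ζ) : UniformLojasiewicz F K β' 1 := by
  intro x hx hgx
  obtain ⟨V, hV, hxV, hVζ⟩ := h x hx hgx
  have hc : Continuous fun y => |F y - F x| ^ (β' - β) * ζ :=
    (((hF.sub continuous_const).abs).rpow_const fun _ => Or.inr (by linarith)).mul
      continuous_const
  -- The surplus power `|F y - F x|^(β' - β)` tends to zero at `x` and beats `ζ` after shrinking the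
  -- neighbourhood.
  refine ⟨V ∩ {y | |F y - F x| ^ (β' - β) * ζ < 1}, hV.inter (isOpen_lt hc continuous_const),
    ⟨hxV, ?_⟩, fun y hy => ?_⟩
  · change |F x - F x| ^ (β' - β) * ζ < 1
    rw [sub_self, abs_zero, Real.zero_rpow (by linarith), zero_mul]
    exact one_pos
  · have h1 := hVζ y hy.1
    have h2 : |F y - F x| ^ (β' - β) * ζ < 1 := hy.2
    have h3 : |F y - F x| ^ β' = |F y - F x| ^ (β' - β) * |F y - F x| ^ β := by
      rw [← Real.rpow_add' (abs_nonneg _) (by linarith)]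
      ring_nf
    rw [h3, one_mul]
    calc _ ≤ |F y - F x| ^ (β' - β) * (ζ * ‖gradient F y‖) := by gcongr
      _ = |F y - F x| ^ (β' - β) * ζ * ‖gradient F y‖ := by ring
      _ ≤ _ := mul_le_of_le_one_left (norm_nonneg _) h2.le

/-- On a compact set, the Łojasiewicz inequalities hold with a common exponent. -/
theorem Lojasiewicz.exists_uniform (h : Lojasiewicz F) (hG : Continuous (gradient F))
    {K : Set (Vec m)} (hK : IsCompact K) :
    ∃ β : ℝ, 0 < β ∧ β < 1 ∧ UniformLojasiewicz F K β 1 := by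
  have hF := h.1.continuous
  refine hK.induction_on (p := fun s => ∃ β : ℝ, 0 < β ∧ β < 1 ∧ UniformLojasiewicz F s β 1)
    ⟨1 / 2, by norm_num, by norm_num, fun _ hx => hx.elim⟩ ?_ ?_ ?_
  · rintro s t hst ⟨β, h1, h2, h3⟩
    exact ⟨β, h1, h2, fun x hx => h3 x (hst hx)⟩
  · rintro s t ⟨β₁, h1, h2, h3⟩ ⟨β₂, h4, h5, h6⟩
    have h7 : max β₁ β₂ < 1 := max_lt h2 h5
    have h8 := le_max_left β₁ β₂
    have h9 := le_max_right β₁ β₂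
    refine ⟨(max β₁ β₂ + 1) / 2, by linarith, by linarith, fun x hx => ?_⟩
    rcases hx with hx | hx
    · exact h3.of_lt hF (by linarith) h1 x hx
    · exact h6.of_lt hF (by linarith) h4 x hx
  · intro x _
    by_cases hgx : gradient F x = 0
    · obtain ⟨V, hV, hxV, β, ζ, hβ0, hβ1, -, hVζ⟩ := h.2 x hgx
      refine ⟨V, mem_nhdsWithin_of_mem_nhds (hV.mem_nhds hxV), (β + 1) / 2, by linarith,
        by linarith, ?_⟩
      -- At a stationary point of `V` the inequality centred at `x` forces the value `F x`, so that
      -- same inequality is already centred there.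
      have h1 : UniformLojasiewicz F V β ζ := by
        intro y hy hgy
        have h2 := hVζ y hy
        rw [hgy, norm_zero, mul_zero] at h2
        have h3 : F y - F x = 0 := by
          by_contra hne
          exact absurd h2 (not_le.2 (Real.rpow_pos_of_pos (abs_pos.2 hne) _))
        exact ⟨V, hV, hy, fun z hz => by rw [sub_eq_zero.1 h3]; exact hVζ z hz⟩
      exact h1.of_lt hF (by linarith) hβ0
    · refine ⟨{y | gradient F y ≠ 0}, mem_nhdsWithin_of_mem_nhds
        ((isOpen_ne_fun hG continuous_const).mem_nhds hgx), 1 / 2, by norm_num, by norm_num,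
        fun y hy hgy => absurd hgy hy⟩

/-- The exponent `1` lies strictly above every local exponent, so each point can absorb its own
constant and no compactness is needed. -/
theorem Lojasiewicz.uniform_univ (h : Lojasiewicz F) : UniformLojasiewicz F Set.univ 1 1 := by
  intro x _ hgx
  obtain ⟨V, hV, hxV, β, ζ, hβ0, hβ1, -, hVζ⟩ := h.2 x hgx
  have h1 : UniformLojasiewicz F {x} β ζ := by
    rintro y rfl -
    exact ⟨V, hV, hxV, hVζ⟩
  exact h1.of_lt h.1.continuous hβ1 hβ0 x rfl hgx

/-- A Łojasiewicz inequality eventually holds along any bounded sequence of nearly stationary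
points whose values converge. -/
theorem UniformLojasiewicz.eventually (hF : Continuous F) (hG : Continuous (gradient F))
    {K S : Set (Vec m)} {β ζ l : ℝ} (h : UniformLojasiewicz F K β ζ) (hS : IsCompact S)
    {x : ℕ → Vec m} (hxS : ∀ n, x n ∈ S) (hl : Tendsto (fun n => F (x n)) atTop (𝓝 l))
    (hg : Tendsto (fun n => ‖gradient F (x n)‖) atTop (𝓝 0))
    (hK : ∀ y, MapClusterPt y atTop x → y ∈ K) :
    ∀ᶠ n in atTop, |F (x n) - l| ^ β ≤ ζ * ‖gradient F (x n)‖ := by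
  by_contra hcon
  set B : Set ℕ := {n | ¬|F (x n) - l| ^ β ≤ ζ * ‖gradient F (x n)‖} with hB
  have hfreq : ∃ᶠ n in atTop, n ∈ B := not_eventually.1 hcon
  -- By compactness the bad indices have their own cluster point. It is stationary, has value `l`
  -- and lies in `K`, and the inequality around it contradicts badness.
  have hne : NeBot (atTop ⊓ 𝓟 B) := frequently_mem_iff_neBot.1 hfreq
  obtain ⟨y, -, hy⟩ := hS.exists_mapClusterPt (f := atTop ⊓ 𝓟 B) (u := x)
    (tendsto_principal.2 (Eventually.of_forall hxS))
  have hy' : MapClusterPt y atTop x := hy.mono inf_le_left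
  have hFy : F y = l := (hy'.continuousAt_comp hF.continuousAt).eq_of_tendsto hl
  have hgy : gradient F y = 0 := norm_eq_zero.1
    ((hy'.continuousAt_comp hG.norm.continuousAt).eq_of_tendsto hg)
  obtain ⟨V, hV, hyV, hVζ⟩ := h y (hK y hy') hgy
  have h1 : ∃ᶠ n in atTop ⊓ 𝓟 B, x n ∈ V := hy.frequently (hV.mem_nhds hyV)
  obtain ⟨n, hn1, hn2⟩ := (h1.and_eventually (mem_inf_of_right (mem_principal_self B))).exists
  refine hn2 ?_
  rw [← hFy]
  exact hVζ _ hn1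

/-- The quadratic form of a Łojasiewicz inequality. -/
theorem rpow_two_mul_le_of_lojasiewicz {β ζ t G : ℝ} (hζ : 0 < ζ) (ht : 0 ≤ t)
    (h : t ^ β ≤ ζ * G) : t ^ (2 * β) / ζ ^ 2 ≤ G ^ 2 := by
  rw [div_le_iff₀ (by positivity), mul_comm 2 β, Real.rpow_mul ht, Real.rpow_two]
  calc (t ^ β) ^ 2 ≤ (ζ * G) ^ 2 := by
        have := Real.rpow_nonneg ht β
        gcongr
    _ = _ := by ring

end Lojasiewicz

/-! ### Local rates. -/

namespace SGDModel

variable {Ω : Type*} [mΩ : MeasurableSpace Ω] {P : Measure Ω} [IsProbabilityMeasure P] {d m : ℕ}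
  {X : Ω → Vec d} {F : Vec m → ℝ} {g : Vec d → Vec m → Vec m} {Xs : ℕ → Ω → Vec d}
  {θ₀ : Ω → Vec m} {L α κ : ℝ} {γ : ℕ → ℝ}

local notation "θ" => sgd g γ Xs θ₀
local notation "∇F" => gradient F

variable (M : SGDModel P X F g Xs θ₀ L α κ γ)
include M

theorem ae_tendsto_limitValue :
    ∀ᵐ ω ∂P, Tendsto (fun n => F (θ n ω)) atTop (𝓝 (limitValue F θ ω)) := by
  filter_upwards [M.ae_exists_tendsto_gap] with ω ⟨c, hc⟩
  have h1 : Tendsto (fun n => F (θ n ω)) atTop (𝓝 (c + ⨅ x : Vec m, F x)) := by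
    refine (hc.add_const (⨅ x : Vec m, F x)).congr fun n => ?_
    simp [gap]
  rwa [limitValue, h1.limUnder_eq]

/-- The accumulation points lie in a level set with large probability. -/
theorem exists_accPoints_subset_levelSet {ε : ℝ} (hε : 0 < ε) :
    ∃ l : ℝ, (⨅ x : Vec m, F x) < l ∧
      1 - ε ≤ P.real {ω | accPoints θ ω ⊆ levelSet F l} := by
  set A : ℕ → Set Ω := fun J => {ω | ∀ n, gap F (θ n ω) ≤ J} with hA
  have hAmono : Monotone A := fun i j hij ω h n => (h n).trans (Nat.cast_le.2 hij)
  have hAall : P.real (⋃ J, A J) = 1 := by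
    have h1 : ∀ᵐ ω ∂P, ω ∈ ⋃ J, A J := by
      filter_upwards [M.ae_exists_tendsto_gap] with ω ⟨c, hc⟩
      obtain ⟨B, hB⟩ := hc.bddAbove_range
      obtain ⟨J, hJ⟩ := exists_nat_ge B
      exact Set.mem_iUnion.2 ⟨J, fun n => (hB ⟨n, rfl⟩).trans hJ⟩
    have h2 : P (⋃ J, A J) = P Set.univ :=
      measure_congr (h1.mono fun ω hω => propext ⟨fun _ => trivial, fun _ => hω⟩)
    simp [Measure.real, h2]
  have hlim : Tendsto (fun J => P.real (A J)) atTop (𝓝 1) := by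
    rw [← hAall]
    exact (ENNReal.tendsto_toReal (measure_ne_top _ _)).comp (tendsto_measure_iUnion_atTop hAmono)
  obtain ⟨J, hJ⟩ := (hlim.eventually (lt_mem_nhds (show 1 - ε < 1 by linarith))).exists
  have hJ0 : (0 : ℝ) ≤ J := Nat.cast_nonneg J
  refine ⟨(⨅ x : Vec m, F x) + J + 1, by linarith, hJ.le.trans (measureReal_mono fun ω hω y hy => ?_)⟩
  have hcl : IsClosed (levelSet F ((⨅ x : Vec m, F x) + J + 1)) :=
    isClosed_le M.smooth.continuous continuous_const
  by_contra hyl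
  have hy' : MapClusterPt y atTop fun n => θ n ω := hy
  obtain ⟨n, hn⟩ := (hy'.frequently (hcl.isOpen_compl.mem_nhds hyl)).exists
  refine hn ?_
  have h1 := hω n
  simp only [gap] at h1
  change F (θ n ω) ≤ _
  linarith

/-- A Łojasiewicz inequality near the accumulation points eventually holds along the trajectory. -/
theorem ae_eventually_lojasiewicz (hF : Tendsto F (cocompact (Vec m)) atTop) {K : Set (Vec m)}
    {β ζ : ℝ} (h : UniformLojasiewicz F K β ζ) :
    ∀ᵐ ω ∂P, ω ∈ {ω | accPoints θ ω ⊆ K} → ∀ᶠ n in atTop,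
      |F (θ n ω) - limitValue F θ ω| ^ β ≤ ζ * ‖∇F (θ n ω)‖ := by
  filter_upwards [M.ae_tendsto_limitValue, M.ae_tendsto_gradient_zero] with ω h1 h2 hω
  obtain ⟨B, hB⟩ := h1.bddAbove_range
  exact h.eventually M.smooth.continuous (M.smooth.continuous_gradient M.α_pos)
    (isCompact_levelSet M.smooth.continuous hF B) (fun n => hB ⟨n, rfl⟩) h1 h2 hω

/-- The local rates, on an event on which the accumulation points satisfy a uniform Łojasiewicz
inequality. -/
theorem localRates (hF : Tendsto F (cocompact (Vec m)) atTop) {ρ : ℝ}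
    (hfine : FineStepSizes γ α ρ) {K : Set (Vec m)} {β ζ δ : ℝ} (hζ : 0 < ζ)
    (hδ : 0 < δ) (hK : 1 - δ / 2 ≤ P.real {ω | accPoints θ ω ⊆ K})
    (h : UniformLojasiewicz F K β ζ) :
    LocalRates P F θ γ α κ ρ δ β (ζ ^ (1 / β)) := by
  have hα := M.α_pos
  have hκ := M.oracle.1
  have hev := M.ae_eventually_lojasiewicz hF h
  constructor
  · intro hβ2 hcrit
    set z := ζ ^ (1 / β) with hz
    have hz0 : 0 < z := Real.rpow_pos_of_pos hζ _
    have hmax : 0 < max α (1 / 2) := lt_max_of_lt_left hα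
    obtain ⟨μ', hμ'0, hμ', hlog⟩ := exists_eventually_log_le hmax (div_pos hκ hz0) M.steps.1
      hfine.1 fun γs hγs hc => by
        rw [div_mul_eq_mul_div, lt_div_iff₀ hz0, mul_comm]
        exact hcrit γs hγs hc
    obtain ⟨w, e, N, C, hW, hNW⟩ := M.steps.exists_exp_rateWeights hα
      (lt_min hα (by norm_num : (0 : ℝ) < 1 / 2)) (min_le_left _ _) (le_max_left _ _) hμ'0 hμ' hlog
    refine M.exists_local_rate hW (hNW (min_le_right _ _) (le_max_right _ _)) hδ hK
      M.ae_tendsto_limitValue ?_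
    filter_upwards [hev, M.ae_tendsto_limitValue] with ω h1 h2 hω
    -- For `β = 1/2` this is an equality, as `z = ζ²`. For `β < 1/2` the left side tends to zero, so
    -- any positive `z` would do.
    have h3 : ∀ᶠ n in atTop, |F (θ n ω) - limitValue F θ ω| ^ (1 - 2 * β) * ζ ^ 2 ≤ z := by
      rcases hβ2.eq_or_lt with hβe | hβl
      · refine Eventually.of_forall fun n => ?_
        rw [hz, hβe]
        norm_num
      · have h4 : Tendsto (fun n => |F (θ n ω) - limitValue F θ ω| ^ (1 - 2 * β) * ζ ^ 2) atTop
            (𝓝 (|limitValue F θ ω - limitValue F θ ω| ^ (1 - 2 * β) * ζ ^ 2)) :=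
          ((h2.sub_const _).abs.rpow_const (Or.inr (by linarith))).mul_const _
        rw [sub_self, abs_zero, Real.zero_rpow (by linarith), zero_mul] at h4
        exact h4.eventually (ge_mem_nhds hz0)
    filter_upwards [h1 hω, h3] with n h4 h5
    set t := |F (θ n ω) - limitValue F θ ω| with ht
    have ht0 : 0 ≤ t := abs_nonneg _
    have h6 := rpow_two_mul_le_of_lojasiewicz hζ ht0 h4
    have h7 : t ≤ z * ‖∇F (θ n ω)‖ ^ 2 := by
      calc t = t ^ (1 - 2 * β) * ζ ^ 2 * (t ^ (2 * β) / ζ ^ 2) := by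
            rw [show t ^ (1 - 2 * β) * ζ ^ 2 * (t ^ (2 * β) / ζ ^ 2)
              = t ^ (1 - 2 * β) * t ^ (2 * β) by field_simp, ← Real.rpow_add' ht0 (by norm_num)]
            norm_num
        _ ≤ z * ‖∇F (θ n ω)‖ ^ 2 := by gcongr
    calc κ / z * t ≤ κ / z * (z * ‖∇F (θ n ω)‖ ^ 2) := by gcongr
      _ = _ := by field_simp
  · intro hβ2
    obtain ⟨hfine1, -, hρ, hO⟩ := hfine
    have hαρ : 1 < α * ρ := by
      rw [div_lt_iff₀ hα] at hρ
      linarith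
    have hρ1 : 1 < ρ := lt_of_le_of_lt (by rw [le_div_iff₀ hα]; linarith [M.α_le]) hρ
    have hb : 0 < 2 * β - 1 := by linarith
    have hr : 0 < localExponent α ρ β :=
      lt_min (by positivity) (lt_min (by linarith) (by linarith))
    refine ⟨hr, ?_⟩
    have hr2 : localExponent α ρ β ≤ (ρ - 1) / 2 := (min_le_right _ _).trans (min_le_right _ _)
    obtain ⟨w, e, N, C, hW, hNW⟩ := M.steps.exists_rpow_rateWeights hα hO (by linarith) hβ2
      (show 0 < κ / ζ ^ 2 by positivity) hr (min_le_left _ _)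
      ((min_le_right _ _).trans (min_le_left _ _))
    refine M.exists_local_rate hW (hNW (by linarith)) hδ hK M.ae_tendsto_limitValue ?_
    filter_upwards [hev] with ω h1 hω
    filter_upwards [h1 hω] with n h4
    have h6 := rpow_two_mul_le_of_lojasiewicz hζ (abs_nonneg _) h4
    calc κ / ζ ^ 2 * |F (θ n ω) - limitValue F θ ω| ^ (2 * β)
        = κ * (|F (θ n ω) - limitValue F θ ω| ^ (2 * β) / ζ ^ 2) := by ring
      _ ≤ _ := by gcongr

end SGDModel

/-! ### The global inequality and its quadratic consequence. -/

section Global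

variable {m : ℕ} {F : Vec m → ℝ} {L α : ℝ}

/-- Comparing a global Łojasiewicz inequality with the gradient bound for Hölder smooth functions. -/
theorem HolderSmooth.gap_rpow_le (h : HolderSmooth F L α) (hL : 0 < L) (hα : 0 < α) {β ζ : ℝ}
    (hζ : 0 < ζ) {x : Vec m} (hx : gap F x ^ β ≤ ζ * ‖gradient F x‖) :
    gap F x ^ ((1 + α) / α * β)
      ≤ ζ ^ ((1 + α) / α) * ((1 + α) * L ^ (1 / α) / α) * gap F x := by
  have hg : 0 ≤ gap F x := h.gap_nonneg x
  have he : 0 ≤ (1 + α) / α := by positivity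
  calc gap F x ^ ((1 + α) / α * β) = (gap F x ^ β) ^ ((1 + α) / α) := by
        rw [← Real.rpow_mul hg, mul_comm]
    _ ≤ (ζ * ‖gradient F x‖) ^ ((1 + α) / α) :=
        Real.rpow_le_rpow (Real.rpow_nonneg hg _) hx he
    _ = ζ ^ ((1 + α) / α) * ‖gradient F x‖ ^ ((1 + α) / α) :=
        Real.mul_rpow hζ.le (norm_nonneg _)
    _ ≤ ζ ^ ((1 + α) / α) * ((1 + α) * L ^ (1 / α) / α * gap F x) := by
        have := h.gradient_rpow_le hL hα x
        have := Real.rpow_nonneg hζ.le ((1 + α) / α)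
        gcongr
        assumption
    _ = _ := by ring

/-- A globally Łojasiewicz function satisfies the global inequality with some exponent
`β ≥ α / (1 + α)`. -/
theorem GloballyLojasiewicz.exists_globalInequality (hG : GloballyLojasiewicz F)
    (h : HolderSmooth F L α) (hL : 0 < L) (hα : 0 < α) (hα' : α ≤ 1)
    (hF : Tendsto F (cocompact (Vec m)) atTop) :
    ∃ β ζ : ℝ, α / (1 + α) ≤ β ∧ β < 1 ∧ 0 < ζ ∧ GlobalInequality F β ζ := by
  obtain ⟨xs, hxs⟩ := h.continuous.exists_forall_le hF
  have hmin : (⨅ x : Vec m, F x) = F xs :=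
    le_antisymm (h.iInf_le xs) (le_ciInf hxs)
  have hgrad : gradient F xs = 0 := by
    have h1 : IsLocalMin F xs := Eventually.of_forall hxs
    rw [gradient, h1.fderiv_eq_zero, map_zero]
  have hgap0 : gap F xs = 0 := by rw [gap, hmin, sub_self]
  obtain ⟨β, ζ, hβ0, hβ1, hζ, hβζ⟩ := hG.2 xs hgrad
  have hineq : ∀ x, gap F x ^ β ≤ ζ * ‖gradient F x‖ := fun x => by
    have h1 := hβζ x
    rwa [← hmin, abs_of_nonneg (h.gap_nonneg x)] at h1
  have hα1 : 0 < 1 + α := by linarith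
  rcases le_or_gt (α / (1 + α)) β with hle | hlt
  · exact ⟨β, ζ, hle, hβ1, hζ, hineq⟩
  -- For a smaller `β`, the gap raised to a power below `1` is at most a multiple of the gap, so
  -- positive gaps are bounded away from zero. Continuity and a minimizer, where the gap vanishes,
  -- then force `F` to be constant.
  have hzero : ∀ x, gap F x = 0 := by
    intro y
    by_contra hy
    have hy0 : 0 < gap F y := lt_of_le_of_ne (h.gap_nonneg y) (Ne.symm hy)
    set c := ζ ^ ((1 + α) / α) * ((1 + α) * L ^ (1 / α) / α) with hc
    have hc0 : 0 < c := by
      have := Real.rpow_pos_of_pos hζ ((1 + α) / α)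
      have := Real.rpow_pos_of_pos hL (1 / α)
      positivity
    set s := 1 - (1 + α) / α * β with hs
    have hs0 : 0 < s := by
      rw [lt_div_iff₀ hα1] at hlt
      have : (1 + α) / α * β < 1 := by
        rw [div_mul_eq_mul_div, div_lt_one hα]
        linarith
      linarith
    set v := min (gap F y) ((1 / (2 * c)) ^ (1 / s)) with hv
    have hv0 : 0 < v := lt_min hy0 (Real.rpow_pos_of_pos (by positivity) _)
    have hcont : Continuous (gap F) := h.continuous.sub continuous_const
    obtain ⟨x, hx⟩ := mem_range_of_exists_le_of_exists_ge hcont ⟨xs, hgap0.le.trans hv0.le⟩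
      ⟨y, min_le_left _ _⟩
    have h1 := h.gap_rpow_le hL hα hζ (hineq x)
    rw [hx, ← hc] at h1
    have h2 : v ^ s ≤ 1 / (2 * c) := by
      calc v ^ s ≤ ((1 / (2 * c)) ^ (1 / s)) ^ s :=
            Real.rpow_le_rpow hv0.le (min_le_right _ _) hs0.le
        _ = _ := by rw [← Real.rpow_mul (by positivity), one_div_mul_cancel hs0.ne', Real.rpow_one]
    have hp : 0 < v ^ ((1 + α) / α * β) := Real.rpow_pos_of_pos hv0 _
    have h3 : v = v ^ s * v ^ ((1 + α) / α * β) := by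
      rw [← Real.rpow_add hv0, hs]
      simp
    have h4 : c * v ≤ 1 / 2 * v ^ ((1 + α) / α * β) := by
      calc c * v = c * (v ^ s * v ^ ((1 + α) / α * β)) := by rw [← h3]
        _ ≤ c * (1 / (2 * c) * v ^ ((1 + α) / α * β)) := by gcongr
        _ = _ := by field_simp
    linarith
  refine ⟨1 / 2, 1, by rw [div_le_div_iff₀ hα1 two_pos]; linarith, by norm_num, one_pos,
    fun x => ?_⟩
  have h1 : F x - ⨅ θ' : Vec m, F θ' = 0 := hzero x
  rw [h1, Real.zero_rpow (by norm_num)]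
  positivity

/-- The quadratic growth of the gradient implied by the global inequality with exponent at most
`1 / 2`. -/
theorem GlobalInequality.gap_le (h : HolderSmooth F L α) (hL : 0 < L) (hα : 0 < α) {β ζ : ℝ}
    (hβ : α / (1 + α) < β ∨ β = 1 / 2) (hβ2 : β ≤ 1 / 2) (hζ : 0 < ζ)
    (hG : GlobalInequality F β ζ) (x : Vec m) :
    gap F x ≤ ζ ^ (2 + globalLambda α β * ((1 + α) / α))
      * ((1 + α) * L ^ (1 / α) / α) ^ globalLambda α β * ‖gradient F x‖ ^ 2 := by
  have hα1 : 0 < 1 + α := by linarith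
  have hg : 0 ≤ gap F x := h.gap_nonneg x
  have hx : gap F x ^ β ≤ ζ * ‖gradient F x‖ := hG x
  have h1 : gap F x ^ (2 * β) ≤ ζ ^ 2 * ‖gradient F x‖ ^ 2 := by
    have := rpow_two_mul_le_of_lojasiewicz hζ hg hx
    rw [div_le_iff₀ (by positivity)] at this
    linarith
  rcases hβ2.eq_or_lt with hβe | hβl
  · have hl : globalLambda α β = 0 := if_neg (by linarith)
    rw [hl, zero_mul, add_zero, Real.rpow_zero, mul_one, Real.rpow_two]
    rw [hβe] at h1
    norm_num at h1
    exact h1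
  · have hβ0 : α / (1 + α) < β := hβ.resolve_right hβl.ne
    have hs : 0 < (1 + α) / α * β - 1 := by
      rw [div_lt_iff₀ hα1] at hβ0
      have : 1 < (1 + α) / α * β := by
        rw [div_mul_eq_mul_div, one_lt_div hα]
        linarith
      linarith
    have hl : globalLambda α β = (1 - 2 * β) / ((1 + α) / α * β - 1) := if_pos hβl
    set lam := globalLambda α β with hlam
    have hlam0 : 0 ≤ lam := by
      rw [hl]
      exact div_nonneg (by linarith) hs.le
    set c := (1 + α) * L ^ (1 / α) / α with hc
    have hc0 : 0 < c := by
      have := Real.rpow_pos_of_pos hL (1 / α)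
      positivity
    rcases hg.eq_or_lt with hg0 | hg0
    · rw [← hg0]
      positivity
    have h2 := h.gap_rpow_le hL hα hζ hx
    -- As this exponent is positive, the gap is bounded. `globalLambda` is the power turning the
    -- bound into one on `gap ^ (1 - 2β)`, the factor missing from `gap ^ (2β) ≤ ζ² ‖∇F‖²`.
    have h3 : gap F x ^ ((1 + α) / α * β - 1) ≤ ζ ^ ((1 + α) / α) * c := by
      rw [Real.rpow_sub_one hg0.ne', div_le_iff₀ hg0]
      exact h2
    have h4 : gap F x ^ (1 - 2 * β) ≤ (ζ ^ ((1 + α) / α) * c) ^ lam := by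
      calc gap F x ^ (1 - 2 * β) = (gap F x ^ ((1 + α) / α * β - 1)) ^ lam := by
            rw [← Real.rpow_mul hg, hl, mul_div_cancel₀ _ hs.ne']
        _ ≤ _ := Real.rpow_le_rpow (Real.rpow_nonneg hg _) h3 hlam0
    have h5 : (ζ ^ ((1 + α) / α) * c) ^ lam = ζ ^ (lam * ((1 + α) / α)) * c ^ lam := by
      rw [Real.mul_rpow (Real.rpow_nonneg hζ.le _) hc0.le, ← Real.rpow_mul hζ.le,
        mul_comm lam]
    calc gap F x = gap F x ^ (1 - 2 * β) * gap F x ^ (2 * β) := by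
          rw [← Real.rpow_add hg0]
          norm_num
      _ ≤ (ζ ^ ((1 + α) / α) * c) ^ lam * (ζ ^ 2 * ‖gradient F x‖ ^ 2) := by
          gcongr
      _ = _ := by
          rw [h5, Real.rpow_add hζ, Real.rpow_two]
          ring

end Global

/-! ### Global rates and the final assembly. -/

namespace SGDModel

variable {Ω : Type*} [mΩ : MeasurableSpace Ω] {P : Measure Ω} [IsProbabilityMeasure P] {d m : ℕ}
  {X : Ω → Vec d} {F : Vec m → ℝ} {g : Vec d → Vec m → Vec m} {Xs : ℕ → Ω → Vec d}
  {θ₀ : Ω → Vec m} {L α κ : ℝ} {γ : ℕ → ℝ}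

local notation "θ" => sgd g γ Xs θ₀

variable (M : SGDModel P X F g Xs θ₀ L α κ γ) {ρ β ζ : ℝ} (hζ : 0 < ζ)
  (hfine : FineStepSizes γ α ρ) (hG : GlobalInequality F β ζ)
include M hζ hfine hG

/-- The drift is linear on the whole space, so the argument in expectation applies. No noise weights
are needed, whence the rate `γ_n^α` without the cap at `1/2`. -/
theorem global_rate_of_le_half (hβ : α / (1 + α) < β ∨ β = 1 / 2) (hβ2 : β ≤ 1 / 2)
    (hcrit : ∀ γs : ℝ, 0 < γs → CriticalSteps γ γs →
      ζ ^ (2 + globalLambda α β * ((1 + α) / α))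
        * ((1 + α) * L ^ (1 / α) / α) ^ globalLambda α β * α < κ * γs) :
    ∃ C : ℝ, 0 < C ∧ ∀ δ : ℝ, 0 < δ → δ < 1 → ∀ n : ℕ, 1 ≤ n →
      1 - δ ≤ P.real {ω | gap F (θ n ω) ≤ C / δ * γ n ^ α} := by
  have hα := M.α_pos
  have hL := M.L_pos
  have hκ := M.oracle.1
  set z := ζ ^ (2 + globalLambda α β * ((1 + α) / α))
    * ((1 + α) * L ^ (1 / α) / α) ^ globalLambda α β with hz
  have hz0 : 0 < z := by positivity
  obtain ⟨μ', hμ'0, hμ', hlog⟩ := exists_eventually_log_le hα (div_pos hκ hz0) M.steps.1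
    hfine.1 fun γs hγs hc => by
      rw [div_mul_eq_mul_div, lt_div_iff₀ hz0, mul_comm]
      exact hcrit γs hγs hc
  obtain ⟨w, e, N, C, hW, -⟩ := M.steps.exists_exp_rateWeights hα hα le_rfl le_rfl hμ'0 hμ' hlog
  refine M.exists_global_rate hW fun x => ?_
  have h1 := hG.gap_le M.smooth hL hα hβ hβ2 hζ x
  rw [← hz] at h1
  rw [abs_of_nonneg (M.gap_nonneg x)]
  calc κ / z * gap F x ≤ κ / z * (z * ‖gradient F x‖ ^ 2) := by gcongr
    _ = _ := by field_simp

theorem global_rate_of_half_lt (hβ2 : 1 / 2 < β) :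
    0 < globalExponent α ρ β ∧
      ∃ C : ℝ, 0 < C ∧ ∀ δ : ℝ, 0 < δ → δ < 1 → ∀ n : ℕ, 1 ≤ n →
        1 - δ ≤ P.real {ω | gap F (θ n ω) ≤ C / δ * stepSum γ n ^ (-globalExponent α ρ β)} := by
  have hα := M.α_pos
  have hκ := M.oracle.1
  obtain ⟨-, -, hρ, hO⟩ := hfine
  have hαρ : 1 < α * ρ := by
    rw [div_lt_iff₀ hα] at hρ
    linarith
  have hρ0 : 0 < ρ := lt_trans (by positivity) hρ
  have hb : 0 < 2 * β - 1 := by linarith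
  have hr : 0 < globalExponent α ρ β := lt_min (by positivity) (by linarith)
  refine ⟨hr, ?_⟩
  obtain ⟨w, e, N, C, hW, -⟩ := M.steps.exists_rpow_rateWeights hα hO hρ0 hβ2
    (show 0 < κ / ζ ^ 2 by positivity) hr (min_le_left _ _) (min_le_right _ _)
  refine M.exists_global_rate hW fun x => ?_
  have hg : 0 ≤ gap F x := M.gap_nonneg x
  have h6 := rpow_two_mul_le_of_lojasiewicz hζ hg (hG x)
  rw [abs_of_nonneg hg]
  calc κ / ζ ^ 2 * gap F x ^ (2 * β) = κ * (gap F x ^ (2 * β) / ζ ^ 2) := by ring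
    _ ≤ _ := by gcongr

end SGDModel

theorem mainTheorem5 {Ω : Type*} [MeasurableSpace Ω] (P : Measure Ω) [IsProbabilityMeasure P]
    {d m : ℕ} (hd : 1 ≤ d) (hm : 1 ≤ m)
    -- the optimization problem: minimize `F(θ) = E[f(X, θ)]`
    (X : Ω → Vec d) (hX : Measurable X)
    (f : Vec d → Vec m → ℝ) (hf : ∀ θ : Vec m, Integrable (fun ω => f (X ω) θ) P)
    (F : Vec m → ℝ) (hF : ∀ θ : Vec m, F θ = ∫ ω, f (X ω) θ ∂P)
    -- the oracle, the innovations and the initialization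
    (g : Vec d → Vec m → Vec m) (hg : Measurable (Function.uncurry g))
    (Xs : ℕ → Ω → Vec d) (hXs_meas : ∀ n : ℕ, 1 ≤ n → Measurable (Xs n))
    (hXs_law : ∀ n : ℕ, 1 ≤ n → IdentDistrib (Xs n) X P P)
    (hXs_indep : iIndepFun (fun n : ℕ => Xs (n + 1)) P)
    (θ₀ : Ω → Vec m) (hθ₀_meas : Measurable θ₀) (hθ₀ : MemLp θ₀ 2 P)
    (hθ₀_indep : IndepFun θ₀ (fun ω (n : ℕ) => Xs (n + 1) ω) P)
    -- the standing assumptions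
    (L α κ ρ : ℝ) (hL : 0 < L) (hα : 0 < α) (hα' : α ≤ 1) (γ : ℕ → ℝ)
    (hsmooth : HolderSmooth F L α)
    (horacle : OracleCondition P X g F κ)
    (hγ : StepSizes γ α)
    (hcoercive : Tendsto F (cocompact (Vec m)) atTop)
    (hloj : Lojasiewicz F)
    (hγ_fine : FineStepSizes γ α ρ) :
    -- the limit `F_⋆` of `F(θ_n)` exists almost surely
    (∀ᵐ ω ∂P, Tendsto (fun n => F (sgd g γ Xs θ₀ n ω)) atTop
      (𝓝 (limitValue F (sgd g γ Xs θ₀) ω))) ∧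
    -- (i) local setting on a level set
    (∀ δ : ℝ, 0 < δ → δ < 1 →
      ∃ l : ℝ, (⨅ θ : Vec m, F θ) < l ∧
        1 - δ ≤ P.real {ω | accPoints (sgd g γ Xs θ₀) ω ⊆ levelSet F l} ∧
        -- a.
        ((∃ β ζ : ℝ, 0 < β ∧ β < 1 ∧ 0 < ζ ∧ UniformLojasiewicz F (levelSet F l) β ζ) ∧
          ∀ β ζ : ℝ, 0 < β → β < 1 → 0 < ζ → UniformLojasiewicz F (levelSet F l) β ζ →
            LocalRates P F (sgd g γ Xs θ₀) γ α κ ρ δ β (ζ ^ (1 / β))) ∧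
        -- b.
        ((∃ β : ℝ, 0 < β ∧ β < 1 ∧ UniformLojasiewicz F (levelSet F l) β 1) ∧
          ∀ β : ℝ, 0 < β → β < 1 → UniformLojasiewicz F (levelSet F l) β 1 →
            LocalRates P F (sgd g γ Xs θ₀) γ α κ ρ δ β 1)) ∧
    -- (ii) local setting on the whole space
    ((∃ β : ℝ, 0 < β ∧ β ≤ 1 ∧ UniformLojasiewicz F Set.univ β 1) ∧
      ∀ β : ℝ, 0 < β → β ≤ 1 → UniformLojasiewicz F Set.univ β 1 →
        ∀ δ : ℝ, 0 < δ → δ < 1 →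
          LocalRates P F (sgd g γ Xs θ₀) γ α κ ρ δ β 1) ∧
    -- (iii) global setting
    (GloballyLojasiewicz F →
      (∃ β ζ : ℝ, α / (1 + α) ≤ β ∧ β < 1 ∧ 0 < ζ ∧ GlobalInequality F β ζ) ∧
      ∀ β ζ : ℝ, (α / (1 + α) < β ∧ β < 1 ∨ β = 1 / 2) → 0 < ζ → GlobalInequality F β ζ →
        (β ≤ 1 / 2 →
          (∀ γs : ℝ, 0 < γs → CriticalSteps γ γs →
            ζ ^ (2 + globalLambda α β * ((1 + α) / α))
              * ((1 + α) * L ^ (1 / α) / α) ^ globalLambda α β * α < κ * γs) →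
          ∃ C : ℝ, 0 < C ∧ ∀ δ : ℝ, 0 < δ → δ < 1 → ∀ n : ℕ, 1 ≤ n →
            1 - δ ≤ P.real {ω | F (sgd g γ Xs θ₀ n ω) - (⨅ θ : Vec m, F θ)
              ≤ C / δ * γ n ^ α}) ∧
        (1 / 2 < β →
          0 < globalExponent α ρ β ∧
          ∃ C : ℝ, 0 < C ∧ ∀ δ : ℝ, 0 < δ → δ < 1 → ∀ n : ℕ, 1 ≤ n →
            1 - δ ≤ P.real {ω | F (sgd g γ Xs θ₀ n ω) - (⨅ θ : Vec m, F θ)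
              ≤ C / δ * stepSum γ n ^ (-globalExponent α ρ β)})) := by
  have M : SGDModel P X F g Xs θ₀ L α κ γ :=
    ⟨hX, hg, hXs_meas, hXs_law, hXs_indep, hθ₀_meas, hθ₀, hθ₀_indep, hL, hα, hα', hsmooth, horacle,
      hγ⟩
  have hcont := hsmooth.continuous
  have hG := hsmooth.continuous_gradient hα
  refine ⟨M.ae_tendsto_limitValue, fun δ hδ _ => ?_, ⟨⟨1, one_pos, le_rfl, hloj.uniform_univ⟩,
    fun β _ _ h δ hδ _ => ?_⟩, fun hglob => ⟨hglob.exists_globalInequality hsmooth hL hα hα'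
      hcoercive, fun β ζ hβ hζ h => ⟨fun hβ2 hcrit => ?_, fun hβ2 => ?_⟩⟩⟩
  -- Half of `δ` is spent on the level set; the other half is left for the rate.
  · obtain ⟨l, hl, hlP⟩ := M.exists_accPoints_subset_levelSet (half_pos hδ)
    obtain ⟨β₀, hβ₀, hβ₀', hβ₀l⟩ :=
      hloj.exists_uniform hG (isCompact_levelSet hcont hcoercive l)
    refine ⟨l, hl, by linarith, ⟨⟨β₀, 1, hβ₀, hβ₀', one_pos, hβ₀l⟩, fun β ζ _ _ hζ h => ?_⟩,
      ⟨⟨β₀, hβ₀, hβ₀', hβ₀l⟩, fun β _ _ h => ?_⟩⟩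
    · exact M.localRates hcoercive hγ_fine hζ hδ hlP h
    · simpa using M.localRates hcoercive hγ_fine one_pos hδ hlP h
  · have hP : 1 - δ / 2 ≤ P.real {ω | accPoints (sgd g γ Xs θ₀) ω ⊆ Set.univ} := by
      simp only [Set.subset_univ, Set.ofPred_true, probReal_univ]
      linarith
    simpa using M.localRates hcoercive hγ_fine one_pos hδ hP h
  · exact M.global_rate_of_le_half hζ hγ_fine h (hβ.imp_left And.left) hβ2 hcrit
  · exact M.global_rate_of_half_lt hζ hγ_fine h hβ2
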